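/- **Theorem 1.2.** Let $n\ge 2$, $m\ge 0$, and let $\Omega\subset\mathbb R^n$ be a bounded open subset with Lipschitz boundary $\Sigma=\partial\Omega$. Let $f=(f^1,\dots,f^m):\mathbb R^n\setminus\Omega\to\mathbb R^m$ be a $C^2$ map (up to the boundary) which is asymptotically flat, i.e. the scalar curvature $S$ of its graph is integrable over $\mathbb R^n\setminus\Omega$ and there is $p>\frac{n-2}2$ such that the partial derivatives satisfy $f_i^\alpha=O(|x|^{-p/2})$ and $f_{ij}^\alpha=O(|x|^{-p/2-1})$ as $|x|\to\infty$, for all $\alpha,i,j$. Assume that $f$ is constant on each connected component of $\Sigma$. Let $M=\{(x,f(x))\}\subset\mathbb R^{n+m}$ be the graph of $f$ with the induced metric $g_{ij}=\delta_{ij}+\sum_\alpha f_i^\alpha f_j^\alpha$ in the coordinates $x$, put $G=\det(g_{ij})$ and $dM=\sqrt G\,dx$, and let $$S^\perp=\sum_{\alpha,\beta}\langle R^\perp(\nabla f^\alpha,\nabla f^\beta)\eta^\beta,\eta^\alpha\rangle ,$$ where $\nabla f^\alpha$ is the gradient of $f^\alpha$ on $M$, $\eta^\alpha=(-Df^\alpha,e_\alpha)$,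 and $R^\perp$ is the curvature of the normal connection $\nabla^\perp$ of $M$ in $\mathbb R^{n+m}$, with the convention $R^\perp(X,Y)=\nabla^\perp_X\nabla^\perp_Y-\nabla^\perp_Y\nabla^\perp_X-\nabla^\perp_{[X,Y]}$. (As $f$ is only $C^2$, the curvature tensor and $R^\perp$ are understood as given by the second fundamental form $B$ and the shape operators $A_\xi$, i.e. by $\langle R(X,Y)Z,W\rangle=\langle B(X,W),B(Y,Z)\rangle-\langle B(X,Z),B(Y,W)\rangle$ and $R^\perp(X,Y)\xi=B(X,A_\xi Y)-B(Y,A_\xi X)$.) Then $(S+S^\perp)G^{-1/2}$ is integrable over $M$, $\frac{|Df|^2}{1+|Df|^2}H^\Sigma$ is integrable over $\Sigma$, and the ADM mass of $M$, $$m_{ADM}=\lim_{r\to\infty}\frac1{2(n-1)\omega_{n-1}}\int_{|x|=r}\sum_{i,j}\Big(\frac{\partial g_{ij}}{\partial x_i}-\frac{\partial g_{ii}}{\partial x_j}\Big)\frac{x_j}{r}\,d\mu ,$$ exists and is given by $$m_{ADM}=\frac1{2(n-1)\omega_{n-1}}\left(\int_M (S+S^\perp)\frac1{\sqrt G}\,dM+\int_\Sigma\frac{|Df|^2}{1+|Df|^2}\,H^\Sigma\,d\Sigma\right).$$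 Here $\omega_{n-1}$ is the area of the unit sphere of $\mathbb R^n$, $|Df|^2=\sum_{\alpha,i}(f_i^\alpha)^2$, and $H^\Sigma=-\operatorname{div}\nu$ is the mean curvature (sum of the principal curvatures) of $\Sigma$ in the direction of the unit normal $\nu$ pointing into $\Omega$, so that it is positive on round spheres. At points near which $\Sigma$ is not a $C^2$ hypersurface, where $H^\Sigma$ is not defined (there $Df$ vanishes), the integrand over $\Sigma$ is taken to be $0$. -/

import Mathlib

open MeasureTheory Filter Topology Asymptotics
open scoped RealInnerProductSpace Matrix

noncomputable section

namespace GraphMass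

/-- Euclidean space `ℝ^k`. -/
abbrev E (k : ℕ) := EuclideanSpace ℝ (Fin k)

/-- The Euclidean product `ℝ^n × ℝ^m = ℝ^(n+m)`, in which graphs live. -/
abbrev Amb (n m : ℕ) := WithLp 2 (E n × E m)

/-- The `i`-th canonical basis vector. -/
def e {k : ℕ} (i : Fin k) : E k := EuclideanSpace.single i (1 : ℝ)

/-! ### Derivatives of a map on a domain `D ⊆ ℝ^n` -/

section Derivatives

variable {n m : ℕ} (D : Set (E n)) (f : E n → E m)

/-- First partial derivatives `f_i^α`, one-sided at boundary points of `D`. -/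
def pd (x : E n) (α : Fin m) (i : Fin n) : ℝ :=
  fderivWithin ℝ f D x (e i) α

/-- The second derivative `D²f_x(u, v)`, one-sided at boundary points of `D`. -/
def hess (x u v : E n) : E m :=
  fderivWithin ℝ (fderivWithin ℝ f D) D x u v

/-- Second partial derivatives `f_{ij}^α`. -/
def pd2 (x : E n) (α : Fin m) (i j : Fin n) : ℝ :=
  hess D f x (e i) (e j) α

/-- `|Df|² = |Df^1|² + ⋯ + |Df^m|²`. -/
def normSqDf (x : E n) : ℝ := ∑ α, ∑ i, pd D f x α i ^ 2

/-- The Euclidean gradient `Df^α`. -/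
def gradEuc (x : E n) (α : Fin m) : E n := WithLp.toLp 2 (fun i => pd D f x α i)

end Derivatives

/-! ### Geometry of the graph `M = {(x, f x) | x ∈ D} ⊆ ℝ^(n+m)`

Points of `M` are given by `x ∈ D`, and a tangent vector `∑ u^i ∂_i` of `M` by its coordinate
vector `u ∈ ℝ^n` in the chart `(x, f x) ↦ x`. -/

section Graph

variable {n m : ℕ} (D : Set (E n)) (f : E n → E m)

/-- The tangent vector `∑ u^i ∂_i = (u, Df_x u)` as a vector of `ℝ^(n+m)`. -/
def tangentVec (x u : E n) : Amb n m := WithLp.toLp 2 (u, fderivWithin ℝ f D x u)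

/-- The tangent space of the graph, as a subspace of `ℝ^(n+m)`. -/
def tangentSpace (x : E n) : Submodule ℝ (Amb n m) :=
  Submodule.span ℝ (Set.range (tangentVec D f x))

/-- The normal frame `η^α = (-Df^α, e_α)`. -/
def normalFrame (x : E n) (α : Fin m) : Amb n m :=
  WithLp.toLp 2 (-gradEuc D f x α, e α)

/-- The natural (induced) metric `g_{ij} = ⟨∂_i, ∂_j⟩ = δ_{ij} + f_i^α f_j^α`. -/
def metric (x : E n) : Matrix (Fin n) (Fin n) ℝ :=
  Matrix.of fun i j => ⟪tangentVec D f x (e i), tangentVec D f x (e j)⟫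

/-- `G = det (g_{ij})`. -/
def detMetric (x : E n) : ℝ := (metric D f x).det

/-- The Riemannian volume `dM = √G dx` of the graph over `D`, in the chart `(x, f x) ↦ x`. -/
def volumeM : Measure (E n) :=
  (volume.restrict D).withDensity (fun x => ENNReal.ofReal (Real.sqrt (detMetric D f x)))

/-- The gradient `∇f^α = g^{jk} f_k^α ∂_j` with respect to the metric of the graph. -/
def gradM (x : E n) (α : Fin m) : E n :=
  WithLp.toLp 2 ((metric D f x)⁻¹ *ᵥ fun k => pd D f x α k)

/-- The second fundamental form `B(u, v)`: the normal component of the second derivative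
`(0, D²f(u, v))` of the parametrization `x ↦ (x, f x)`. -/
def secondFF (x u v : E n) : Amb n m :=
  (tangentSpace D f x)ᗮ.starProjection (WithLp.toLp 2 (0, hess D f x u v))

/-- The shape operator `A_ξ` of a normal vector `ξ`: `g(A_ξ u, v) = ⟨B(u, v), ξ⟩`. -/
def shapeOp (x : E n) (ξ : Amb n m) (u : E n) : E n :=
  WithLp.toLp 2 ((metric D f x)⁻¹ *ᵥ fun k => ⟪secondFF D f x u (e k), ξ⟫)

/-- The curvature tensor `⟨R(u, v) w, z⟩` of the graph, with
`R(X, Y) = ∇_X ∇_Y - ∇_Y ∇_X - ∇_[X, Y]`. For a graph that is only `C²` (so that its metric is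
only `C¹`) the curvature of the submanifold is the one given by the second fundamental form. -/
def curv (x u v w z : E n) : ℝ :=
  ⟪secondFF D f x u z, secondFF D f x v w⟫ - ⟪secondFF D f x u w, secondFF D f x v z⟫

/-- The scalar curvature `S = g^{ij} g^{kl} ⟨R(∂_i, ∂_l) ∂_k, ∂_j⟩`. -/
def scalarCurv (x : E n) : ℝ :=
  ∑ i, ∑ j, ∑ k, ∑ l, (metric D f x)⁻¹ i j * (metric D f x)⁻¹ k l *
    curv D f x (e i) (e l) (e k) (e j)

/-- The normal curvature tensor `R^⊥(u, v) ξ` of the graph in `ℝ^(n+m)`, with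
`R^⊥(X, Y) = ∇^⊥_X ∇^⊥_Y - ∇^⊥_Y ∇^⊥_X - ∇^⊥_[X, Y]`. For a graph that is only `C²` it is the one
given by the second fundamental form and the shape operators. -/
def normalCurv (x u v : E n) (ξ : Amb n m) : Amb n m :=
  secondFF D f x u (shapeOp D f x ξ v) - secondFF D f x v (shapeOp D f x ξ u)

/-- `S^⊥ = ⟨R^⊥(∇f^α, ∇f^β) η^β, η^α⟩`, summed over `α` and `β`. -/
def sPerp (x : E n) : ℝ :=
  ∑ α, ∑ β, ⟪normalCurv D f x (gradM D f x α) (gradM D f x β) (normalFrame D f x β),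
    normalFrame D f x α⟫

end Graph

/-! ### Asymptotically flat maps and the ADM mass -/

/-- A `C²` map `f : ℝ^n \ Ω → ℝ^m` is asymptotically flat if the scalar curvature of its graph is
integrable and, for some `p > (n - 2) / 2`, `f_i^α = O(|x|^{-p/2})` and
`f_{ij}^α = O(|x|^{-p/2-1})` at infinity. -/
structure IsAsymptoticallyFlat {n m : ℕ} (Ω : Set (E n)) (f : E n → E m) : Prop where
  contDiffOn : ContDiffOn ℝ 2 f Ωᶜ
  integrable_scalarCurv : IntegrableOn (scalarCurv Ωᶜ f) Ωᶜ
  decay : ∃ p : ℝ, ((n : ℝ) - 2) / 2 < p ∧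
    (∀ α i, (fun x => pd Ωᶜ f x α i) =O[Bornology.cobounded (E n)]
      fun x => ‖x‖ ^ (-p / 2)) ∧
    (∀ α i j, (fun x => pd2 Ωᶜ f x α i j) =O[Bornology.cobounded (E n)]
      fun x => ‖x‖ ^ (-p / 2 - 1))

/-- The `(k-1)`-dimensional surface measure of hypersurfaces of `ℝ^k`, normalized to agree with
the Euclidean area. -/
def area {k : ℕ} : Measure (E k) := Measure.euclideanHausdorffMeasure (k - 1)

/-- `ω_{k-1}`, the area of the unit sphere of `ℝ^k`. -/
def sphereArea (k : ℕ) : ℝ := (area (k := k)).real (Metric.sphere 0 1)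

/-- `g_{ijk} = ∂ g_{ij} / ∂ x^k`. -/
def dMetric {n : ℕ} (g : E n → Matrix (Fin n) (Fin n) ℝ) (i j k : Fin n) (x : E n) : ℝ :=
  fderiv ℝ (fun y => g y i j) x (e k)

/-- The metric `g`, given in coordinates of `ℝ^n` near infinity, has ADM mass `μ`: the limit as
`r → ∞` of `1 / (2 (n-1) ω_{n-1}) ∫_{S_r} (g_{iji} - g_{iij}) ν_j`, `ν = x / r`, exists and
equals `μ`. -/
def HasADMMass {n : ℕ} (g : E n → Matrix (Fin n) (Fin n) ℝ) (μ : ℝ) : Prop :=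
  Tendsto (fun r : ℝ => 1 / (2 * ((n : ℝ) - 1) * sphereArea n) *
    ∫ x in Metric.sphere (0 : E n) r,
      ∑ i, ∑ j, (dMetric g i j i x - dMetric g i i j x) * (x j / r) ∂area) atTop (𝓝 μ)

/-! ### Boundaries -/

/-- `Ω` has Lipschitz boundary: near every boundary point, and up to a rotation, `Ω` is the region
under the graph of a Lipschitz function over a hyperplane `v^⊥`. -/
def HasLipschitzBoundary {n : ℕ} (Ω : Set (E n)) : Prop :=
  ∀ x₀ ∈ frontier Ω, ∃ v : E n, ‖v‖ = 1 ∧ ∃ (K : NNReal) (h : (ℝ ∙ v)ᗮ → ℝ), LipschitzWith K h ∧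
    ∀ᶠ x in 𝓝 x₀, x ∈ Ω ↔ ⟪v, x⟫ < h ((ℝ ∙ v)ᗮ.orthogonalProjectionOnto x)

/-- `ρ` is a `C²` defining function of `Ω` near the boundary point `x`. It exists exactly when the
boundary of `Ω` is a `C²` hypersurface near `x` with `Ω` locally on one side. -/
structure IsDefiningFunctionAt {n : ℕ} (Ω : Set (E n)) (x : E n) (ρ : E n → ℝ) : Prop where
  contDiffAt : ContDiffAt ℝ 2 ρ x
  map_eq_zero : ρ x = 0
  gradient_ne_zero : gradient ρ x ≠ 0
  mem_iff : ∀ᶠ y in 𝓝 x, y ∈ Ω ↔ ρ y < 0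

/-- The divergence of a vector field on `ℝ^n`. -/
def divergence {n : ℕ} (V : E n → E n) (x : E n) : ℝ := ∑ i, fderiv ℝ V x (e i) i

/-- The field of unit normals to the level sets of a defining function `ρ`, in the direction
pointing into `Ω = {ρ < 0}`, i.e. out of the domain `ℝ^n \ Ω`. -/
def unitNormal {n : ℕ} (ρ : E n → ℝ) (x : E n) : E n := -(‖gradient ρ x‖⁻¹ • gradient ρ x)

open Classical in
/-- The mean curvature `H^Σ = -div ν` (the sum of the principal curvatures) of `Σ = ∂Ω` in the
direction of the unit normal `ν` pointing into `Ω`; it is positive on round spheres. It does not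
depend on the defining function. At points near which `Σ` is not a `C²` hypersurface it has no
meaning, and is set to zero. -/
def meanCurv {n : ℕ} (Ω : Set (E n)) (x : E n) : ℝ :=
  if h : ∃ ρ, IsDefiningFunctionAt Ω x ρ then -divergence (unitNormal h.choose) x else 0

end GraphMass

end

/-! The proof rests on one pointwise identity. Consider on the domain the field X = ∑_α (tr_g D²f^α)
∇f^α - (D²f^α(∇f^α, ·))^♯, with traces, gradients and ♯ taken in the metric g of the graph. Its
Euclidean divergence is S + S^⊥. The third derivatives of f cancel because they are symmetric
(`sum_fluxDerivJ`). What remains is quadratic in D²f and splits into the Gauss expression for S and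
the normal curvature term S^⊥ (`scalarCurv_add_sPerp`). The formula is then the divergence theorem
for X between Σ and a large sphere (`integral_sphere_flux`), followed by r → ∞; the density √G of dM
cancels the factor 1/√G.

At the sphere, replacing g by δ in X gives ∑_α ∑_i (f_ii f_j - f_i f_ij), which is exactly the ADM
integrand (`mass_integrand_eq`). The error is cubic in Df and linear in D²f, hence O(r^(-2p-1)), and
its integral over the sphere of radius r tends to zero because 2p > n - 2
(`tendsto_integral_sphere_sub`). Likewise S^⊥ is quadratic in both Df and D²f, hence O(|x|^(-2p-2)),
which is integrable at infinity; S is integrable by hypothesis.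

On Σ the map f is locally constant, so every Df^α is a multiple of the unit normal ν, and the
tangential Hessian of f^α is a multiple of that of a defining function. This gives X · ν =
-|Df|²/(1+|Df|²) H (`graphDensity_mul_meanCurv`).

Two defects of regularity shape the argument. First, f is only C², so X is only continuous. Both X
and S + S^⊥ are continuous functions of the first and second derivatives of f, so the identity
survives mollification and holds weakly, tested with Lipschitz functions (`weak_divergence`).
Second, Σ is only Lipschitz. Cut-offs in a Lipschitz chart turn the weak identity into a flux
integral over a hyperplane (`chart_divergence`), which must be converted into Hausdorff area only
where X ≠ 0. There Df ≠ 0, and since f is constant along the boundary, this forces the boundary to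
be C² (`contDiffAt_of_level`), so that the area formula applies and the mean curvature is defined.
At the other boundary points X and the boundary integrand vanish together, and nothing needs to be
known about Σ. -/

noncomputable section

namespace GraphMass

/-! ### The flux field and its divergence as functions of the jets -/

section Jets

variable {n m : ℕ}

/-- The metric of a graph in terms of the first derivatives. -/
def metricJ (U : Matrix (Fin m) (Fin n) ℝ) : Matrix (Fin n) (Fin n) ℝ := 1 + Uᵀ * U

/-- The inverse metric of a graph in terms of the first derivatives. -/
def invJ (U : Matrix (Fin m) (Fin n) ℝ) : Matrix (Fin n) (Fin n) ℝ := (metricJ U)⁻¹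

/-- The flux field `∑_α tr_g(D²f^α) ∇f^α - D²f^α(∇f^α, ·)^♯` in terms of the derivatives. -/
def fluxJ (U : Matrix (Fin m) (Fin n) ℝ) (H : Fin m → Matrix (Fin n) (Fin n) ℝ) (j : Fin n) : ℝ :=
  ∑ α, ((invJ U * H α).trace * (invJ U *ᵥ U α) j
    - (invJ U *ᵥ (H α *ᵥ (invJ U *ᵥ U α))) j)

/-- The divergence of the flux field in terms of the derivatives. -/
def divJ (U : Matrix (Fin m) (Fin n) ℝ) (H : Fin m → Matrix (Fin n) (Fin n) ℝ) : ℝ :=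
  ∑ α, ∑ β, (((1 : Matrix (Fin m) (Fin m) ℝ) α β - U α ⬝ᵥ (invJ U *ᵥ U β)) *
      ((invJ U * H α).trace * (invJ U * H β).trace - ((invJ U * H α) * (invJ U * H β)).trace)
    + ((H α *ᵥ (invJ U *ᵥ U α)) ⬝ᵥ (invJ U *ᵥ (H β *ᵥ (invJ U *ᵥ U β)))
      - (H α *ᵥ (invJ U *ᵥ U β)) ⬝ᵥ (invJ U *ᵥ (H β *ᵥ (invJ U *ᵥ U α)))))

lemma posDef_metricJ (U : Matrix (Fin m) (Fin n) ℝ) : (metricJ U).PosDef := by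
  unfold metricJ
  have h := Matrix.posSemidef_conjTranspose_mul_self U
  rw [Matrix.conjTranspose_eq_transpose_of_trivial] at h
  exact Matrix.PosDef.one.add_posSemidef h

lemma det_metricJ_pos (U : Matrix (Fin m) (Fin n) ℝ) : 0 < (metricJ U).det :=
  (posDef_metricJ U).det_pos

lemma invJ_mul (U : Matrix (Fin m) (Fin n) ℝ) : invJ U * metricJ U = 1 :=
  Matrix.nonsing_inv_mul _ (isUnit_iff_ne_zero.2 (det_metricJ_pos U).ne')

lemma mul_invJ (U : Matrix (Fin m) (Fin n) ℝ) : metricJ U * invJ U = 1 :=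
  Matrix.mul_nonsing_inv _ (isUnit_iff_ne_zero.2 (det_metricJ_pos U).ne')

lemma invJ_symm (U : Matrix (Fin m) (Fin n) ℝ) (i j : Fin n) : invJ U i j = invJ U j i := by
  have h : (metricJ U)ᵀ = metricJ U := by simp [metricJ]
  have : (invJ U)ᵀ = invJ U := by rw [invJ, Matrix.transpose_nonsing_inv, h]
  conv_lhs => rw [← this]
  rfl

lemma invJ_transpose (U : Matrix (Fin m) (Fin n) ℝ) : (invJ U)ᵀ = invJ U := by
  ext i j; exact invJ_symm U j i

lemma metricJ_apply (U : Matrix (Fin m) (Fin n) ℝ) (i j : Fin n) :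
    metricJ U i j = (1 : Matrix (Fin n) (Fin n) ℝ) i j + ∑ β, U β i * U β j := by
  simp [metricJ, Matrix.mul_apply]

lemma continuous_invJ : Continuous (invJ : Matrix (Fin m) (Fin n) ℝ → _) := by
  have h1 : Continuous (metricJ : Matrix (Fin m) (Fin n) ℝ → _) := by
    unfold metricJ; fun_prop
  have : (invJ : Matrix (Fin m) (Fin n) ℝ → _) =
      fun U => ((metricJ U).det)⁻¹ • (metricJ U).adjugate := by
    ext1 U
    rw [invJ, Matrix.inv_def, Ring.inverse_eq_inv']
  rw [this]
  exact (h1.matrix_det.inv₀ fun U => (det_metricJ_pos U).ne').smul h1.matrix_adjugate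

lemma continuous_fluxJ (j : Fin n) :
    Continuous fun p : Matrix (Fin m) (Fin n) ℝ × (Fin m → Matrix (Fin n) (Fin n) ℝ) =>
      fluxJ p.1 p.2 j := by
  have h : Continuous fun p : Matrix (Fin m) (Fin n) ℝ × (Fin m → Matrix (Fin n) (Fin n) ℝ) =>
    invJ p.1 := continuous_invJ.comp continuous_fst
  have hU : ∀ α, Continuous fun p : Matrix (Fin m) (Fin n) ℝ ×
      (Fin m → Matrix (Fin n) (Fin n) ℝ) => p.1 α := fun α => by fun_prop
  have hH : ∀ α, Continuous fun p : Matrix (Fin m) (Fin n) ℝ ×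
      (Fin m → Matrix (Fin n) (Fin n) ℝ) => p.2 α := fun α => by fun_prop
  unfold fluxJ
  refine continuous_finsetSum _ fun α _ => ?_
  have hv := h.matrix_mulVec (hU α)
  exact ((h.matrix_mul (hH α)).matrix_trace.mul ((continuous_apply j).comp hv)).sub
    ((continuous_apply j).comp (h.matrix_mulVec ((hH α).matrix_mulVec hv)))

/-- Only derivatives of order at most two enter. Continuity in them is what lets the divergence
identity pass from smooth to C² maps, and compactness of bounded sets of jets then gives the uniform
bounds. -/
lemma continuous_divJ :
    Continuous fun p : Matrix (Fin m) (Fin n) ℝ × (Fin m → Matrix (Fin n) (Fin n) ℝ) =>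
      divJ p.1 p.2 := by
  have h : Continuous fun p : Matrix (Fin m) (Fin n) ℝ × (Fin m → Matrix (Fin n) (Fin n) ℝ) =>
    invJ p.1 := continuous_invJ.comp continuous_fst
  have hU : ∀ α, Continuous fun p : Matrix (Fin m) (Fin n) ℝ ×
      (Fin m → Matrix (Fin n) (Fin n) ℝ) => p.1 α := fun α => by fun_prop
  have hH : ∀ α, Continuous fun p : Matrix (Fin m) (Fin n) ℝ ×
      (Fin m → Matrix (Fin n) (Fin n) ℝ) => p.2 α := fun α => by fun_prop
  have hv := fun α => h.matrix_mulVec (hU α)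
  have hP := fun α => h.matrix_mul (hH α)
  have hw := fun α β => (hH α).matrix_mulVec (hv β)
  unfold divJ
  refine continuous_finsetSum _ fun α _ => continuous_finsetSum _ fun β _ => ?_
  exact ((continuous_const.sub ((hU α).dotProduct (hv β))).mul
    (((hP α).matrix_trace.mul (hP β).matrix_trace).sub ((hP α).matrix_mul (hP β)).matrix_trace)).add
    (((hw α α).dotProduct (h.matrix_mulVec (hw β β))).sub
      ((hw α β).dotProduct (h.matrix_mulVec (hw β α))))

end Jets

/-! ### Derivatives of the flux field along curves of jets -/

section JetDerivatives

variable {n m : ℕ}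

lemma contDiff_det {V ι : Type*} [NormedAddCommGroup V] [NormedSpace ℝ V] [Fintype ι]
    [DecidableEq ι] {k : ℕ∞} {A : V → Matrix ι ι ℝ}
    (h : ∀ i j, ContDiff ℝ k fun x => A x i j) : ContDiff ℝ k fun x => (A x).det := by
  simp only [Matrix.det_apply']
  exact ContDiff.sum fun σ _ => contDiff_const.mul (contDiff_prod fun i _ => h _ _)

lemma contDiff_invJ {V : Type*} [NormedAddCommGroup V] [NormedSpace ℝ V]
    {k : ℕ∞} {U : V → Matrix (Fin m) (Fin n) ℝ}
    (h : ∀ i j, ContDiff ℝ k fun x => U x i j) (i j : Fin n) :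
    ContDiff ℝ k fun x => invJ (U x) i j := by
  have h1 : ∀ i j, ContDiff ℝ k fun x => metricJ (U x) i j := fun i j => by
    simp only [metricJ_apply]
    exact contDiff_const.add (ContDiff.sum fun β _ => (h β i).mul (h β j))
  have : (fun x => invJ (U x) i j) =
      fun x => ((metricJ (U x)).det)⁻¹ * (metricJ (U x)).adjugate i j := by
    ext1 x
    rw [invJ, Matrix.inv_def, Ring.inverse_eq_inv', Matrix.smul_apply, smul_eq_mul]
  rw [this]
  refine ((contDiff_det h1).inv fun x => (det_metricJ_pos _).ne').mul ?_
  simp only [Matrix.adjugate_apply]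
  refine contDiff_det fun p q => ?_
  by_cases hp : p = j
  · subst hp; simp only [Matrix.updateRow_self]; exact contDiff_const
  · simp only [Matrix.updateRow_ne hp]; exact h1 p q

lemma contDiff_fluxJ {V : Type*} [NormedAddCommGroup V] [NormedSpace ℝ V]
    {k : ℕ∞} {U : V → Matrix (Fin m) (Fin n) ℝ} {H : V → Fin m → Matrix (Fin n) (Fin n) ℝ}
    (h : ∀ i j, ContDiff ℝ k fun x => U x i j) (h' : ∀ α i j, ContDiff ℝ k fun x => H x α i j)
    (j : Fin n) :
    ContDiff ℝ k fun x => fluxJ (U x) (H x) j := by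
  have ha := contDiff_invJ h
  simp only [fluxJ, Matrix.trace, Matrix.diag, Matrix.mul_apply, Matrix.mulVec, dotProduct]
  refine ContDiff.sum fun α _ => ?_
  refine ContDiff.sub (ContDiff.mul ?_ ?_) ?_
  · exact ContDiff.sum fun p _ => ContDiff.sum fun q _ => (ha _ _).mul (h' _ _ _)
  · exact ContDiff.sum fun p _ => (ha _ _).mul (h _ _)
  · exact ContDiff.sum fun p _ => (ha _ _).mul (ContDiff.sum fun q _ => (h' _ _ _).mul
      (ContDiff.sum fun r _ => (ha _ _).mul (h _ _)))

variable {U : ℝ → Matrix (Fin m) (Fin n) ℝ} {U' : Matrix (Fin m) (Fin n) ℝ} {t : ℝ}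

/-- Differentiating `invJ U * metricJ U = 1` gives -a g' a with g' = U'ᵀU + UᵀU', and symmetry of a
writes this as outer products. The `ContDiff` hypothesis supplies the existence of the derivative,
which the product rule then determines. -/
lemma hasDerivAt_invJ (hC : ∀ α i, ContDiff ℝ 1 fun t => U t α i)
    (hU : ∀ α i, HasDerivAt (fun t => U t α i) (U' α i) t) (i k : Fin n) :
    HasDerivAt (fun t => invJ (U t) i k)
      (-∑ β, ((invJ (U t) *ᵥ U' β) i * (invJ (U t) *ᵥ U t β) k
        + (invJ (U t) *ᵥ U t β) i * (invJ (U t) *ᵥ U' β) k)) t := by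
  set a := invJ (U t) with ha
  have hd : ∀ i k, HasDerivAt (fun t => invJ (U t) i k) (deriv (fun t => invJ (U t) i k) t) t :=
    fun i k => ((contDiff_invJ (k := 1) hC i k).differentiable (by simp) t).hasDerivAt
  set a' : Matrix (Fin n) (Fin n) ℝ := Matrix.of fun i k => deriv (fun t => invJ (U t) i k) t
  have hg : ∀ i k, HasDerivAt (fun t => metricJ (U t) i k)
      ((U'ᵀ * U t + (U t)ᵀ * U') i k) t := fun i k => by
    simp only [metricJ_apply, Matrix.add_apply, Matrix.mul_apply, Matrix.transpose_apply]
    rw [← Finset.sum_add_distrib]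
    exact (HasDerivAt.fun_sum fun β _ => (hU β i).mul (hU β k)).const_add _
  have h1 : a' * metricJ (U t) + a * (U'ᵀ * U t + (U t)ᵀ * U') = 0 := by
    ext i l
    have : HasDerivAt (fun t => ∑ k, invJ (U t) i k * metricJ (U t) k l)
        (∑ k, (a' i k * metricJ (U t) k l + a i k * (U'ᵀ * U t + (U t)ᵀ * U') k l)) t :=
      HasDerivAt.fun_sum fun k _ => (hd i k).mul (hg k l)
    have h0 : (fun t => ∑ k, invJ (U t) i k * metricJ (U t) k l) = fun _ =>
        (1 : Matrix (Fin n) (Fin n) ℝ) i l := by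
      ext1 t
      rw [← invJ_mul (U t), Matrix.mul_apply]
    rw [h0] at this
    have := this.unique (hasDerivAt_const _ _)
    rw [Finset.sum_add_distrib] at this
    simpa [Matrix.mul_apply] using this
  have h2 : a' = -(a * (U'ᵀ * U t + (U t)ᵀ * U') * a) := by
    have := congrArg (· * a) h1
    simp only [add_mul, zero_mul, mul_assoc a' , ha, mul_invJ, mul_one] at this
    rw [eq_neg_iff_add_eq_zero, ha, mul_assoc, ← this]
    simp [mul_add, add_mul, mul_assoc]
  have h3 : a' i k = -∑ β, ((a *ᵥ U' β) i * (a *ᵥ U t β) k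
        + (a *ᵥ U t β) i * (a *ᵥ U' β) k) := by
    have hs : ∀ (V : Matrix (Fin m) (Fin n) ℝ) (β k), (V * a) β k = (a *ᵥ V β) k := by
      intro V β k
      simp only [Matrix.mul_apply, Matrix.mulVec, dotProduct]
      exact Finset.sum_congr rfl fun p _ => by rw [ha, invJ_symm, mul_comm]
    have hs' : ∀ (V : Matrix (Fin m) (Fin n) ℝ) (β i), (a * Vᵀ) i β = (a *ᵥ V β) i := by
      intro V β k
      simp only [Matrix.mul_apply, Matrix.mulVec, dotProduct, Matrix.transpose_apply]
    rw [h2, Matrix.neg_apply, Matrix.mul_add, Matrix.add_mul, Matrix.add_apply,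
      ← Matrix.mul_assoc, ← Matrix.mul_assoc, Matrix.mul_assoc (a * U'ᵀ),
      Matrix.mul_assoc (a * (U t)ᵀ), Matrix.mul_apply,
      Matrix.mul_apply, Finset.sum_add_distrib]
    simp only [hs, hs']
  rw [← h3]
  exact hd i k

lemma invJ_mulVec_dotProduct (U : Matrix (Fin m) (Fin n) ℝ) (p q : Fin n → ℝ) :
    (invJ U *ᵥ p) ⬝ᵥ q = p ⬝ᵥ (invJ U *ᵥ q) := by
  rw [Matrix.dotProduct_mulVec, ← Matrix.mulVec_transpose, invJ_transpose]

lemma hasDerivAt_grad (hC : ∀ α i, ContDiff ℝ 1 fun t => U t α i)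
    (hU : ∀ α i, HasDerivAt (fun t => U t α i) (U' α i) t) (α : Fin m) (i : Fin n) :
    HasDerivAt (fun t => (invJ (U t) *ᵥ U t α) i)
      ((invJ (U t) *ᵥ U' α) i - ∑ β, ((invJ (U t) *ᵥ U' β) i * (U t β ⬝ᵥ (invJ (U t) *ᵥ U t α))
        + (invJ (U t) *ᵥ U t β) i * (U' β ⬝ᵥ (invJ (U t) *ᵥ U t α)))) t := by
  have h : HasDerivAt (fun t => ∑ k, invJ (U t) i k * U t α k) _ t :=
    HasDerivAt.fun_sum fun k _ => (hasDerivAt_invJ hC hU i k).mul (hU α k)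
  simp only [← invJ_mulVec_dotProduct]
  refine h.congr_deriv ?_
  rw [Finset.sum_add_distrib, add_comm, sub_eq_add_neg]
  congr 1
  simp only [neg_mul, Finset.sum_neg_distrib, Finset.sum_mul]
  rw [Finset.sum_comm]
  congr 1
  refine Finset.sum_congr rfl fun β _ => ?_
  simp only [dotProduct, Finset.mul_sum, ← Finset.sum_add_distrib]
  exact Finset.sum_congr rfl fun k _ => by ring

variable {H : ℝ → Fin m → Matrix (Fin n) (Fin n) ℝ} {T : Fin m → Matrix (Fin n) (Fin n) ℝ}

/-- The two halves of the derivative of the inverse metric contribute equally because H is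
symmetric; hence the factor 2. -/
lemma hasDerivAt_traceJ (hC : ∀ α i, ContDiff ℝ 1 fun t => U t α i)
    (hU : ∀ α i, HasDerivAt (fun t => U t α i) (U' α i) t)
    (hH : ∀ α i k, HasDerivAt (fun t => H t α i k) (T α i k) t)
    (hsymm : ∀ α i k, H t α i k = H t α k i) (α : Fin m) :
    HasDerivAt (fun t => (invJ (U t) * H t α).trace)
      ((invJ (U t) * T α).trace
        - 2 * ∑ β, (invJ (U t) *ᵥ U' β) ⬝ᵥ (H t α *ᵥ (invJ (U t) *ᵥ U t β))) t := by
  have h : HasDerivAt (fun t => ∑ i, ∑ k, invJ (U t) i k * H t α k i) _ t :=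
    HasDerivAt.fun_sum fun i _ => HasDerivAt.fun_sum fun k _ =>
      (hasDerivAt_invJ hC hU i k).mul (hH α k i)
  simp only [Matrix.trace, Matrix.diag, Matrix.mul_apply]
  refine h.congr_deriv ?_
  simp only [Finset.sum_add_distrib]
  rw [add_comm, sub_eq_add_neg]
  congr 1
  simp only [neg_mul, Finset.sum_neg_distrib]
  congr 1
  rw [two_mul]
  have e1 : ∑ i, ∑ k, ∑ β, (invJ (U t) *ᵥ U' β) i * (invJ (U t) *ᵥ U t β) k * H t α k i
      = ∑ β, (invJ (U t) *ᵥ U' β) ⬝ᵥ (H t α *ᵥ (invJ (U t) *ᵥ U t β)) := by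
    simp_rw [Finset.sum_comm (t := (Finset.univ : Finset (Fin m)))]
    refine Finset.sum_congr rfl fun β _ => ?_
    rw [dotProduct]
    refine Finset.sum_congr rfl fun i _ => ?_
    have : (H t α *ᵥ (invJ (U t) *ᵥ U t β)) i = ∑ k, H t α i k * (invJ (U t) *ᵥ U t β) k := rfl
    rw [this, Finset.mul_sum]
    exact Finset.sum_congr rfl fun k _ => by rw [hsymm α k i]; ring
  have e2 : ∑ i, ∑ k, ∑ β, (invJ (U t) *ᵥ U t β) i * (invJ (U t) *ᵥ U' β) k * H t α k i
      = ∑ β, (invJ (U t) *ᵥ U' β) ⬝ᵥ (H t α *ᵥ (invJ (U t) *ᵥ U t β)) := by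
    rw [← e1, Finset.sum_comm]
    refine Finset.sum_congr rfl fun i _ => Finset.sum_congr rfl fun k _ =>
      Finset.sum_congr rfl fun β _ => by rw [hsymm]; ring
  rw [← e1]
  nth_rewrite 2 [e1]
  rw [← e2]
  simp only [← Finset.sum_add_distrib]
  refine Finset.sum_congr rfl fun i _ => Finset.sum_congr rfl fun k _ => ?_
  rw [Finset.sum_mul]
  exact Finset.sum_congr rfl fun β _ => by ring

lemma hasDerivAt_hessGrad (hC : ∀ α i, ContDiff ℝ 1 fun t => U t α i)
    (hU : ∀ α i, HasDerivAt (fun t => U t α i) (U' α i) t)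
    (hH : ∀ α i k, HasDerivAt (fun t => H t α i k) (T α i k) t) (α : Fin m)
    {v' : Fin n → ℝ} (hv : ∀ i, HasDerivAt (fun t => (invJ (U t) *ᵥ U t α) i) (v' i) t)
    (j : Fin n) :
    HasDerivAt (fun t => (invJ (U t) *ᵥ (H t α *ᵥ (invJ (U t) *ᵥ U t α))) j)
      ((invJ (U t) *ᵥ (T α *ᵥ (invJ (U t) *ᵥ U t α))) j + (invJ (U t) *ᵥ (H t α *ᵥ v')) j
        - ∑ β, ((invJ (U t) *ᵥ U' β) j *
            ((invJ (U t) *ᵥ U t β) ⬝ᵥ (H t α *ᵥ (invJ (U t) *ᵥ U t α)))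
          + (invJ (U t) *ᵥ U t β) j *
            ((invJ (U t) *ᵥ U' β) ⬝ᵥ (H t α *ᵥ (invJ (U t) *ᵥ U t α))))) t := by
  have hw : ∀ k, HasDerivAt (fun t => (H t α *ᵥ (invJ (U t) *ᵥ U t α)) k)
      ((T α *ᵥ (invJ (U t) *ᵥ U t α)) k + (H t α *ᵥ v') k) t := fun k => by
    have h : HasDerivAt (fun t => ∑ i, H t α k i * (invJ (U t) *ᵥ U t α) i) _ t :=
      HasDerivAt.fun_sum fun i _ => (hH α k i).mul (hv i)
    refine h.congr_deriv ?_
    rw [Finset.sum_add_distrib]; rfl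
  have h : HasDerivAt (fun t => ∑ k, invJ (U t) j k * (H t α *ᵥ (invJ (U t) *ᵥ U t α)) k) _ t :=
    HasDerivAt.fun_sum fun k _ => (hasDerivAt_invJ hC hU j k).mul (hw k)
  refine h.congr_deriv ?_
  rw [Finset.sum_add_distrib, add_comm, sub_eq_add_neg]
  congr 1
  · simp only [mul_add, Finset.sum_add_distrib]; rfl
  · simp only [neg_mul, Finset.sum_neg_distrib, Finset.sum_mul]
    rw [Finset.sum_comm]
    congr 1
    refine Finset.sum_congr rfl fun β _ => ?_
    simp only [dotProduct, Finset.mul_sum, ← Finset.sum_add_distrib]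
    exact Finset.sum_congr rfl fun k _ => by ring

/-- The derivative of the `j`-th component of the flux field along a curve of jets. -/
def fluxDerivJ (U U' : Matrix (Fin m) (Fin n) ℝ) (H T : Fin m → Matrix (Fin n) (Fin n) ℝ)
    (j : Fin n) : ℝ :=
  ∑ α, (((invJ U * T α).trace
        - 2 * ∑ β, (invJ U *ᵥ U' β) ⬝ᵥ (H α *ᵥ (invJ U *ᵥ U β))) * (invJ U *ᵥ U α) j
      + (invJ U * H α).trace * ((invJ U *ᵥ U' α) j
        - ∑ β, ((invJ U *ᵥ U' β) j * (U β ⬝ᵥ (invJ U *ᵥ U α))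
          + (invJ U *ᵥ U β) j * (U' β ⬝ᵥ (invJ U *ᵥ U α))))
      - ((invJ U *ᵥ (T α *ᵥ (invJ U *ᵥ U α))) j
        + (invJ U *ᵥ (H α *ᵥ fun i => (invJ U *ᵥ U' α) i
          - ∑ β, ((invJ U *ᵥ U' β) i * (U β ⬝ᵥ (invJ U *ᵥ U α))
            + (invJ U *ᵥ U β) i * (U' β ⬝ᵥ (invJ U *ᵥ U α))))) j
        - ∑ β, ((invJ U *ᵥ U' β) j * ((invJ U *ᵥ U β) ⬝ᵥ (H α *ᵥ (invJ U *ᵥ U α)))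
          + (invJ U *ᵥ U β) j * ((invJ U *ᵥ U' β) ⬝ᵥ (H α *ᵥ (invJ U *ᵥ U α))))))

lemma hasDerivAt_fluxJ (hC : ∀ α i, ContDiff ℝ 1 fun t => U t α i)
    (hU : ∀ α i, HasDerivAt (fun t => U t α i) (U' α i) t)
    (hH : ∀ α i k, HasDerivAt (fun t => H t α i k) (T α i k) t)
    (hsymm : ∀ α i k, H t α i k = H t α k i) (j : Fin n) :
    HasDerivAt (fun t => fluxJ (U t) (H t) j) (fluxDerivJ (U t) U' (H t) T j) t :=
  HasDerivAt.fun_sum fun α _ => ((hasDerivAt_traceJ hC hU hH hsymm α).mul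
    (hasDerivAt_grad hC hU α j)).sub
    (hasDerivAt_hessGrad hC hU hH α (hasDerivAt_grad hC hU α) j)

end JetDerivatives

/-! ### The divergence of the flux field: algebra -/

section JetDivergence

variable {n m : ℕ}

lemma sum_column_dotProduct_mul (P : Matrix (Fin n) (Fin n) ℝ) (x y : Fin n → ℝ) :
    ∑ j, ((fun i => P i j) ⬝ᵥ x) * y j = (P *ᵥ y) ⬝ᵥ x := by
  simp only [dotProduct, Matrix.mulVec, Finset.sum_mul]
  rw [Finset.sum_comm]
  exact Finset.sum_congr rfl fun j _ => Finset.sum_congr rfl fun i _ => by ring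

lemma trace_mul_vecMulVec' (P : Matrix (Fin n) (Fin n) ℝ) (x y : Fin n → ℝ) :
    (P * Matrix.vecMulVec x y).trace = (P *ᵥ x) ⬝ᵥ y := by
  rw [Matrix.mul_vecMulVec, Matrix.trace_vecMulVec]

/-- The j-th derivative of f_i^β is H β i j, so the left side is the divergence of the flux field
when T j is the j-th derivative of H. The third derivatives cancel by full symmetry of T, some of
the quadratic terms cancel only after summing over α and β, and the rest regroups into the S and S^⊥
parts of `divJ`. -/
theorem sum_fluxDerivJ (U : Matrix (Fin m) (Fin n) ℝ) (H : Fin m → Matrix (Fin n) (Fin n) ℝ)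
    (T : Fin n → Fin m → Matrix (Fin n) (Fin n) ℝ) (hH : ∀ α i j, H α i j = H α j i)
    (hT : ∀ α i j k, T j α i k = T k α i j) :
    ∑ j, fluxDerivJ U (Matrix.of fun β i => H β i j) H (T j) j = divJ U H := by
  set a := invJ U with ha
  set v : Fin m → Fin n → ℝ := fun β => a *ᵥ U β with hv
  have k2 : ∀ β j (x : Fin n → ℝ), (fun i => H β i j) ⬝ᵥ x = (H β *ᵥ x) j := fun β j x => by
    simp only [dotProduct, Matrix.mulVec]
    exact Finset.sum_congr rfl fun i _ => by rw [hH]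
  -- All third-derivative terms: contracting a and v with T in two ways gives the same sum because T
  -- is symmetric in j and k.
  have k3 : ∀ α, ∑ j, ((a * T j α).trace * v α j - (a *ᵥ (T j α *ᵥ v α)) j) = 0 := fun α => by
    rw [Finset.sum_sub_distrib, sub_eq_zero]
    simp only [Matrix.trace, Matrix.diag, Matrix.mul_apply, Matrix.mulVec, dotProduct,
      Finset.sum_mul, Finset.mul_sum]
    rw [Finset.sum_comm]
    refine Finset.sum_congr rfl fun p _ => ?_
    rw [Finset.sum_comm]
    refine Finset.sum_congr rfl fun q _ => Finset.sum_congr rfl fun j _ => ?_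
    rw [hT α q j p, ← mul_assoc]
  have k4 : ∀ (α : Fin m) (Z : Matrix (Fin n) (Fin n) ℝ),
      ∑ j, (a *ᵥ (H α *ᵥ fun i => Z i j)) j = (a * H α * Z).trace := fun α Z => by
    rw [Matrix.mul_assoc]; rfl
  have k5 : ∀ α : Fin m, ∑ j, (a *ᵥ (H α *ᵥ fun i => (a * H α) i j
      - ∑ β, ((a * H β) i j * (U β ⬝ᵥ v α) + v β i * (H β *ᵥ v α) j))) j
      = (a * H α * (a * H α)).trace - ∑ β, ((U β ⬝ᵥ v α) * (a * H α * (a * H β)).trace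
        + (H α *ᵥ v β) ⬝ᵥ (a *ᵥ (H β *ᵥ v α))) := fun α => by
    have := k4 α (a * H α - ∑ β, ((U β ⬝ᵥ v α) • (a * H β) + Matrix.vecMulVec (v β) (H β *ᵥ v α)))
    rw [Matrix.mul_sub, Matrix.trace_sub, Finset.mul_sum, Matrix.trace_sum] at this
    simp only [Matrix.mul_add, Matrix.trace_add, trace_mul_vecMulVec', Matrix.mul_smul,
      Matrix.trace_smul, smul_eq_mul] at this
    simp only [← Matrix.mulVec_mulVec, ha, invJ_mulVec_dotProduct] at this ⊢
    rw [← this]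
    refine Finset.sum_congr rfl fun j _ => ?_
    congr 3
    ext i
    simp only [Matrix.sub_apply, Matrix.sum_apply, Matrix.add_apply, Matrix.smul_apply,
      Matrix.vecMulVec_apply, smul_eq_mul, mul_comm]
  have k6 : ∀ α β x, (a *ᵥ H β *ᵥ v α) ⬝ᵥ x = (H β *ᵥ v α) ⬝ᵥ (a *ᵥ x) := fun α β x => by
    rw [ha, invJ_mulVec_dotProduct]
  -- For fixed α an unwanted last sum remains; it is antisymmetric in α and β, and disappears only
  -- in `swap`.
  have main : ∀ α, ∑ j, ((((a * T j α).trace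
        - 2 * ∑ β, (fun i => (a * H β) i j) ⬝ᵥ (H α *ᵥ v β)) * v α j
      + (a * H α).trace * ((a * H α) j j
        - ∑ β, ((a * H β) j j * (U β ⬝ᵥ v α) + v β j * (H β *ᵥ v α) j))
      - ((a *ᵥ (T j α *ᵥ v α)) j
        + (a *ᵥ (H α *ᵥ fun i => (a * H α) i j
          - ∑ β, ((a * H β) i j * (U β ⬝ᵥ v α) + v β i * (H β *ᵥ v α) j))) j
        - ∑ β, ((a * H β) j j * (v β ⬝ᵥ (H α *ᵥ v α))
          + v β j * ((fun i => (a * H β) i j) ⬝ᵥ (H α *ᵥ v α)))))) =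
      ((a * H α).trace ^ 2 - (a * H α * (a * H α)).trace)
        - ∑ β, (U β ⬝ᵥ v α) * ((a * H α).trace * (a * H β).trace
            - (a * H α * (a * H β)).trace)
        + ∑ β, ((H β *ᵥ v β) ⬝ᵥ (a *ᵥ (H α *ᵥ v α)) - (H β *ᵥ v α) ⬝ᵥ (a *ᵥ (H α *ᵥ v β)))
        + ∑ β, ((a * H β).trace * (v β ⬝ᵥ (H α *ᵥ v α))
          - (a * H α).trace * (v β ⬝ᵥ (H β *ᵥ v α))) := fun α => by
    have r1 : ∑ j, (∑ β, (fun i => (a * H β) i j) ⬝ᵥ (H α *ᵥ v β)) * v α j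
        = ∑ β, (H β *ᵥ v α) ⬝ᵥ (a *ᵥ (H α *ᵥ v β)) := by
      simp only [Finset.sum_mul]
      rw [Finset.sum_comm]
      refine Finset.sum_congr rfl fun β _ => ?_
      rw [sum_column_dotProduct_mul, ← Matrix.mulVec_mulVec, k6]
    have r2 : ∑ j, ∑ β, ((a * H β) j j * (U β ⬝ᵥ v α) + v β j * (H β *ᵥ v α) j)
        = ∑ β, ((a * H β).trace * (U β ⬝ᵥ v α) + v β ⬝ᵥ (H β *ᵥ v α)) := by
      rw [Finset.sum_comm]
      refine Finset.sum_congr rfl fun β _ => ?_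
      rw [Finset.sum_add_distrib, ← Finset.sum_mul]; rfl
    have r3 : ∑ j, ∑ β, ((a * H β) j j * (v β ⬝ᵥ (H α *ᵥ v α))
          + v β j * ((fun i => (a * H β) i j) ⬝ᵥ (H α *ᵥ v α)))
        = ∑ β, ((a * H β).trace * (v β ⬝ᵥ (H α *ᵥ v α))
          + (H β *ᵥ v β) ⬝ᵥ (a *ᵥ (H α *ᵥ v α))) := by
      rw [Finset.sum_comm]
      refine Finset.sum_congr rfl fun β _ => ?_
      rw [Finset.sum_add_distrib, ← Finset.sum_mul]
      simp only [mul_comm (v β _)]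
      rw [sum_column_dotProduct_mul, ← Matrix.mulVec_mulVec, k6]; rfl
    have r4 : ∀ β, (H β *ᵥ v α) ⬝ᵥ (a *ᵥ (H α *ᵥ v β)) = (H α *ᵥ v β) ⬝ᵥ (a *ᵥ (H β *ᵥ v α)) :=
      fun β => by rw [← invJ_mulVec_dotProduct, dotProduct_comm]
    have r5 : ∑ j, (a * H α) j j = (a * H α).trace := rfl
    have k3' := k3 α
    rw [Finset.sum_sub_distrib] at k3'
    simp only [sub_mul, mul_sub, Finset.sum_sub_distrib, Finset.sum_add_distrib, mul_assoc,
      ← Finset.mul_sum] at r1 r2 r3 k3' ⊢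
    have k5' := k5 α
    simp only [Finset.sum_add_distrib, mul_assoc] at k5'
    rw [r1, k5', r5]
    simp only [← r4]
    have e1 : ∑ β, (U β ⬝ᵥ v α) * ((a * H α).trace * (a * H β).trace)
      = (a * H α).trace * ∑ β, (a * H β).trace * (U β ⬝ᵥ v α) := by
      rw [Finset.mul_sum]; exact Finset.sum_congr rfl fun β _ => by ring
    rw [e1]
    linear_combination k3' - (a * H α).trace * r2 + r3
  have swap : ∑ α, ∑ β, ((a * H β).trace * (v β ⬝ᵥ (H α *ᵥ v α))
          - (a * H α).trace * (v β ⬝ᵥ (H β *ᵥ v α))) = 0 := by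
    have hs : ∀ α β, v β ⬝ᵥ (H β *ᵥ v α) = (H β *ᵥ v β) ⬝ᵥ v α := fun α β => by
      rw [Matrix.dotProduct_mulVec, ← Matrix.mulVec_transpose]
      congr 2; ext i j; exact hH _ _ _
    simp only [hs, Finset.sum_sub_distrib]
    rw [sub_eq_zero, Finset.sum_comm]
    exact Finset.sum_congr rfl fun α _ => Finset.sum_congr rfl fun β _ => by
      rw [dotProduct_comm]
  have hsum := Finset.sum_congr (rfl : (Finset.univ : Finset (Fin m)) = Finset.univ)
    fun α _ => main α
  refine Eq.trans ?_ (hsum.trans ?_)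
  · unfold fluxDerivJ
    rw [Finset.sum_comm]
    simp only [← k2]
    rfl
  rw [Finset.sum_add_distrib, swap, add_zero, divJ]
  simp only [Finset.sum_add_distrib (s := (Finset.univ : Finset (Fin m)))]
  congr 1
  · refine Finset.sum_congr rfl fun α _ => ?_
    simp only [sub_mul, Finset.sum_sub_distrib, Matrix.one_apply, ite_mul, one_mul, zero_mul,
      Finset.sum_ite_eq, Finset.mem_univ, if_true]
    rw [pow_two]
    congr 1
    refine Finset.sum_congr rfl fun β _ => ?_
    rw [← invJ_mulVec_dotProduct, dotProduct_comm]
  · rw [Finset.sum_comm]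

end JetDivergence

/-! ### Curvatures of the graph in terms of first and second derivatives -/

section GraphJets

variable {n m : ℕ} (D : Set (E n)) (f : E n → E m) (x : E n)

/-- The matrix of first partial derivatives. -/
def jet1 : Matrix (Fin m) (Fin n) ℝ := Matrix.of fun α i => pd D f x α i

/-- The matrices of second partial derivatives. -/
def jet2 (α : Fin m) : Matrix (Fin n) (Fin n) ℝ := Matrix.of fun i j => pd2 D f x α i j

lemma e_apply {k : ℕ} (i j : Fin k) : (e i : E k) j = if i = j then 1 else 0 := by
  simp [e, eq_comm]

lemma sum_smul_e {k : ℕ} (u : E k) : u = ∑ i, u i • e i := by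
  ext j
  simp [Finset.sum_apply, e_apply]

lemma fderivWithin_apply_eq (u : E n) (α : Fin m) :
    fderivWithin ℝ f D x u α = ∑ i, u i * pd D f x α i := by
  conv_lhs => rw [sum_smul_e u]
  simp [pd]

lemma hess_apply_eq (u v : E n) (α : Fin m) :
    hess D f x u v α = ∑ i, ∑ j, u i * v j * pd2 D f x α i j := by
  unfold hess pd2 hess
  conv_lhs => rw [sum_smul_e u, sum_smul_e v]
  simp only [map_sum, map_smul, _root_.sum_apply, _root_.smul_apply, WithLp.ofLp_sum,
    Finset.sum_apply, WithLp.ofLp_smul, Pi.smul_apply, smul_eq_mul, Finset.mul_sum, mul_assoc]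
  rw [Finset.sum_comm]
  exact Finset.sum_congr rfl fun i _ => Finset.sum_congr rfl fun j _ => by ring

lemma inner_euclidean {k : ℕ} (u v : E k) : ⟪u, v⟫ = ∑ i, u i * v i := by
  simp [PiLp.inner_apply, mul_comm]

lemma inner_e {k : ℕ} (u : E k) (i : Fin k) : ⟪u, e i⟫ = u i := by
  simp [inner_euclidean, e_apply]

lemma metric_eq : metric D f x = metricJ (jet1 D f x) := by
  ext i j
  rw [metricJ_apply, metric, Matrix.of_apply, tangentVec, tangentVec, WithLp.prod_inner_apply,
    inner_euclidean (fderivWithin _ _ _ _ _)]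
  congr 1
  simp only [inner_e, e_apply, Matrix.one_apply]

lemma metric_inv : (metric D f x)⁻¹ = invJ (jet1 D f x) := by rw [metric_eq, invJ]

lemma gradM_apply (α : Fin m) :
    gradM D f x α = WithLp.toLp 2 (invJ (jet1 D f x) *ᵥ jet1 D f x α) := by
  rw [gradM, metric_inv]; rfl

lemma tangentVec_add (u v : E n) :
    tangentVec D f x (u + v) = tangentVec D f x u + tangentVec D f x v := by
  simp [tangentVec, ← WithLp.toLp_add]

lemma tangentVec_smul (c : ℝ) (u : E n) :
    tangentVec D f x (c • u) = c • tangentVec D f x u := by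
  simp [tangentVec, ← WithLp.toLp_smul]

lemma mem_tangentSpace_orthogonal {ξ : Amb n m} :
    ξ ∈ (tangentSpace D f x)ᗮ ↔ ∀ u, ⟪tangentVec D f x u, ξ⟫ = 0 := by
  rw [tangentSpace, Submodule.mem_orthogonal]
  constructor
  · intro h u
    exact h _ (Submodule.subset_span ⟨u, rfl⟩)
  · intro h w hw
    induction hw using Submodule.span_induction with
    | mem w hw => obtain ⟨u, rfl⟩ := hw; exact h u
    | zero => simp
    | add a b _ _ ha hb => rw [inner_add_left, ha, hb, add_zero]
    | smul c a _ ha => rw [inner_smul_left, ha, mul_zero]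

lemma normalFrame_mem (α : Fin m) : normalFrame D f x α ∈ (tangentSpace D f x)ᗮ := by
  rw [mem_tangentSpace_orthogonal]
  intro u
  rw [tangentVec, normalFrame, WithLp.prod_inner_apply]
  simp only [inner_neg_right, inner_e, fderivWithin_apply_eq]
  rw [inner_euclidean]
  simp [gradEuc]

/-- Orthogonal projection is self-adjoint and fixes normal vectors, so pairing with a normal vector
sees only the unprojected second derivative, whose horizontal component is zero. -/
lemma inner_secondFF_of_mem {ξ : Amb n m} (hξ : ξ ∈ (tangentSpace D f x)ᗮ) (u v : E n) :
    ⟪secondFF D f x u v, ξ⟫ = ⟪hess D f x u v, ξ.snd⟫ := by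
  rw [secondFF, Submodule.inner_starProjection_left_eq_right,
    Submodule.starProjection_eq_self_iff.2 hξ, WithLp.prod_inner_apply]
  simp

lemma inner_secondFF_normalFrame (u v : E n) (α : Fin m) :
    ⟪secondFF D f x u v, normalFrame D f x α⟫ = hess D f x u v α := by
  rw [inner_secondFF_of_mem D f x (normalFrame_mem D f x α)]
  simp [normalFrame, inner_e]

lemma tangentVec_eq_sum (u : E n) :
    tangentVec D f x u = ∑ j, u j • tangentVec D f x (e j) := by
  conv_lhs => rw [sum_smul_e u]
  have : ∀ s : Finset (Fin n), tangentVec D f x (∑ j ∈ s, u j • e j) =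
      ∑ j ∈ s, u j • tangentVec D f x (e j) := by
    classical
    intro s
    induction s using Finset.induction_on with
    | empty => simp [tangentVec]
    | insert a s ha ih =>
      rw [Finset.sum_insert ha, Finset.sum_insert ha, tangentVec_add, tangentVec_smul, ih]
  exact this _

/-- The coordinates of the tangential part of `(0, w)`. -/
def tangentCoord (w : E m) : E n :=
  WithLp.toLp 2 (invJ (jet1 D f x) *ᵥ fun k => ∑ β, pd D f x β k * w β)

/-- The coordinates solve the normal equations g y = (Df)ᵀ w, which express orthogonality of the
remainder to every ∂_i. -/
lemma starProjection_tangentSpace (w : E m) :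
    (tangentSpace D f x).starProjection (WithLp.toLp 2 (0, w)) =
      tangentVec D f x (tangentCoord D f x w) := by
  apply Submodule.eq_starProjection_of_mem_orthogonal
  · exact Submodule.subset_span ⟨_, rfl⟩
  rw [mem_tangentSpace_orthogonal]
  intro u
  have key : (metricJ (jet1 D f x)) *ᵥ (tangentCoord D f x w).ofLp =
      fun k => ∑ β, pd D f x β k * w β := by
    simp only [tangentCoord]
    rw [Matrix.mulVec_mulVec, mul_invJ, Matrix.one_mulVec]
  set y := tangentCoord D f x w
  have h1 : ∀ i, ⟪tangentVec D f x (e i), WithLp.toLp 2 (0, w) - tangentVec D f x y⟫ = 0 := by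
    intro i
    have h2 : ⟪tangentVec D f x (e i), tangentVec D f x y⟫ =
        (metricJ (jet1 D f x) *ᵥ y.ofLp) i := by
      rw [tangentVec_eq_sum D f x y, inner_sum, ← metric_eq, Matrix.mulVec, dotProduct]
      refine Finset.sum_congr rfl fun j _ => ?_
      rw [inner_smul_right, mul_comm]; rfl
    rw [inner_sub_right, h2, key, tangentVec, WithLp.prod_inner_apply, inner_euclidean]
    simp only [sub_eq_zero, inner_euclidean]
    simp [pd]
  rw [tangentVec_eq_sum D f x u, sum_inner]
  exact Finset.sum_eq_zero fun i _ => by rw [inner_smul_left, h1, mul_zero]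

/-- Removing the tangential part of (0, D²f) replaces δ_αβ by δ_αβ - ⟨∇f^α, ∇f^β⟩. This matrix is
the inverse of the Gram matrix of the frame η^α. -/
lemma inner_secondFF (u v w z : E n) :
    ⟪secondFF D f x u v, secondFF D f x w z⟫ =
      ∑ α, ∑ β, ((1 : Matrix (Fin m) (Fin m) ℝ) α β
        - jet1 D f x α ⬝ᵥ (invJ (jet1 D f x) *ᵥ jet1 D f x β)) *
          (hess D f x u v α * hess D f x w z β) := by
  set p := hess D f x u v
  set q := hess D f x w z
  have hmem : secondFF D f x w z ∈ (tangentSpace D f x)ᗮ :=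
    Submodule.starProjection_apply_mem _ _
  rw [inner_secondFF_of_mem D f x hmem]
  have : (secondFF D f x w z).snd = q - fderivWithin ℝ f D x (tangentCoord D f x q) := by
    rw [secondFF, Submodule.starProjection_orthogonal_val, starProjection_tangentSpace]
    rfl
  rw [this, inner_sub_right, inner_euclidean, inner_euclidean]
  simp only [fderivWithin_apply_eq, sub_mul, Finset.sum_sub_distrib]
  congr 1
  · simp [Matrix.one_apply, p]
  · refine Finset.sum_congr rfl fun α _ => ?_
    simp only [tangentCoord, Matrix.mulVec, dotProduct, Finset.mul_sum, Finset.sum_mul]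
    rw [Finset.sum_comm]
    conv_rhs => rw [Finset.sum_comm]
    conv_lhs => rw [Finset.sum_comm]
    refine Finset.sum_congr rfl fun i _ => ?_
    rw [Finset.sum_comm]
    refine Finset.sum_congr rfl fun β _ => Finset.sum_congr rfl fun k _ => ?_
    simp only [jet1, Matrix.of_apply]
    ring

lemma scalarCurv_eq (hs : ∀ α i j, jet2 D f x α i j = jet2 D f x α j i) :
    scalarCurv D f x = ∑ α, ∑ β, ((1 : Matrix (Fin m) (Fin m) ℝ) α β
        - jet1 D f x α ⬝ᵥ (invJ (jet1 D f x) *ᵥ jet1 D f x β)) *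
      ((invJ (jet1 D f x) * jet2 D f x α).trace * (invJ (jet1 D f x) * jet2 D f x β).trace
        - ((invJ (jet1 D f x) * jet2 D f x α) * (invJ (jet1 D f x) * jet2 D f x β)).trace) := by
  set a := invJ (jet1 D f x) with ha
  set c : Fin m → Fin m → ℝ := fun α β => (1 : Matrix (Fin m) (Fin m) ℝ) α β
        - jet1 D f x α ⬝ᵥ (a *ᵥ jet1 D f x β)
  have hF : ∀ i j α, hess D f x (e i) (e j) α = jet2 D f x α i j := fun _ _ _ => rfl
  simp only [scalarCurv, curv, inner_secondFF, metric_inv, hF, ← ha]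
  simp only [← Finset.sum_sub_distrib, Finset.mul_sum]
  have e : ∀ F : Fin n → Fin n → Fin n → Fin n → Fin m → Fin m → ℝ,
      ∑ i, ∑ j, ∑ k, ∑ l, ∑ α, ∑ β, F i j k l α β =
        ∑ α, ∑ β, ∑ i, ∑ j, ∑ k, ∑ l, F i j k l α β := by
    intro F
    simp_rw [Finset.sum_comm (s := (Finset.univ : Finset (Fin n)))
      (t := (Finset.univ : Finset (Fin m)))]
  rw [e]
  refine Finset.sum_congr rfl fun α _ => Finset.sum_congr rfl fun β _ => ?_
  change _ = c α β * _
  have t1 : (a * jet2 D f x α).trace * (a * jet2 D f x β).trace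
      = ∑ i, ∑ j, ∑ k, ∑ l, a i j * a k l * (jet2 D f x α i j * jet2 D f x β l k) := by
    rw [mul_comm]
    simp only [Matrix.trace, Matrix.diag, Matrix.mul_apply, Finset.sum_mul, Finset.mul_sum]
    refine Finset.sum_congr rfl fun i _ => Finset.sum_congr rfl fun j _ =>
      Finset.sum_congr rfl fun k _ => Finset.sum_congr rfl fun l _ => ?_
    rw [hs α i j]; ring
  have t2 : ((a * jet2 D f x α) * (a * jet2 D f x β)).trace
      = ∑ i, ∑ j, ∑ k, ∑ l, a i j * a k l * (jet2 D f x α i k * jet2 D f x β l j) := by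
    simp only [Matrix.trace, Matrix.diag, Matrix.mul_apply, Finset.sum_mul, Finset.mul_sum]
    conv_rhs => rw [Finset.sum_comm]
    refine Finset.sum_congr rfl fun j _ => ?_
    conv_rhs => rw [Finset.sum_comm]
    refine Finset.sum_congr rfl fun k _ => ?_
    rw [Finset.sum_comm]
    refine Finset.sum_congr rfl fun i _ => Finset.sum_congr rfl fun l _ => ?_
    rw [ha, invJ_symm _ i j]; ring
  rw [t1, t2, ← Finset.sum_sub_distrib, Finset.mul_sum]
  refine Finset.sum_congr rfl fun i _ => ?_
  rw [← Finset.sum_sub_distrib, Finset.mul_sum]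
  refine Finset.sum_congr rfl fun j _ => ?_
  rw [← Finset.sum_sub_distrib, Finset.mul_sum]
  refine Finset.sum_congr rfl fun k _ => ?_
  rw [← Finset.sum_sub_distrib, Finset.mul_sum]
  refine Finset.sum_congr rfl fun l _ => ?_
  ring

lemma hess_apply_eq_dotProduct (u v : E n) (α : Fin m) :
    hess D f x u v α = u.ofLp ⬝ᵥ (jet2 D f x α *ᵥ v.ofLp) := by
  rw [hess_apply_eq]
  simp only [dotProduct, Matrix.mulVec, Finset.mul_sum, jet2, Matrix.of_apply]
  exact Finset.sum_congr rfl fun i _ => Finset.sum_congr rfl fun j _ => by ring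

/-- Pairing B with η^β returns the Hessian of f^β, so the shape operator of η^β is g⁻¹ D²f^β in
coordinates, and a second pairing gives the claim. -/
lemma inner_secondFF_shapeOp (hs : ∀ α i j, jet2 D f x α i j = jet2 D f x α j i)
    (u v : E n) (α β : Fin m) :
    ⟪secondFF D f x u (shapeOp D f x (normalFrame D f x β) v), normalFrame D f x α⟫ =
      (jet2 D f x α *ᵥ u.ofLp) ⬝ᵥ (invJ (jet1 D f x) *ᵥ (jet2 D f x β *ᵥ v.ofLp)) := by
  have hT : ∀ α, (jet2 D f x α)ᵀ = jet2 D f x α := fun α => by ext i j; exact hs α j i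
  rw [inner_secondFF_normalFrame, hess_apply_eq_dotProduct, Matrix.dotProduct_mulVec,
    ← Matrix.mulVec_transpose, hT, shapeOp, metric_inv]
  refine congrArg (fun w => (jet2 D f x α *ᵥ u.ofLp) ⬝ᵥ (invJ (jet1 D f x) *ᵥ w)) ?_
  funext k
  simp only [inner_secondFF_normalFrame, hess_apply_eq_dotProduct]
  rw [Matrix.dotProduct_mulVec, ← Matrix.mulVec_transpose, hT]
  simp [dotProduct, e_apply]

/-- The traced Gauss equation is the first half of `divJ`; the Ricci equation evaluated on gradients
is the second half. Symmetry of the Hessians is assumed because on the boundary they are one-sided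
derivatives, treated in `jet2_symm`. -/
lemma scalarCurv_add_sPerp (hs : ∀ α i j, jet2 D f x α i j = jet2 D f x α j i) :
    scalarCurv D f x + sPerp D f x = divJ (jet1 D f x) (jet2 D f x) := by
  rw [scalarCurv_eq D f x hs, divJ, sPerp]
  simp only [Finset.sum_add_distrib]
  congr 1
  refine Finset.sum_congr rfl fun α _ => Finset.sum_congr rfl fun β _ => ?_
  rw [normalCurv, inner_sub_left, inner_secondFF_shapeOp D f x hs,
    inner_secondFF_shapeOp D f x hs, gradM_apply, gradM_apply]

end GraphJets

/-! ### The classical divergence identity for C³ maps -/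

section Flux

variable {n m : ℕ} (D : Set (E n)) (f : E n → E m)

/-- The flux field of a graph. -/
def flux (x : E n) : E n := WithLp.toLp 2 (fluxJ (jet1 D f x) (jet2 D f x))

lemma jet1_univ_apply (x : E n) (α : Fin m) (i : Fin n) :
    jet1 Set.univ f x α i = fderiv ℝ f x (e i) α := by
  simp [jet1, pd, fderivWithin_univ]

lemma jet2_univ_apply (x : E n) (α : Fin m) (i j : Fin n) :
    jet2 Set.univ f x α i j = fderiv ℝ (fderiv ℝ f) x (e i) (e j) α := by
  simp only [jet2, Matrix.of_apply, pd2, hess, fderivWithin_univ]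

variable {f}

lemma contDiff_jet1 {k : ℕ∞} (hf : ContDiff ℝ (k + 1 : ℕ∞) f) (α : Fin m) (i : Fin n) :
    ContDiff ℝ k fun x => jet1 Set.univ f x α i := by
  simp only [jet1_univ_apply]
  have h : ContDiff ℝ k (fderiv ℝ f) := hf.fderiv_right (by norm_cast)
  have := h.clm_apply (contDiff_const (c := (e i : E n)))
  exact (contDiff_piLp_apply 2 (i := α)).comp this

lemma fderiv_jet1 (hf : ContDiff ℝ 2 f) (x : E n) (α : Fin m) (i j : Fin n) :
    fderiv ℝ (fun x => jet1 Set.univ f x α i) x (e j) = jet2 Set.univ f x α j i := by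
  simp only [jet1_univ_apply, jet2_univ_apply]
  have h : ContDiff ℝ 1 (fderiv ℝ f) := hf.fderiv_right (by norm_num)
  have h1 : HasFDerivAt (fun x => fderiv ℝ f x (e i))
      ((fderiv ℝ (fderiv ℝ f) x).flip (e i)) x := by
    have := (h.differentiable (by simp) x).hasFDerivAt.clm_apply (hasFDerivAt_const (e i : E n) x)
    simpa using this
  have h2 := (PiLp.proj (𝕜 := ℝ) 2 (fun _ : Fin m => ℝ) α).hasFDerivAt.comp x h1
  change fderiv ℝ ((PiLp.proj (𝕜 := ℝ) 2 (fun _ : Fin m => ℝ) α) ∘ _) x (e j) = _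
  rw [h2.fderiv]
  rfl

lemma jet2_univ_symm (hf : ContDiff ℝ 2 f) (x : E n) (α : Fin m) (i j : Fin n) :
    jet2 Set.univ f x α i j = jet2 Set.univ f x α j i := by
  simp only [jet2_univ_apply]
  rw [(hf.contDiffAt.isSymmSndFDerivAt (by simp)).eq]

lemma contDiff_jet2 {k : ℕ∞} (hf : ContDiff ℝ (k + 2 : ℕ∞) f) (α : Fin m) (i j : Fin n) :
    ContDiff ℝ k fun x => jet2 Set.univ f x α i j := by
  have h2 : ContDiff ℝ 2 f := hf.of_le (by norm_cast; simp)
  simp only [← fderiv_jet1 h2]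
  have h : ContDiff ℝ (k + 1 : ℕ∞) fun x => jet1 Set.univ f x α j :=
    contDiff_jet1 (by rwa [add_assoc, one_add_one_eq_two]) α j
  exact (h.fderiv_right (m := k) (by norm_cast)).clm_apply contDiff_const

/-- Along each coordinate line the jets form a differentiable curve, to which the algebraic
derivative of the flux applies. Three derivatives are needed because the field already contains
second ones. -/
theorem sum_lineDeriv_flux (hf : ContDiff ℝ 3 f) (x : E n) :
    ∑ j, lineDeriv ℝ (fun y => flux Set.univ f y j) x (e j)
      = divJ (jet1 Set.univ f x) (jet2 Set.univ f x) := by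
  have hf2 : ContDiff ℝ 2 f := hf.of_le (by norm_num)
  set T : Fin n → Fin m → Matrix (Fin n) (Fin n) ℝ := fun j α => Matrix.of fun i k =>
    fderiv ℝ (fun y => jet2 Set.univ f y α i k) x (e j)
  have hj1 : ∀ α i, ContDiff ℝ 2 fun x => jet1 Set.univ f x α i := fun α i =>
    contDiff_jet1 (k := 2) (by exact_mod_cast hf) α i
  have hj2 : ∀ α i k, ContDiff ℝ 1 fun x => jet2 Set.univ f x α i k := fun α i k =>
    contDiff_jet2 (k := 1) (by exact_mod_cast hf) α i k
  -- Schwarz's theorem for D²f lets the index k be read as a derivative of f_i^α; Schwarz for f_i^α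
  -- then exchanges j and k.
  have hT : ∀ α i j k, T j α i k = T k α i j := by
    intro α i j k
    simp only [T, Matrix.of_apply]
    have h1 : ∀ k, (fun y => jet2 Set.univ f y α i k) =
        fun y => fderiv ℝ (fun x => jet1 Set.univ f x α i) y (e k) := fun k => by
      ext1 y; rw [fderiv_jet1 hf2, jet2_univ_symm hf2]
    have h2 : ContDiff ℝ 1 (fderiv ℝ fun x => jet1 Set.univ f x α i) :=
      (hj1 α i).fderiv_right (by norm_num)
    have h3 : ∀ j k, fderiv ℝ (fun y => fderiv ℝ (fun x => jet1 Set.univ f x α i) y (e k)) x (e j)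
        = fderiv ℝ (fderiv ℝ (fun x => jet1 Set.univ f x α i)) x (e j) (e k) := fun j k => by
      have := (h2.differentiable (by simp) x).hasFDerivAt.clm_apply
        (hasFDerivAt_const (e k : E n) x)
      rw [this.fderiv]; simp
    rw [h1, h1, h3, h3, ((hj1 α i).contDiffAt.isSymmSndFDerivAt (by simp)).eq]
  rw [← sum_fluxDerivJ _ _ T (fun α i j => jet2_univ_symm hf2 x α i j) hT]
  refine Finset.sum_congr rfl fun j _ => ?_
  have hline : ContDiff ℝ 3 fun t : ℝ => x + t • (e j : E n) := by fun_prop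
  have hline' : HasDerivAt (fun t : ℝ => x + t • (e j : E n)) (e j) 0 := by
    simpa using ((hasDerivAt_id (0 : ℝ)).smul_const (e j : E n)).const_add x
  have h0 : x + (0 : ℝ) • (e j : E n) = x := by simp
  have hU : ∀ α i, HasDerivAt (fun t : ℝ => jet1 Set.univ f (x + t • (e j : E n)) α i)
      ((Matrix.of fun β i => jet2 Set.univ f x β i j) α i) 0 := fun α i => by
    have hd := ((hj1 α i).differentiable (by simp) (x + (0 : ℝ) • (e j : E n))).hasFDerivAt
    have := hd.comp_hasDerivAt (0 : ℝ) hline'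
    rw [h0, fderiv_jet1 hf2, jet2_univ_symm hf2] at this
    exact this
  have hH : ∀ α i k, HasDerivAt (fun t : ℝ => jet2 Set.univ f (x + t • (e j : E n)) α i k)
      (T j α i k) 0 := fun α i k => by
    have hd := ((hj2 α i k).differentiable (by simp) (x + (0 : ℝ) • (e j : E n))).hasFDerivAt
    have := hd.comp_hasDerivAt (0 : ℝ) hline'
    rw [h0] at this
    exact this
  have := hasDerivAt_fluxJ (t := 0) (U := fun t : ℝ => jet1 Set.univ f (x + t • (e j : E n)))
    (H := fun t : ℝ => jet2 Set.univ f (x + t • (e j : E n)))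
    (fun α i => (hj1 α i).of_le (by norm_num) |>.comp (hline.of_le (by norm_num))) hU hH
    (fun α i k => jet2_univ_symm hf2 _ _ _ _) j
  rw [h0] at this
  exact this.deriv

end Flux

/-- Integration by parts for Lipschitz fields against compactly supported Lipschitz functions. -/
theorem integral_mul_divergence_add_fderiv {n : ℕ} {X : E n → E n} {C : Fin n → NNReal}
    (hX : ∀ j, LipschitzWith (C j) fun x => X x j) {φ : E n → ℝ} {K : NNReal}
    (hφ : LipschitzWith K φ) (hc : HasCompactSupport φ) :
    ∫ x, (φ x * ∑ j, lineDeriv ℝ (fun y => X y j) x (e j) + fderiv ℝ φ x (X x)) = 0 := by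
  have hi1 : ∀ j, Integrable fun x => lineDeriv ℝ (fun y => X y j) x (e j) * φ x := fun j =>
    (hφ.continuous.integrable_of_hasCompactSupport hc).bdd_mul
      ((hX j).memLp_lineDeriv (μ := volume) _).aestronglyMeasurable
      (.of_forall fun x => norm_lineDeriv_le_of_lipschitz ℝ (hX j))
  have hcl : ∀ v x, x ∉ tsupport φ → lineDeriv ℝ φ x v = 0 := fun v x hx => by
    have h : φ =ᶠ[𝓝 x] 0 := notMem_tsupport_iff_eventuallyEq.1 hx
    have h' := h.lineDeriv_eq (v := v) (𝕜 := ℝ)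
    rw [h']
    simp [lineDeriv]
  have hi2 : ∀ j v, Integrable fun x => lineDeriv ℝ φ x v * X x j := fun j v => by
    have h1 : IntegrableOn (fun x => lineDeriv ℝ φ x v * X x j) (tsupport φ) :=
      (((hX j).continuous.continuousOn).integrableOn_compact hc).bdd_mul
        (hφ.memLp_lineDeriv (μ := volume) _).aestronglyMeasurable.restrict
        (.of_forall fun x => norm_lineDeriv_le_of_lipschitz ℝ hφ)
    refine (integrableOn_iff_integrable_of_support_subset fun x hx => ?_).1 h1
    by_contra h
    exact hx (by simp [hcl v x h])
  have hp : ∀ j, ∫ x, (lineDeriv ℝ (fun y => X y j) x (e j) * φ x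
      - lineDeriv ℝ φ x (-e j) * X x j) = 0 := fun j => by
    rw [integral_sub (hi1 j) (hi2 j _), sub_eq_zero]
    exact (hX j).integral_lineDeriv_mul_eq hφ hc (e j)
  have hs : ∫ x, ∑ j, (lineDeriv ℝ (fun y => X y j) x (e j) * φ x
      - lineDeriv ℝ φ x (-e j) * X x j) = 0 := by
    refine (integral_finsetSum _ fun j _ => (hi1 j).sub (hi2 j (-e j))).trans ?_
    exact Finset.sum_eq_zero fun j _ => hp j
  rw [← hs]
  refine integral_congr_ae ?_
  -- By Rademacher, directional derivatives are almost everywhere linear in the direction, so those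
  -- along the coordinate axes add up to the derivative along X.
  filter_upwards [hφ.ae_differentiableAt (μ := volume)] with x hx
  rw [Finset.sum_sub_distrib, sub_eq_add_neg, Finset.mul_sum, ← Finset.sum_neg_distrib]
  congr 1
  · exact Finset.sum_congr rfl fun j _ => mul_comm _ _
  · conv_lhs => rw [sum_smul_e (X x)]
    rw [map_sum]
    refine Finset.sum_congr rfl fun j _ => ?_
    rw [map_smul, hx.lineDeriv_eq_fderiv, map_neg, smul_eq_mul]
    ring

/-! ### Mollification -/

section Mollify

open ContinuousLinearMap
open scoped Convolution ContDiff

variable {n : ℕ} {F : Type*} [NormedAddCommGroup F] [NormedSpace ℝ F]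

/-- The mollification of a function by a normalized bump function. -/
def mollify (ρ : ContDiffBump (0 : E n)) (g : E n → F) : E n → F :=
  ρ.normed volume ⋆[lsmul ℝ ℝ, volume] g

variable (ρ : ContDiffBump (0 : E n)) {g : E n → F}

lemma hasCompactSupport_mollify (hc : HasCompactSupport g) : HasCompactSupport (mollify ρ g) :=
  HasCompactSupport.convolution _ ρ.hasCompactSupport_normed hc

lemma contDiff_mollify (hg : Continuous g) : ContDiff ℝ ∞ (mollify ρ g) :=
  ρ.hasCompactSupport_normed.contDiff_convolution_left _ ρ.contDiff_normed hg.locallyIntegrable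

lemma fderiv_mollify [CompleteSpace F] (hc : HasCompactSupport g) (hg : ContDiff ℝ 1 g) :
    fderiv ℝ (mollify ρ g) = mollify ρ (fderiv ℝ g) := by
  ext1 x
  have := hc.hasFDerivAt_convolution_right (lsmul ℝ ℝ) (μ := volume)
    (f := ρ.normed volume) (ρ.continuous_normed.locallyIntegrable) hg x
  rw [mollify, this.fderiv]
  rfl

/-- The factor 3 is crude: 2C bounds the distance from g and C bounds g. Only independence of the
bump matters, for dominated convergence. -/
lemma norm_mollify_le [CompleteSpace F] (hg : Continuous g) {C : ℝ} (hC : ∀ x, ‖g x‖ ≤ C)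
    (x : E n) :
    ‖mollify ρ g x‖ ≤ 3 * C := by
  have h : dist (mollify ρ g x) (g x) ≤ 2 * C :=
    ContDiffBump.dist_normed_convolution_le hg.aestronglyMeasurable fun y _ => by
      rw [dist_eq_norm]
      linarith [norm_sub_le (g y) (g x), hC x, hC y]
  rw [dist_eq_norm] at h
  have := norm_add_le (mollify ρ g x - g x) (g x)
  rw [sub_add_cancel] at this
  linarith [hC x]

end Mollify

/-! ### The weak divergence identity for compactly supported C² maps -/

section WeakDivergence

open scoped ContDiff

variable {n m : ℕ} {f : E n → E m}

lemma norm_apply_e_le {F : Type*} [NormedAddCommGroup F] [NormedSpace ℝ F] (L : E n →L[ℝ] F)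
    (i : Fin n) : ‖L (e i)‖ ≤ ‖L‖ := by
  simpa [e] using L.le_opNorm (e i)

lemma abs_jet1_univ_le (x : E n) (α : Fin m) (i : Fin n) :
    |jet1 Set.univ f x α i| ≤ ‖fderiv ℝ f x‖ := by
  rw [jet1_univ_apply, ← Real.norm_eq_abs]
  exact (PiLp.norm_apply_le _ α).trans (norm_apply_e_le _ i)

lemma abs_jet2_univ_le (x : E n) (α : Fin m) (i j : Fin n) :
    |jet2 Set.univ f x α i j| ≤ ‖fderiv ℝ (fderiv ℝ f) x‖ := by
  rw [jet2_univ_apply, ← Real.norm_eq_abs]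
  exact (PiLp.norm_apply_le _ α).trans ((norm_apply_e_le _ j).trans (norm_apply_e_le _ i))

/-- Jets all of whose entries are bounded by `C`. -/
def boundedJets (n m : ℕ) (C : ℝ) :
    Set (Matrix (Fin m) (Fin n) ℝ × (Fin m → Matrix (Fin n) (Fin n) ℝ)) :=
  {p | (∀ α i, |p.1 α i| ≤ C) ∧ ∀ α i j, |p.2 α i j| ≤ C}

lemma isCompact_boundedJets (C : ℝ) : IsCompact (boundedJets n m C) := by
  have h1 : IsCompact (Set.univ.pi fun _ : Fin m => Set.univ.pi fun _ : Fin n =>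
      Set.Icc (-C) C) := isCompact_univ_pi fun _ => isCompact_univ_pi fun _ => isCompact_Icc
  have h2 : IsCompact (Set.univ.pi fun _ : Fin m => Set.univ.pi fun _ : Fin n =>
      Set.univ.pi fun _ : Fin n => Set.Icc (-C) C) :=
    isCompact_univ_pi fun _ => isCompact_univ_pi fun _ => isCompact_univ_pi fun _ => isCompact_Icc
  have : boundedJets n m C = (Set.univ.pi fun _ : Fin m => Set.univ.pi fun _ : Fin n =>
      Set.Icc (-C) C) ×ˢ (Set.univ.pi fun _ : Fin m => Set.univ.pi fun _ : Fin n =>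
      Set.univ.pi fun _ : Fin n => Set.Icc (-C) C) := by
    refine Set.ext fun p => ⟨fun h => ⟨fun α _ i _ => abs_le.1 (h.1 α i),
      fun α _ i _ j _ => abs_le.1 (h.2 α i j)⟩, fun h => ⟨fun α i => abs_le.2 ?_,
      fun α i j => abs_le.2 ?_⟩⟩
    · exact h.1 α trivial i trivial
    · exact h.2 α trivial i trivial j trivial
  rw [this]
  exact h1.prod h2

lemma continuous_toLp_fluxJ :
    Continuous fun p : Matrix (Fin m) (Fin n) ℝ × (Fin m → Matrix (Fin n) (Fin n) ℝ) =>
      (WithLp.toLp 2 (fluxJ p.1 p.2) : E n) :=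
  (PiLp.continuous_toLp 2 _).comp (continuous_pi continuous_fluxJ)

/-- Here the flux field is C¹ with compact support, hence globally Lipschitz, and integration by
parts combines with the classical identity. -/
theorem weak_divergence_of_contDiff_three (hf : ContDiff ℝ 3 f) (hc : HasCompactSupport f)
    {φ : E n → ℝ} {K : NNReal} (hφ : LipschitzWith K φ) (hφc : HasCompactSupport φ) :
    ∫ x, (φ x * divJ (jet1 Set.univ f x) (jet2 Set.univ f x)
      + fderiv ℝ φ x (flux Set.univ f x)) = 0 := by
  have hflux : ∀ j, ∃ C, LipschitzWith C fun x => flux Set.univ f x j := fun j => by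
    have h1 : ContDiff ℝ 1 fun x => flux Set.univ f x j :=
      contDiff_fluxJ (k := 1)
        (fun α i => contDiff_jet1 (k := 1) (hf.of_le (by norm_cast)) α i)
        (fun α i k => contDiff_jet2 (k := 1) (by exact_mod_cast hf) α i k) j
    -- Every term of the flux carries a factor ∇f^α, so the field vanishes off the support of f.
    have h2 : HasCompactSupport fun x => flux Set.univ f x j := by
      refine hc.mono' fun x hx => ?_
      by_contra h
      apply hx
      have h0 : fderiv ℝ f x = 0 := by
        rw [(notMem_tsupport_iff_eventuallyEq.1 h).fderiv_eq]; simp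
      have hU : jet1 Set.univ f x = 0 := by
        ext α i; rw [jet1_univ_apply, h0]; rfl
      simp [flux, fluxJ, hU, Matrix.mulVec, dotProduct]
    exact h1.lipschitzWith_of_hasCompactSupport h2 (by simp)
  choose C hC using hflux
  rw [← integral_mul_divergence_add_fderiv hC hφ hφc]
  simp only [sum_lineDeriv_flux hf]

lemma exists_bound_fderiv {F : Type*} [NormedAddCommGroup F] [NormedSpace ℝ F] {g : E n → F}
    (hg : ContDiff ℝ 1 g) (hc : HasCompactSupport g) : ∃ C, ∀ x, ‖fderiv ℝ g x‖ ≤ C :=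
  (hg.continuous_fderiv (by simp)).bounded_above_of_compact_support (hc.fderiv ℝ)

lemma tendsto_fderiv_mollify {F : Type*} [NormedAddCommGroup F] [NormedSpace ℝ F]
    [CompleteSpace F] {g : E n → F} (hg : ContDiff ℝ 1 g) (hc : HasCompactSupport g)
    {ρ : ℕ → ContDiffBump (0 : E n)} (hρ : Tendsto (fun k => (ρ k).rOut) atTop (𝓝 0)) :
    (∀ x, Tendsto (fun k => fderiv ℝ (mollify (ρ k) g) x) atTop (𝓝 (fderiv ℝ g x))) ∧
    ∃ C, ∀ k x, ‖fderiv ℝ (mollify (ρ k) g) x‖ ≤ C := by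
  have h : Continuous (fderiv ℝ g) := hg.continuous_fderiv (by simp)
  obtain ⟨C, hC⟩ := exists_bound_fderiv hg hc
  simp only [fderiv_mollify _ hc hg]
  exact ⟨fun x => ContDiffBump.convolution_tendsto_right_of_continuous hρ h x,
    3 * C, fun k x => norm_mollify_le _ h hC x⟩

lemma exists_bound_divJ (C : ℝ) : ∃ M, ∀ p ∈ boundedJets n m C, ‖divJ p.1 p.2‖ ≤ M :=
  (isCompact_boundedJets C).exists_bound_of_continuousOn continuous_divJ.continuousOn

lemma exists_bound_fluxJ (C : ℝ) : ∃ M, ∀ p ∈ boundedJets n m C,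
    ‖(WithLp.toLp 2 (fluxJ p.1 p.2) : E n)‖ ≤ M :=
  (isCompact_boundedJets C).exists_bound_of_continuousOn continuous_toLp_fluxJ.continuousOn

lemma measurable_fderiv_apply (φ : E n → ℝ) {X : E n → E n} (hX : Measurable X) :
    Measurable fun x => fderiv ℝ φ x (X x) := by
  have : (fun x => fderiv ℝ φ x (X x)) = fun x => ∑ j, X x j * fderiv ℝ φ x (e j) := by
    ext1 x
    conv_lhs => rw [sum_smul_e (X x)]
    simp
  rw [this]
  exact Finset.measurable_sum _ fun j _ => ((PiLp.continuous_apply 2 _ j).measurable.comp hX).mul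
    (measurable_fderiv_apply_const ℝ φ _)

lemma exists_bump_seq (n : ℕ) : ∃ ρ : ℕ → ContDiffBump (0 : E n),
    Tendsto (fun k => (ρ k).rOut) atTop (𝓝 0) := by
  refine ⟨fun k => ⟨1 / (2 * ((k : ℝ) + 1)), 1 / ((k : ℝ) + 1), by positivity, ?_⟩,
    tendsto_one_div_add_atTop_nhds_zero_nat⟩
  have : (0 : ℝ) < k + 1 := by positivity
  gcongr; linarith

-- The mollified maps satisfy the identity. Their first and second derivatives converge pointwise
-- and stay in one compact set of jets, and no higher derivative occurs, so dominated convergence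
-- passes to the limit.
set_option maxHeartbeats 400000 in
theorem weak_divergence_of_hasCompactSupport (hf : ContDiff ℝ 2 f) (hc : HasCompactSupport f)
    {φ : E n → ℝ} {K : NNReal} (hφ : LipschitzWith K φ) (hφc : HasCompactSupport φ) :
    ∫ x, (φ x * divJ (jet1 Set.univ f x) (jet2 Set.univ f x)
      + fderiv ℝ φ x (flux Set.univ f x)) = 0 := by
  obtain ⟨ρ, hρ⟩ := exists_bump_seq n
  set g : ℕ → E n → E m := fun k => mollify (ρ k) f
  have hf' : ContDiff ℝ 1 (fderiv ℝ f) := hf.fderiv_right (by norm_num)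
  have hc' : HasCompactSupport (fderiv ℝ f) := hc.fderiv ℝ
  have hg1 : ∀ k, fderiv ℝ (g k) = mollify (ρ k) (fderiv ℝ f) := fun k =>
    fderiv_mollify _ hc (hf.of_le (by norm_num))
  obtain ⟨hlim1, C1, hC1⟩ := tendsto_fderiv_mollify (hf.of_le (by norm_num)) hc hρ
  obtain ⟨hlim2, C2, hC2⟩ := tendsto_fderiv_mollify hf' hc' hρ
  simp only [← hg1] at hlim2 hC2
  have hlimJ : ∀ x, Tendsto (fun k => (jet1 Set.univ (g k) x, jet2 Set.univ (g k) x)) atTop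
      (𝓝 (jet1 Set.univ f x, jet2 Set.univ f x)) := fun x => by
    refine Tendsto.prodMk_nhds ?_ ?_
    · refine tendsto_pi_nhds.2 fun α => tendsto_pi_nhds.2 fun i => ?_
      simp only [jet1_univ_apply]
      exact (((PiLp.continuous_apply 2 _ α).comp
        (continuous_eval_const (e i : E n))).tendsto _).comp (hlim1 x)
    · refine tendsto_pi_nhds.2 fun α => tendsto_pi_nhds.2 fun i => tendsto_pi_nhds.2 fun j => ?_
      simp only [jet2_univ_apply]
      exact (((PiLp.continuous_apply 2 _ α).comp ((continuous_eval_const (e j : E n)).comp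
        (continuous_eval_const (e i : E n)))).tendsto _).comp (hlim2 x)
  have hbd : ∀ k x, (jet1 Set.univ (g k) x, jet2 Set.univ (g k) x) ∈
      boundedJets n m (max C1 C2) := fun k x =>
    ⟨fun α i => (abs_jet1_univ_le x α i).trans ((hC1 k x).trans (le_max_left _ _)),
      fun α i j => (abs_jet2_univ_le x α i j).trans ((hC2 k x).trans (le_max_right _ _))⟩
  obtain ⟨M1, hM1⟩ := exists_bound_divJ (n := n) (m := m) (max C1 C2)
  obtain ⟨M2, hM2⟩ := exists_bound_fluxJ (n := n) (m := m) (max C1 C2)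
  have hgc : ∀ k, ContDiff ℝ ∞ (g k) := fun k => contDiff_mollify _ hf.continuous
  have hzero : ∀ k, ∫ x, (φ x * divJ (jet1 Set.univ (g k) x) (jet2 Set.univ (g k) x)
      + fderiv ℝ φ x (flux Set.univ (g k) x)) = 0 := fun k =>
    weak_divergence_of_contDiff_three (contDiff_infty.1 (hgc k) 3)
      (hasCompactSupport_mollify _ hc) hφ hφc
  have hlim := tendsto_integral_of_dominated_convergence (μ := volume)
    (F := fun k x => φ x * divJ (jet1 Set.univ (g k) x) (jet2 Set.univ (g k) x)
      + fderiv ℝ φ x (flux Set.univ (g k) x))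
    (f := fun x => φ x * divJ (jet1 Set.univ f x) (jet2 Set.univ f x)
      + fderiv ℝ φ x (flux Set.univ f x))
    (fun x => |φ x| * M1 + (tsupport φ).indicator (fun _ => K * M2) x) ?_ ?_ ?_ ?_
  · simp only [hzero] at hlim
    exact tendsto_nhds_unique hlim tendsto_const_nhds
  · intro k
    have hj : Continuous fun x => (jet1 Set.univ (g k) x, jet2 Set.univ (g k) x) := by
      refine Continuous.prodMk ?_ ?_
      · exact continuous_pi fun α => continuous_pi fun i =>
          (contDiff_jet1 (k := 0) (contDiff_infty.1 (hgc k) 1) α i).continuous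
      · exact continuous_pi fun α => continuous_pi fun i => continuous_pi fun j =>
          (contDiff_jet2 (k := 0) (contDiff_infty.1 (hgc k) 2) α i j).continuous
    refine ((hφ.continuous.mul (continuous_divJ.comp hj)).measurable.add ?_).aestronglyMeasurable
    exact measurable_fderiv_apply φ (continuous_toLp_fluxJ.comp hj).measurable
  · refine ((hφ.continuous.integrable_of_hasCompactSupport hφc).abs.mul_const _).add ?_
    rw [integrable_indicator_iff (isClosed_tsupport φ).measurableSet]
    exact integrableOn_const hφc.measure_lt_top.ne
  · intro k
    refine .of_forall fun x => ?_
    refine (norm_add_le _ _).trans (add_le_add ?_ ?_)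
    · have h1 := hM1 _ (hbd k x)
      rw [norm_mul, Real.norm_eq_abs]
      exact mul_le_mul_of_nonneg_left h1 (abs_nonneg _)
    · by_cases hx : x ∈ tsupport φ
      · have h2 := hM2 _ (hbd k x)
        rw [Set.indicator_of_mem hx]
        refine (ContinuousLinearMap.le_opNorm _ _).trans ?_
        exact mul_le_mul (norm_fderiv_le_of_lipschitz ℝ hφ) h2 (norm_nonneg _)
          K.2
      · rw [Set.indicator_of_notMem hx,
          (notMem_tsupport_iff_eventuallyEq.1 hx).fderiv_eq]
        simp
  · refine .of_forall fun x => ?_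
    have h1 := (continuous_divJ.tendsto (jet1 Set.univ f x, jet2 Set.univ f x)).comp (hlimJ x)
    have h2 := (continuous_toLp_fluxJ.tendsto (jet1 Set.univ f x, jet2 Set.univ f x)).comp
      (hlimJ x)
    exact (h1.const_mul _).add (((fderiv ℝ φ x).continuous.tendsto _).comp h2)

end WeakDivergence

/-! ### Localization to the interior of the domain -/

section LocalWeakDivergence

open scoped ContDiff Manifold

variable {n m : ℕ} {f g : E n → E m} {D : Set (E n)} {x : E n}

lemma fderivWithin_eventuallyEq (hD : D ∈ 𝓝 x) (h : f =ᶠ[𝓝 x] g) :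
    fderivWithin ℝ f D =ᶠ[𝓝 x] fderiv ℝ g := by
  filter_upwards [eventually_mem_nhds_iff.2 hD, h.eventuallyEq_nhds] with y hy hy'
  rw [fderivWithin_of_mem_nhds hy, hy'.fderiv_eq]

lemma jet1_congr (hD : D ∈ 𝓝 x) (h : f =ᶠ[𝓝 x] g) : jet1 D f x = jet1 Set.univ g x := by
  ext α i
  rw [jet1_univ_apply, jet1, Matrix.of_apply, pd, (fderivWithin_eventuallyEq hD h).self_of_nhds]

lemma jet2_congr (hD : D ∈ 𝓝 x) (h : f =ᶠ[𝓝 x] g) : jet2 D f x = jet2 Set.univ g x := by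
  ext α i j
  rw [jet2_univ_apply, jet2, Matrix.of_apply, pd2, hess, fderivWithin_of_mem_nhds hD,
    (fderivWithin_eventuallyEq hD h).fderiv_eq]

/-- Multiplying f by a cut-off equal to one near the support of φ gives a globally C² map of compact
support with the same jets wherever the integrand is nonzero. -/
theorem weak_divergence {K : Set (E n)} (hf : ContDiffOn ℝ 2 f (interior K)) {φ : E n → ℝ}
    {C : NNReal} (hφ : LipschitzWith C φ) (hφc : HasCompactSupport φ)
    (hφK : tsupport φ ⊆ interior K) :
    ∫ x, (φ x * divJ (jet1 K f x) (jet2 K f x) + fderiv ℝ φ x (flux K f x)) = 0 := by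
  obtain ⟨T, hT, hφT, hTK⟩ := exists_compact_between hφc isOpen_interior hφK
  obtain ⟨χ, h1, h0, -⟩ := exists_contMDiffMap_one_nhds_of_subset_interior (n := 2)
    𝓘(ℝ, E n) (isClosed_tsupport φ) hφT
  have hχ : ContDiff ℝ 2 χ := χ.contMDiff.contDiff
  set g : E n → E m := fun x => χ x • f x with hg
  have hg0 : ∀ x ∉ T, g x = 0 := fun x hx => by simp [hg, h0 x hx]
  have hgC : ContDiff ℝ 2 g := contDiff_iff_contDiffAt.2 fun x => by
    by_cases hx : x ∈ interior K
    · exact hχ.contDiffAt.smul (hf.contDiffAt (isOpen_interior.mem_nhds hx))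
    · have : g =ᶠ[𝓝 x] fun _ => 0 := by
        filter_upwards [hT.isClosed.isOpen_compl.mem_nhds fun h => hx (hTK h)] with y hy
        exact hg0 y hy
      exact contDiffAt_const.congr_of_eventuallyEq this
  have hgc : HasCompactSupport g := HasCompactSupport.intro hT hg0
  rw [← weak_divergence_of_hasCompactSupport hgC hgc hφ hφc]
  refine integral_congr_ae (.of_forall fun x => ?_)
  by_cases hx : x ∈ tsupport φ
  · have hK : K ∈ 𝓝 x := mem_interior_iff_mem_nhds.1 (hφK hx)
    have hfg : f =ᶠ[𝓝 x] g := by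
      filter_upwards [(eventually_nhdsSet_iff_forall.1 h1) x hx] with y hy
      simp [hg, hy]
    simp only [flux, jet1_congr hK hfg, jet2_congr hK hfg]
  · simp [(notMem_tsupport_iff_eventuallyEq.1 hx).fderiv_eq, image_eq_zero_of_notMem_tsupport hx]

end LocalWeakDivergence

/-- `s` is the weak divergence of `X` in the interior of `K`, tested with Lipschitz functions. -/
def IsWeakDivergence {n : ℕ} (K : Set (E n)) (X : E n → E n) (s : E n → ℝ) : Prop :=
  ∀ (φ : E n → ℝ) (C : NNReal), LipschitzWith C φ → HasCompactSupport φ → tsupport φ ⊆ interior K →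
    ∫ x, (φ x * s x + fderiv ℝ φ x (X x)) = 0

/-- The profile of the boundary layer. It vanishes up to 1, rather than 0, so that χ(k · height) is
supported at height at least 1/k, strictly inside the domain; the unit integral of χ' produces the
boundary term with coefficient one. -/
lemma exists_smooth_step : ∃ χ χ' : ℝ → ℝ, (∀ t, HasDerivAt χ (χ' t) t) ∧ Continuous χ' ∧
    (∀ t ≤ 1, χ t = 0) ∧ (∀ t, 2 ≤ t → χ t = 1) ∧ (∀ t, |χ t| ≤ 1) ∧ (∀ t ≤ 1, χ' t = 0) ∧
    HasCompactSupport χ' ∧ (∃ L, LipschitzWith L χ) ∧ ∫ t, χ' t = 1 := by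
  set χ : ℝ → ℝ := fun t => Real.smoothTransition (t - 1) with hχ
  have hC : ContDiff ℝ 1 χ := Real.smoothTransition.contDiff.comp (contDiff_id.sub contDiff_const)
  have h0 : ∀ t ≤ 1, χ t = 0 := fun t ht =>
    Real.smoothTransition.zero_of_nonpos (by linarith)
  have h1 : ∀ t, 2 ≤ t → χ t = 1 := fun t ht =>
    Real.smoothTransition.one_of_one_le (by linarith)
  have hd : ∀ t, HasDerivAt χ (deriv χ t) t := fun t =>
    (hC.differentiable (by simp) t).hasDerivAt
  have hcont : Continuous (deriv χ) := hC.continuous_deriv (by simp)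
  have hz1 : ∀ t ∉ Set.Icc (1 : ℝ) 2, deriv χ t = 0 := by
    intro t ht
    rw [Set.mem_Icc, not_and_or, not_le, not_le] at ht
    rcases ht with ht | ht
    · have : χ =ᶠ[𝓝 t] fun _ => 0 := by
        filter_upwards [Iio_mem_nhds ht] with s hs using h0 s (le_of_lt hs)
      rw [this.deriv_eq]; simp
    · have : χ =ᶠ[𝓝 t] fun _ => 1 := by
        filter_upwards [Ioi_mem_nhds ht] with s hs using h1 s (le_of_lt hs)
      rw [this.deriv_eq]; simp
  have hcs : HasCompactSupport (deriv χ) := HasCompactSupport.intro isCompact_Icc hz1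
  have hz2 : ∀ t ≤ 1, deriv χ t = 0 := by
    intro t ht
    rcases ht.lt_or_eq with ht | rfl
    · exact hz1 t fun h => absurd h.1 (not_le.2 ht)
    -- At t = 1 itself the derivative vanishes by continuity from the left.
    · have hcl : IsClosed {t | deriv χ t = 0} := isClosed_eq hcont continuous_const
      have : Set.Iio (1 : ℝ) ⊆ {t | deriv χ t = 0} := fun s hs =>
        hz1 s fun h => absurd h.1 (not_le.2 hs)
      exact closure_minimal this hcl (by simp)
  obtain ⟨L, hL⟩ := hcont.bounded_above_of_compact_support hcs
  refine ⟨χ, deriv χ, hd, hcont, h0, h1, fun t => ?_, hz2, hcs, ⟨L.toNNReal, ?_⟩, ?_⟩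
  · rw [abs_of_nonneg (Real.smoothTransition.nonneg _)]
    exact Real.smoothTransition.le_one _
  · refine lipschitzWith_of_nnnorm_deriv_le (hC.differentiable (by simp)) fun x => ?_
    exact NNReal.le_toNNReal_of_coe_le (hL x)
  · have := integral_of_hasDerivAt_of_tendsto hd (hcont.integrable_of_hasCompactSupport hcs)
      (m := 0) (n := 1) ?_ ?_
    · simpa using this
    · exact tendsto_const_nhds.congr' (by
        filter_upwards [eventually_le_atBot 1] with t ht using (h0 t ht).symm)
    · exact tendsto_const_nhds.congr' (by
        filter_upwards [eventually_ge_atTop 2] with t ht using (h1 t ht).symm)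

/-! ### Charts over a hyperplane given by a Lipschitz height function -/

section Chart

variable {n : ℕ} (v : E n) (h : (ℝ ∙ v)ᗮ → ℝ)

/-- The height of a point above the graph of `h : v^⊥ → ℝ`. -/
def height (x : E n) : ℝ := ⟪v, x⟫ - h ((ℝ ∙ v)ᗮ.orthogonalProjectionOnto x)

/-- The point of height `t` over the point of the graph of `h : v^⊥ → ℝ` above `y`. -/
def chartPt (y : (ℝ ∙ v)ᗮ) (t : ℝ) : E n := (y : E n) + (h y + t) • v

/-- The conormal `∇h - v` of the graph of `h : v^⊥ → ℝ`. -/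
def conormal (y : (ℝ ∙ v)ᗮ) : E n := ((gradient h y : (ℝ ∙ v)ᗮ) : E n) - v

variable {v h}

lemma inner_coe_orthogonal (y : (ℝ ∙ v)ᗮ) : ⟪v, (y : E n)⟫ = 0 :=
  Submodule.mem_orthogonal_singleton_iff_inner_right.1 y.2

lemma proj_chartPt (y : (ℝ ∙ v)ᗮ) (t : ℝ) :
    (ℝ ∙ v)ᗮ.orthogonalProjectionOnto (chartPt v h y t) = y := by
  rw [chartPt, map_add, map_smul, Submodule.orthogonalProjectionOnto_mem_subspace_eq_self,
    Submodule.orthogonalProjectionOnto_orthogonalComplement_singleton_eq_zero, smul_zero,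
    add_zero]

lemma height_chartPt (hv : ‖v‖ = 1) (y : (ℝ ∙ v)ᗮ) (t : ℝ) : height v h (chartPt v h y t) = t := by
  rw [height, proj_chartPt, chartPt, inner_add_right, inner_coe_orthogonal, inner_smul_right,
    real_inner_self_eq_norm_sq, hv]
  ring

lemma chartPt_proj_height (hv : ‖v‖ = 1) (x : E n) :
    chartPt v h ((ℝ ∙ v)ᗮ.orthogonalProjectionOnto x) (height v h x) = x := by
  rw [chartPt, height, add_sub_cancel]
  have h1 := Submodule.starProjection_orthogonal_val (K := ℝ ∙ v) x
  rw [Submodule.starProjection_unit_singleton ℝ hv] at h1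
  rw [show (((ℝ ∙ v)ᗮ.orthogonalProjectionOnto x : (ℝ ∙ v)ᗮ) : E n) =
    (ℝ ∙ v)ᗮ.starProjection x from rfl, h1, sub_add_cancel]

lemma continuous_chartPt (hh : Continuous h) :
    Continuous fun p : (ℝ ∙ v)ᗮ × ℝ => chartPt v h p.1 p.2 := by
  unfold chartPt; fun_prop

lemma continuous_height (hh : Continuous h) : Continuous (height v h) := by
  unfold height; fun_prop

/-- The chart of `ℝ^n` given by a function on `v^⊥`. -/
def chartEquiv (hv : ‖v‖ = 1) (hh : Continuous h) : (ℝ ∙ v)ᗮ × ℝ ≃ₜ E n where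
  toFun p := chartPt v h p.1 p.2
  invFun x := ((ℝ ∙ v)ᗮ.orthogonalProjectionOnto x, height v h x)
  left_inv p := by simp [proj_chartPt, height_chartPt hv]
  right_inv x := chartPt_proj_height hv x
  continuous_toFun := continuous_chartPt hh
  continuous_invFun := by
    have := continuous_height hh
    fun_prop

/-- A shear in the v direction is fibrewise a translation, so it preserves volume; the rest is the
orthogonal splitting of space along the unit vector v. -/
lemma measurePreserving_chartPt (hv : ‖v‖ = 1) (hh : Continuous h) :
    MeasurePreserving (fun p : (ℝ ∙ v)ᗮ × ℝ => chartPt v h p.1 p.2) := by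
  have h1 : MeasurePreserving (fun p : (ℝ ∙ v)ᗮ × ℝ => (p.1, h p.1 + p.2)) :=
    (MeasurePreserving.id volume).skew_product (g := fun y t => h y + t)
      (by fun_prop) (.of_forall fun y => map_add_left_eq_self _ _)
  have h2 : MeasurePreserving (Prod.swap : (ℝ ∙ v)ᗮ × ℝ → ℝ × (ℝ ∙ v)ᗮ) :=
    Measure.measurePreserving_swap
  have h3 : MeasurePreserving (Prod.map (LinearIsometryEquiv.toSpanUnitSingleton v hv) id :
      ℝ × (ℝ ∙ v)ᗮ → (ℝ ∙ v) × (ℝ ∙ v)ᗮ) :=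
    (LinearIsometryEquiv.toSpanUnitSingleton (𝕜 := ℝ) v hv).measurePreserving.prod
      (MeasurePreserving.id volume)
  have h4 := (Submodule.measurePreserving_measurableEquivProd (ℝ ∙ v) (0 : E n)).symm
  rw [InnerProductSpace.euclideanHausdorffMeasure_eq_volume] at h4
  have := h4.comp (h3.comp (h2.comp h1))
  convert this using 1
  ext1 p
  simp [chartPt, add_comm]

lemma measurableEmbedding_chartPt (hv : ‖v‖ = 1) (hh : Continuous h) :
    MeasurableEmbedding fun p : (ℝ ∙ v)ᗮ × ℝ => chartPt v h p.1 p.2 :=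
  (chartEquiv hv hh).measurableEmbedding

lemma integral_chartPt (hv : ‖v‖ = 1) (hh : Continuous h) (F : E n → ℝ) :
    ∫ x, F x = ∫ p : (ℝ ∙ v)ᗮ × ℝ, F (chartPt v h p.1 p.2) :=
  ((measurePreserving_chartPt hv hh).integral_comp (measurableEmbedding_chartPt hv hh) F).symm

lemma measurable_conormal : Measurable (conormal v h) := by
  have h1 : Measurable (gradient h) :=
    (InnerProductSpace.toDual ℝ _).symm.continuous.measurable.comp (measurable_fderiv ℝ h)
  exact (measurable_subtype_coe.comp h1).sub_const v

lemma norm_conormal_le {C : NNReal} (hv : ‖v‖ = 1) (hh : LipschitzWith C h) (y : (ℝ ∙ v)ᗮ) :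
    ‖conormal v h y‖ ≤ C + 1 := by
  refine (norm_sub_le _ _).trans ?_
  rw [hv]
  gcongr
  change ‖gradient h y‖ ≤ C
  rw [gradient, LinearIsometryEquiv.norm_map]
  exact norm_fderiv_le_of_lipschitz ℝ hh

lemma exists_lipschitzWith_height {C : NNReal} (hh : LipschitzWith C h) :
    ∃ L, LipschitzWith L (height v h) :=
  ⟨_, (innerSL ℝ v).lipschitz.sub
    (hh.comp ((ℝ ∙ v)ᗮ.orthogonalProjectionOnto).lipschitz)⟩

/-- The height has gradient -conormal: the conormal points downwards, out of the region above the
graph. This fixes the sign of all boundary terms. -/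
lemma hasFDerivAt_height {x : E n}
    (hd : DifferentiableAt ℝ h ((ℝ ∙ v)ᗮ.orthogonalProjectionOnto x)) :
    HasFDerivAt (height v h)
      (-(innerSL ℝ (conormal v h ((ℝ ∙ v)ᗮ.orthogonalProjectionOnto x)))) x := by
  have h1 : HasFDerivAt (height v h) (innerSL ℝ v -
      (fderiv ℝ h ((ℝ ∙ v)ᗮ.orthogonalProjectionOnto x)).comp
        (ℝ ∙ v)ᗮ.orthogonalProjectionOnto) x :=
    (innerSL ℝ v).hasFDerivAt.sub
      (hd.hasFDerivAt.comp x ((ℝ ∙ v)ᗮ.orthogonalProjectionOnto).hasFDerivAt)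
  convert h1 using 1
  ext w
  set y := (ℝ ∙ v)ᗮ.orthogonalProjectionOnto x
  have h2 : fderiv ℝ h y ((ℝ ∙ v)ᗮ.orthogonalProjectionOnto w) =
      ⟪gradient h y, (ℝ ∙ v)ᗮ.orthogonalProjectionOnto w⟫ := by
    rw [gradient, InnerProductSpace.toDual_symm_apply]
  simp only [conormal, _root_.neg_apply, _root_.sub_apply, innerSL_apply_apply,
    ContinuousLinearMap.comp_apply, h2, inner_sub_left,
    Submodule.inner_orthogonalProjectionOnto_eq_of_mem_left]
  ring

end Chart

/-! ### Testing the weak divergence with a boundary cut-off -/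

section ChartDivergence

variable {n : ℕ}

/-- The cut-off of `ψ` near the graph of `h`. -/
def chartCutoff (v : E n) (h : (ℝ ∙ v)ᗮ → ℝ) (ψ : E n → ℝ) (χ : ℝ → ℝ) (k : ℝ) (x : E n) : ℝ :=
  ψ x * χ (k * height v h x)

variable {v : E n} {h : (ℝ ∙ v)ᗮ → ℝ} {ψ : E n → ℝ} {χ χ' : ℝ → ℝ}

lemma exists_lipschitzWith_chartCutoff {C L : NNReal} (hh : LipschitzWith C h)
    (hψ : ContDiff ℝ 1 ψ) (hψc : HasCompactSupport ψ) (hχ : LipschitzWith L χ)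
    (hχ1 : ∀ t, |χ t| ≤ 1) (k : ℝ) : ∃ A, LipschitzWith A (chartCutoff v h ψ χ k) := by
  obtain ⟨A, hA⟩ := hψ.lipschitzWith_of_hasCompactSupport hψc (by simp)
  obtain ⟨M, hM⟩ := hψ.continuous.bounded_above_of_compact_support hψc
  obtain ⟨B, hB⟩ := exists_lipschitzWith_height (v := v) hh
  have hM0 : 0 ≤ M := (norm_nonneg _).trans (hM 0)
  refine ⟨A + M.toNNReal * (L * (‖k‖₊ * B)), LipschitzWith.of_dist_le_mul fun x y => ?_⟩
  simp only [Real.dist_eq, chartCutoff, NNReal.coe_add, NNReal.coe_mul, Real.coe_toNNReal M hM0,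
    coe_nnnorm]
  have h1 := hA.dist_le_mul x y
  have h2 := hχ.dist_le_mul (k * height v h x) (k * height v h y)
  have h3 := hB.dist_le_mul x y
  rw [Real.dist_eq] at h1 h2 h3
  have h4 : dist (k * height v h x) (k * height v h y) = ‖k‖ * |height v h x - height v h y| := by
    rw [Real.dist_eq, ← mul_sub, abs_mul, Real.norm_eq_abs]
  rw [h4] at h2
  have h5 : |χ (k * height v h x) - χ (k * height v h y)| ≤ L * (‖k‖ * (B * dist x y)) :=
    h2.trans (by gcongr)
  have e : ψ x * χ (k * height v h x) - ψ y * χ (k * height v h y) =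
      (ψ x - ψ y) * χ (k * height v h x)
        + ψ y * (χ (k * height v h x) - χ (k * height v h y)) := by ring
  rw [e]
  refine (abs_add_le _ _).trans ?_
  rw [abs_mul, abs_mul]
  have := mul_le_mul h1 (hχ1 (k * height v h x)) (abs_nonneg _) (by positivity)
  have := mul_le_mul (hM y) h5 (abs_nonneg _) hM0
  rw [Real.norm_eq_abs] at this
  nlinarith

variable {K U : Set (E n)} {X : E n → E n} {s : E n → ℝ}

lemma tsupport_chartCutoff_subset (hh : Continuous h) (hχ0 : ∀ t ≤ 1, χ t = 0) {k : ℝ}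
    (hk : 0 < k) : tsupport (chartCutoff v h ψ χ k) ⊆ tsupport ψ ∩ {x | 0 < height v h x} := by
  have hcl : IsClosed {x : E n | 1 / k ≤ height v h x} :=
    isClosed_le continuous_const (continuous_height hh)
  have : tsupport (chartCutoff v h ψ χ k) ⊆ tsupport ψ ∩ {x | 1 / k ≤ height v h x} := by
    refine closure_minimal (fun x hx => ⟨subset_tsupport _ ?_, ?_⟩)
      ((isClosed_tsupport ψ).inter hcl)
    · exact fun h0 => hx (by simp [chartCutoff, h0])
    · by_contra h0
      apply hx
      have h0 : height v h x < 1 / k := not_le.1 h0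
      rw [lt_div_iff₀ hk] at h0
      rw [chartCutoff, hχ0 _ (by linarith), mul_zero]
  exact this.trans (Set.inter_subset_inter_right _ fun x (hx : 1 / k ≤ height v h x) =>
    lt_of_lt_of_le (by positivity) hx)

lemma subset_interior_of_chart (hh : Continuous h) (hU : IsOpen U)
    (hK : ∀ x ∈ U, x ∈ K ↔ 0 ≤ height v h x) : U ∩ {x | 0 < height v h x} ⊆ interior K :=
  interior_maximal (fun x hx => (hK x hx.1).2 (le_of_lt hx.2))
    (hU.inter (isOpen_lt continuous_const (continuous_height hh)))

/-- The weak divergence is tested with ψ χ(k · height), whose derivative exists over almost every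
point of the hyperplane by Rademacher. The part falling on χ is the boundary layer, carrying the
flux through the conormal. -/
theorem chartCutoff_identity {C L : NNReal} (hv : ‖v‖ = 1) (hh : LipschitzWith C h)
    (hU : IsOpen U) (hK : ∀ x ∈ U, x ∈ K ↔ 0 ≤ height v h x)
    (hw : IsWeakDivergence K X s) (hψ : ContDiff ℝ 1 ψ) (hψc : HasCompactSupport ψ)
    (hψU : tsupport ψ ⊆ U) (hχ : LipschitzWith L χ) (hχ1 : ∀ t, |χ t| ≤ 1)
    (hχ0 : ∀ t ≤ 1, χ t = 0) (hχ' : ∀ t, HasDerivAt χ (χ' t) t) {k : ℝ} (hk : 0 < k) :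
    ∫ p : (ℝ ∙ v)ᗮ × ℝ, (χ (k * p.2) * (ψ (chartPt v h p.1 p.2) * s (chartPt v h p.1 p.2)
        + fderiv ℝ ψ (chartPt v h p.1 p.2) (X (chartPt v h p.1 p.2)))
      - k * χ' (k * p.2) * (ψ (chartPt v h p.1 p.2)
        * ⟪conormal v h p.1, X (chartPt v h p.1 p.2)⟫)) = 0 := by
  obtain ⟨A, hA⟩ := exists_lipschitzWith_chartCutoff (v := v) hh hψ hψc hχ hχ1 k
  have hts := tsupport_chartCutoff_subset (v := v) (ψ := ψ) hh.continuous hχ0 hk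
  have h0 := hw _ A hA (hψc.of_isClosed_subset (isClosed_tsupport _)
    (hts.trans Set.inter_subset_left))
    (hts.trans ((Set.inter_subset_inter_left _ hψU).trans
      (subset_interior_of_chart hh.continuous hU hK)))
  rw [integral_chartPt hv hh.continuous] at h0
  rw [← h0]
  refine integral_congr_ae ?_
  have hae : ∀ᵐ p : (ℝ ∙ v)ᗮ × ℝ, DifferentiableAt ℝ h p.1 :=
    Measure.quasiMeasurePreserving_fst.ae (hh.ae_differentiableAt (μ := volume))
  filter_upwards [hae] with p hp
  set x := chartPt v h p.1 p.2
  have hpx : (ℝ ∙ v)ᗮ.orthogonalProjectionOnto x = p.1 := proj_chartPt _ _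
  have hhx : height v h x = p.2 := height_chartPt hv _ _
  have hd : HasFDerivAt (height v h) (-(innerSL ℝ (conormal v h p.1))) x := by
    have := hasFDerivAt_height (v := v) (h := h) (x := x) (by rwa [hpx])
    rwa [hpx] at this
  have hd1 : HasFDerivAt (fun x => χ (k * height v h x)) _ x :=
    (hχ' (k * height v h x)).comp_hasFDerivAt x (hd.const_mul k)
  have hd2 : HasFDerivAt (chartCutoff v h ψ χ k) _ x :=
    ((hψ.differentiable (by simp) x).hasFDerivAt).mul hd1
  rw [hd2.fderiv, chartCutoff, hhx]
  simp only [_root_.add_apply, _root_.smul_apply, _root_.neg_apply, innerSL_apply_apply,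
    smul_eq_mul]
  ring

end ChartDivergence

/-! ### The limit of the boundary layer -/

section ChartLimit

variable {n : ℕ} {v : E n} {h : (ℝ ∙ v)ᗮ → ℝ} {ψ : E n → ℝ} {K U : Set (E n)}
  {X : E n → E n} {s : E n → ℝ}

lemma integral_scale_snd {Y : Type*} [MeasureSpace Y] [SFinite (volume : Measure Y)]
    {F : Y × ℝ → ℝ} {χ' : ℝ → ℝ} {k : ℝ} (hk : 0 < k)
    (h1 : Integrable fun p : Y × ℝ => k * χ' (k * p.2) * F p)
    (h2 : Integrable fun p : Y × ℝ => χ' p.2 * F (p.1, p.2 / k)) :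
    ∫ p : Y × ℝ, k * χ' (k * p.2) * F p = ∫ p : Y × ℝ, χ' p.2 * F (p.1, p.2 / k) := by
  rw [Measure.volume_eq_prod] at h1 h2 ⊢
  rw [integral_prod _ h1, integral_prod _ h2]
  refine integral_congr_ae (.of_forall fun y => ?_)
  have := Measure.integral_comp_mul_left (fun t => k * χ' t * F (y, t / k)) k
  simp only [mul_div_cancel_left₀ _ hk.ne'] at this
  simp only [this, abs_of_pos (inv_pos.2 hk), smul_eq_mul]
  rw [← integral_const_mul]
  refine integral_congr_ae (.of_forall fun t => ?_)
  field_simp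

lemma exists_bound_on_tsupport {F : Type*} [NormedAddCommGroup F] {X : E n → F}
    (hK : IsClosed K) (hX : ContinuousOn X K) (hψc : HasCompactSupport ψ) :
    ∃ M, 0 ≤ M ∧ ∀ x ∈ K, x ∈ tsupport ψ → ‖X x‖ ≤ M := by
  obtain ⟨M, hM⟩ := (hψc.inter_left hK).exists_bound_of_continuousOn
    (hX.mono Set.inter_subset_left)
  exact ⟨max M 0, le_max_right _ _, fun x hx hx' => (hM x ⟨hx, hx'⟩).trans (le_max_left _ _)⟩

lemma integrableOn_divergence_mul (hKc : IsClosed K) (hX : ContinuousOn X K)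
    (hs : ContinuousOn s K) (hψ : ContDiff ℝ 1 ψ) (hψc : HasCompactSupport ψ) :
    IntegrableOn (fun x => ψ x * s x + fderiv ℝ ψ x (X x)) K := by
  have h1 : ContinuousOn (fun x => ψ x * s x + fderiv ℝ ψ x (X x)) K :=
    (hψ.continuous.continuousOn.mul hs).add
      ((hψ.continuous_fderiv (by simp)).continuousOn.clm_apply hX)
  have h2 : IntegrableOn (fun x => ψ x * s x + fderiv ℝ ψ x (X x)) (K ∩ tsupport ψ) :=
    (h1.mono Set.inter_subset_left).integrableOn_compact (hψc.inter_left hKc)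
  refine (integrableOn_iff_integrable_of_support_subset (s := tsupport ψ) fun x hx => ?_).1 ?_
  · by_contra hx'
    apply hx
    simp [(notMem_tsupport_iff_eventuallyEq.1 hx').fderiv_eq,
      image_eq_zero_of_notMem_tsupport hx']
  · rw [IntegrableOn, Measure.restrict_restrict (isClosed_tsupport ψ).measurableSet,
      Set.inter_comm]
    exact h2

/-- As k → ∞ the volume term fills K, while the boundary layer, rescaled by t ↦ t/k, collapses onto
the graph with total weight ∫ χ' = 1. The flux appears as an integral over the hyperplane, so no
surface measure and no regularity of h beyond Lipschitz is needed. -/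
theorem chart_divergence {C : NNReal} (hv : ‖v‖ = 1) (hh : LipschitzWith C h)
    (hU : IsOpen U) (hKc : IsClosed K) (hK : ∀ x ∈ U, x ∈ K ↔ 0 ≤ height v h x)
    (hw : IsWeakDivergence K X s) (hX : ContinuousOn X K) (hXm : Measurable X)
    (hs : ContinuousOn s K) (hsm : Measurable s)
    (hψ : ContDiff ℝ 1 ψ) (hψc : HasCompactSupport ψ) (hψU : tsupport ψ ⊆ U) :
    Integrable (fun y => ψ (chartPt v h y 0) * ⟪conormal v h y, X (chartPt v h y 0)⟫) ∧
    ∫ x in K, (ψ x * s x + fderiv ℝ ψ x (X x)) =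
      ∫ y, ψ (chartPt v h y 0) * ⟪conormal v h y, X (chartPt v h y 0)⟫ := by
  obtain ⟨χ, χ', hχ', hχ'c, hχ0, hχ2, hχ1, hχ'0, hχ'cs, ⟨L, hχL⟩, hχ'i⟩ := exists_smooth_step
  set Θ : (ℝ ∙ v)ᗮ × ℝ → E n := fun p => chartPt v h p.1 p.2 with hΘ
  have hΘc : Continuous Θ := continuous_chartPt hh.continuous
  have hΘK : ∀ p, Θ p ∈ tsupport ψ → (Θ p ∈ K ↔ 0 ≤ p.2) := fun p hp => by
    rw [hK _ (hψU hp), hΘ, height_chartPt hv]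
  set A : E n → ℝ := fun x => ψ x * s x + fderiv ℝ ψ x (X x) with hA
  have hA0 : ∀ x ∉ tsupport ψ, A x = 0 := fun x hx => by
    simp [hA, (notMem_tsupport_iff_eventuallyEq.1 hx).fderiv_eq,
      image_eq_zero_of_notMem_tsupport hx]
  have hAm : Measurable A := (hψ.continuous.measurable.mul hsm).add (measurable_fderiv_apply ψ hXm)
  set B : (ℝ ∙ v)ᗮ × ℝ → ℝ := {p | 0 < p.2}.indicator fun p => A (Θ p) with hB
  set Z : (ℝ ∙ v)ᗮ × ℝ → ℝ := fun p => ψ (Θ p) * ⟪conormal v h p.1, X (Θ p)⟫ with hZ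
  have hZm : Measurable Z := (hψ.continuous.measurable.comp hΘc.measurable).mul
    ((measurable_conormal.comp measurable_fst).inner (hXm.comp hΘc.measurable))
  -- the volume term
  have hKm : MeasurableSet K := hKc.measurableSet
  have hAi : Integrable (K.indicator A) := (integrable_indicator_iff hKm).2
    (integrableOn_divergence_mul hKc hX hs hψ hψc)
  have hBae : (fun p => K.indicator A (Θ p)) =ᵐ[volume] B := by
    have hne : ∀ᵐ p : (ℝ ∙ v)ᗮ × ℝ, p.2 ≠ 0 :=
      Measure.quasiMeasurePreserving_snd.ae (Measure.ae_ne volume 0)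
    filter_upwards [hne] with p hp
    by_cases hpt : Θ p ∈ tsupport ψ
    · by_cases hp0 : 0 < p.2
      · rw [hB, Set.indicator_of_mem ((hΘK p hpt).2 hp0.le), Set.indicator_of_mem (by exact hp0)]
      · rw [hB, Set.indicator_of_notMem, Set.indicator_of_notMem (by exact hp0)]
        rw [hΘK p hpt]
        exact fun h0 => hp0 (lt_of_le_of_ne h0 (Ne.symm hp))
    · simp only [hB, Set.indicator, hA0 _ hpt, ite_self]
  have hBi : Integrable B := (((measurePreserving_chartPt hv hh.continuous).integrable_comp_emb
    (measurableEmbedding_chartPt hv hh.continuous)).2 hAi).congr hBae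
  have hBint : ∫ x in K, A x = ∫ p, B p := by
    rw [← integral_indicator hKm, integral_chartPt hv hh.continuous, integral_congr_ae hBae]
  have hχB : ∀ k : ℕ, (fun p : (ℝ ∙ v)ᗮ × ℝ => χ ((k + 1 : ℝ) * p.2) * A (Θ p)) =
      fun p => χ ((k + 1 : ℝ) * p.2) * B p := fun k => by
    ext1 p
    by_cases hp : 0 < p.2
    · rw [hB, Set.indicator_of_mem (by exact hp)]
    · rw [hχ0 _ (by nlinarith), zero_mul, zero_mul]
  have hχm : Measurable χ := hχL.continuous.measurable
  have hχBm : ∀ k : ℕ, AEStronglyMeasurable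
      (fun p : (ℝ ∙ v)ᗮ × ℝ => χ ((k + 1 : ℝ) * p.2) * B p) := fun k =>
    (hχm.comp (measurable_snd.const_mul _)).aestronglyMeasurable.mul hBi.aestronglyMeasurable
  have hχBle : ∀ (k : ℕ) p, ‖χ ((k + 1 : ℝ) * p.2) * B p‖ ≤ ‖B p‖ := fun k p => by
    rw [norm_mul]
    exact mul_le_of_le_one_left (norm_nonneg _) (hχ1 _)
  have hlimB : Tendsto (fun k : ℕ => ∫ p, χ ((k + 1 : ℝ) * p.2) * B p) atTop (𝓝 (∫ p, B p)) := by
    refine tendsto_integral_of_dominated_convergence (fun p => ‖B p‖) hχBm hBi.norm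
      (fun k => .of_forall fun p => hχBle k p) (.of_forall fun p => ?_)
    by_cases hp : 0 < p.2
    · refine tendsto_const_nhds.congr' ?_
      filter_upwards [eventually_ge_atTop ⌈2 / p.2⌉₊] with k hk
      have : 2 / p.2 ≤ k := (Nat.le_ceil _).trans (by exact_mod_cast hk)
      rw [div_le_iff₀ hp] at this
      rw [hχ2 _ (by nlinarith), one_mul]
    · simp [hB, Set.indicator_of_notMem (show p ∉ {p : (ℝ ∙ v)ᗮ × ℝ | 0 < p.2} from hp)]
  -- the boundary term
  obtain ⟨M, hM0, hM⟩ := exists_bound_on_tsupport hKc hX hψc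
  obtain ⟨M', hM'⟩ := hψ.continuous.bounded_above_of_compact_support hψc
  have hM'0 : 0 ≤ M' := (norm_nonneg _).trans (hM' 0)
  set P : Set (ℝ ∙ v)ᗮ := (ℝ ∙ v)ᗮ.orthogonalProjectionOnto '' tsupport ψ with hP
  have hPc : IsCompact P := hψc.image (ℝ ∙ v)ᗮ.orthogonalProjectionOnto.continuous
  set Mz := M' * ((C + 1) * M) with hMz
  -- X is controlled only on K, that is for t ≥ 0; for t < 0 the factor χ' vanishes.
  have hZb : ∀ p : (ℝ ∙ v)ᗮ × ℝ, 0 ≤ p.2 → ‖Z p‖ ≤ P.indicator (fun _ => Mz) p.1 := by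
    intro p hp
    by_cases hpt : Θ p ∈ tsupport ψ
    · have hpP : p.1 ∈ P := ⟨_, hpt, proj_chartPt _ _⟩
      rw [Set.indicator_of_mem hpP, hZ, norm_mul]
      refine mul_le_mul (hM' _) ((norm_inner_le_norm _ _).trans ?_) (norm_nonneg _) hM'0
      exact mul_le_mul (norm_conormal_le hv hh _) (hM _ ((hΘK p hpt).2 hp) hpt) (norm_nonneg _)
        (by positivity)
    · simp only [hZ, image_eq_zero_of_notMem_tsupport hpt, zero_mul, norm_zero]
      exact Set.indicator_nonneg (fun _ _ => by positivity) _
  have hPi : Integrable (P.indicator fun _ => Mz) := by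
    rw [integrable_indicator_iff hPc.isClosed.measurableSet]
    exact integrableOn_const hPc.measure_lt_top.ne
  have hχ'm : Measurable χ' := hχ'c.measurable
  have hχ'int : Integrable χ' := hχ'c.integrable_of_hasCompactSupport hχ'cs
  have hZ0i : Integrable fun y => Z (y, 0) :=
    hPi.mono' (hZm.comp (by fun_prop)).aestronglyMeasurable (.of_forall fun y => hZb (y, 0) le_rfl)
  have hdom : Integrable fun p : (ℝ ∙ v)ᗮ × ℝ =>
      P.indicator (fun _ => Mz) p.1 * ‖χ' p.2‖ := hPi.mul_prod hχ'int.norm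
  have hsb : ∀ (k : ℕ) (p : (ℝ ∙ v)ᗮ × ℝ), ‖χ' p.2 * Z (p.1, p.2 / (k + 1 : ℝ))‖ ≤
      P.indicator (fun _ => Mz) p.1 * ‖χ' p.2‖ := fun k p => by
    rw [norm_mul, mul_comm]
    by_cases hp : 0 ≤ p.2
    · exact mul_le_mul_of_nonneg_right (hZb (p.1, p.2 / (k + 1 : ℝ))
        (div_nonneg hp (by positivity))) (norm_nonneg _)
    · rw [hχ'0 _ (by linarith)]; simp
  have hsm' : ∀ k : ℕ, AEStronglyMeasurable
      (fun p : (ℝ ∙ v)ᗮ × ℝ => χ' p.2 * Z (p.1, p.2 / (k + 1 : ℝ))) := fun k =>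
    ((hχ'm.comp measurable_snd).mul (hZm.comp (by fun_prop))).aestronglyMeasurable
  have hint2 : ∀ k : ℕ, Integrable fun p : (ℝ ∙ v)ᗮ × ℝ =>
      χ' p.2 * Z (p.1, p.2 / (k + 1 : ℝ)) := fun k =>
    hdom.mono' (hsm' k) (.of_forall fun p => hsb k p)
  have hint1 : ∀ k : ℕ, Integrable fun p : (ℝ ∙ v)ᗮ × ℝ =>
      (k + 1 : ℝ) * χ' ((k + 1 : ℝ) * p.2) * Z p := fun k => by
    have hk : (0 : ℝ) < k + 1 := by positivity
    have hd : Integrable fun p : (ℝ ∙ v)ᗮ × ℝ =>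
        P.indicator (fun _ => Mz) p.1 * ‖(k + 1 : ℝ) * χ' ((k + 1 : ℝ) * p.2)‖ :=
      hPi.mul_prod ((hχ'int.comp_mul_left' hk.ne').const_mul _).norm
    refine hd.mono' (((hχ'm.comp (measurable_snd.const_mul _)).const_mul _).mul
      hZm).aestronglyMeasurable (.of_forall fun p => ?_)
    rw [norm_mul, mul_comm]
    by_cases hp : 0 ≤ p.2
    · exact mul_le_mul_of_nonneg_right (hZb p hp) (norm_nonneg _)
    · rw [hχ'0 _ (by nlinarith)]; simp
  -- The graph is approached from above, so continuity of X within K suffices.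
  have hlimZ : Tendsto (fun k : ℕ => ∫ p : (ℝ ∙ v)ᗮ × ℝ, χ' p.2 * Z (p.1, p.2 / (k + 1 : ℝ)))
      atTop (𝓝 (∫ p : (ℝ ∙ v)ᗮ × ℝ, χ' p.2 * Z (p.1, 0))) := by
    refine tendsto_integral_of_dominated_convergence _ hsm' hdom
      (fun k => .of_forall fun p => hsb k p) (.of_forall fun p => ?_)
    by_cases hp : 0 ≤ p.2
    swap
    · rw [hχ'0 _ (by linarith)]; simp
    refine Tendsto.const_mul _ ?_
    have ht : Tendsto (fun k : ℕ => Θ (p.1, p.2 / (k + 1 : ℝ))) atTop (𝓝 (Θ (p.1, 0))) := by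
      refine (hΘc.tendsto _).comp (tendsto_const_nhds.prodMk_nhds ?_)
      have := tendsto_one_div_add_atTop_nhds_zero_nat (𝕜 := ℝ).const_mul p.2
      simpa [div_eq_mul_inv] using this
    by_cases hpt : Θ (p.1, 0) ∈ tsupport ψ
    · have hmem : Θ (p.1, 0) ∈ K := (hΘK _ hpt).2 le_rfl
      have hev : ∀ᶠ k : ℕ in atTop, Θ (p.1, p.2 / (k + 1 : ℝ)) ∈ K := by
        filter_upwards [ht.eventually (hU.mem_nhds (hψU hpt))] with k hk
        rw [hK _ hk, hΘ, height_chartPt hv]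
        positivity
      have hXt := (hX _ hmem).tendsto.comp
        (tendsto_nhdsWithin_iff.2 ⟨ht, hev⟩)
      exact ((hψ.continuous.tendsto _).comp ht).mul (tendsto_const_nhds.inner hXt)
    · have hz : Z (p.1, 0) = 0 := by simp [hZ, image_eq_zero_of_notMem_tsupport hpt]
      rw [hz]
      refine tendsto_const_nhds.congr' ?_
      filter_upwards [ht.eventually ((isClosed_tsupport ψ).isOpen_compl.mem_nhds hpt)] with k hk
      simp [hZ, image_eq_zero_of_notMem_tsupport hk]
  have hprod : ∫ p : (ℝ ∙ v)ᗮ × ℝ, χ' p.2 * Z (p.1, 0) = ∫ y, Z (y, 0) := by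
    have := integral_prod_mul (μ := (volume : Measure (ℝ ∙ v)ᗮ)) (ν := (volume : Measure ℝ))
      (fun y => Z (y, 0)) χ'
    rw [hχ'i, mul_one] at this
    rw [← this, Measure.volume_eq_prod]
    simp only [mul_comm]
  have hid : ∀ k : ℕ, ∫ p, χ ((k + 1 : ℝ) * p.2) * B p =
      ∫ p : (ℝ ∙ v)ᗮ × ℝ, χ' p.2 * Z (p.1, p.2 / (k + 1 : ℝ)) := fun k => by
    have hk : (0 : ℝ) < k + 1 := by positivity
    rw [← integral_scale_snd hk (hint1 k) (hint2 k), ← hχB, ← sub_eq_zero, ← integral_sub]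
    · exact chartCutoff_identity hv hh hU hK hw hψ hψc hψU hχL hχ1 hχ0 hχ' hk
    · rw [hχB]
      exact hBi.mono (hχBm k) (.of_forall fun p => hχBle k p)
    · exact hint1 k
  refine ⟨hZ0i, ?_⟩
  rw [hBint, ← hprod.trans rfl]
  simp only [hid] at hlimB
  rw [tendsto_nhds_unique hlimB hlimZ, hprod]

end ChartLimit

/-! ### Comparison of Hausdorff measures -/

section AreaComparison

open scoped ENNReal NNReal

/-- On A the map f factors through g with Lipschitz constant C. Injectivity of g is not needed:
points with the same image under g also have the same image under f, so any choice of preimages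
works. -/
lemma euclideanHausdorffMeasure_image_le_image {Y Z : Type*} [EMetricSpace Y] [EMetricSpace Z]
    [MeasurableSpace Z] [BorelSpace Z] {f g : Y → Z} {A : Set Y} {C : ℝ≥0} (d : ℕ)
    (hfg : ∀ x ∈ A, ∀ y ∈ A, edist (f x) (f y) ≤ C * edist (g x) (g y)) :
    μHE[d] (f '' A) ≤ (C : ℝ≥0∞) ^ d * μHE[d] (g '' A) := by
  rcases A.eq_empty_or_nonempty with rfl | ⟨a, ha⟩
  · simp
  have : Nonempty Y := ⟨a⟩
  have hinv : ∀ z ∈ g '' A, Function.invFunOn g A z ∈ A ∧ g (Function.invFunOn g A z) = z :=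
    fun z hz => ⟨Function.invFunOn_mem hz, Function.invFunOn_eq hz⟩
  have hL : LipschitzOnWith C (f ∘ Function.invFunOn g A) (g '' A) := fun z hz w hw => by
    have := hfg _ (hinv z hz).1 _ (hinv w hw).1
    rwa [(hinv z hz).2, (hinv w hw).2] at this
  have him : f '' A ⊆ (f ∘ Function.invFunOn g A) '' (g '' A) := by
    rintro _ ⟨x, hx, rfl⟩
    have hz : g x ∈ g '' A := ⟨x, hx, rfl⟩
    refine ⟨g x, hz, ?_⟩
    have := hfg _ (hinv _ hz).1 _ hx
    rw [(hinv _ hz).2, edist_self, mul_zero, nonpos_iff_eq_zero, edist_eq_zero] at this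
    exact this
  have h1 := hL.hausdorffMeasure_image_le (d := d) (Nat.cast_nonneg d)
  rw [ENNReal.rpow_natCast] at h1
  simp only [Measure.euclideanHausdorffMeasure_def, Measure.smul_apply, ENNReal.smul_def,
    smul_eq_mul]
  rw [mul_left_comm]
  gcongr
  exact (measure_mono him).trans h1

/-- Lindelöf: countably many of the neighbourhoods cover V, and the inequality is summed over their
disjointed pieces. -/
lemma measure_le_of_locally {Y : Type*} [TopologicalSpace Y] [SecondCountableTopology Y]
    [MeasurableSpace Y] [OpensMeasurableSpace Y] {μ ν : Measure Y} {V : Set Y}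
    (hloc : ∀ x ∈ V, ∃ N ∈ 𝓝 x, ∀ A ⊆ N ∩ V, MeasurableSet A → μ A ≤ ν A)
    {A : Set Y} (hA : MeasurableSet A) (hAV : A ⊆ V) : μ A ≤ ν A := by
  have : ∀ x ∈ V, ∃ N, IsOpen N ∧ x ∈ N ∧ ∀ A ⊆ N ∩ V, MeasurableSet A → μ A ≤ ν A := by
    intro x hx
    obtain ⟨N, hN, h⟩ := hloc x hx
    exact ⟨interior N, isOpen_interior, mem_interior_iff_mem_nhds.2 hN, fun A hA =>
      h A (hA.trans (Set.inter_subset_inter_left _ interior_subset))⟩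
  choose! N hNo hxN hN using this
  obtain ⟨T, hT, hTc, hTU⟩ := TopologicalSpace.isOpen_biUnion_countable V N
    (fun x hx => hNo x hx)
  rcases T.eq_empty_or_nonempty with rfl | hTne
  · have : V ⊆ ∅ := fun x hx => by
      have : x ∈ ⋃ i ∈ V, N i := Set.mem_biUnion hx (hxN x hx)
      rw [← hTU] at this
      simp at this
    have : A = ∅ := Set.subset_empty_iff.1 (hAV.trans this)
    simp [this]
  obtain ⟨t, ht⟩ := hTc.exists_eq_range hTne
  have htV : ∀ k, t k ∈ V := fun k => hT (ht ▸ Set.mem_range_self k)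
  set S : ℕ → Set Y := fun k => N (t k) with hS
  have hSm : ∀ k, MeasurableSet (A ∩ disjointed S k) := fun k =>
    hA.inter (MeasurableSet.disjointed (fun k => (hNo _ (htV k)).measurableSet) k)
  have hdis : Pairwise (Function.onFun Disjoint fun k => A ∩ disjointed S k) := fun i j hij =>
    ((disjoint_disjointed S) hij).mono Set.inter_subset_right Set.inter_subset_right
  have hAeq : A = ⋃ k, A ∩ disjointed S k := by
    rw [← Set.inter_iUnion, iUnion_disjointed]
    refine (Set.inter_eq_left.2 fun x hx => ?_).symm
    have : x ∈ ⋃ i ∈ V, N i := Set.mem_biUnion (hAV hx) (hxN x (hAV hx))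
    rw [← hTU, ht] at this
    simpa [hS] using this
  rw [hAeq, measure_iUnion hdis hSm, measure_iUnion hdis hSm]
  refine ENNReal.tsum_le_tsum fun k => hN (t k) (htV k) _ (fun x hx => ⟨?_, hAV hx.1⟩) (hSm k)
  exact disjointed_subset S k hx.2

end AreaComparison

/-! ### The Jacobian of a graph -/

section GraphArea

open scoped ENNReal NNReal

variable {n : ℕ} {v : E n} {h : (ℝ ∙ v)ᗮ → ℝ}

/-- The derivative `u ↦ u + ⟪p, u⟫ v` of the parametrization of a graph over `v^⊥`. -/
def graphDeriv (v : E n) (p : (ℝ ∙ v)ᗮ) : (ℝ ∙ v)ᗮ →L[ℝ] E n :=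
  (ℝ ∙ v)ᗮ.subtypeL + (innerSL ℝ p).smulRight v

lemma graphDeriv_apply (p u : (ℝ ∙ v)ᗮ) : graphDeriv v p u = (u : E n) + ⟪p, u⟫ • v := by
  simp [graphDeriv]

lemma norm_coe_add_smul_sq (hv : ‖v‖ = 1) (u : (ℝ ∙ v)ᗮ) (c : ℝ) :
    ‖(u : E n) + c • v‖ ^ 2 = ‖u‖ ^ 2 + c ^ 2 := by
  rw [norm_add_sq_real, inner_smul_right, real_inner_comm, inner_coe_orthogonal, norm_smul, hv]
  simp

lemma norm_le_norm_coe_add_smul (hv : ‖v‖ = 1) (u : (ℝ ∙ v)ᗮ) (c : ℝ) :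
    ‖u‖ ≤ ‖(u : E n) + c • v‖ := by
  refine le_of_sq_le_sq ?_ (norm_nonneg _)
  rw [norm_coe_add_smul_sq hv]
  nlinarith [sq_nonneg c]

/-- The Gram matrix is 1 + p pᵀ, whose determinant is given by the matrix determinant lemma. -/
lemma normDet_graphDeriv (hv : ‖v‖ = 1) (p : (ℝ ∙ v)ᗮ) :
    (graphDeriv v p).toLinearMap.normDet = Real.sqrt (1 + ‖p‖ ^ 2) := by
  have hsq : (graphDeriv v p).toLinearMap.normDet ^ 2 = 1 + ‖p‖ ^ 2 := by
    set b := stdOrthonormalBasis ℝ (ℝ ∙ v)ᗮ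
    have := (graphDeriv v p).toLinearMap.normDet_sq_eq_det_gram b
    rw [RCLike.ofReal_real_eq_id, id] at this
    rw [this]
    have hg : Matrix.gram ℝ (fun i => (graphDeriv v p).toLinearMap (b i)) =
        1 + Matrix.replicateCol Unit (fun i => ⟪p, b i⟫) *
          Matrix.replicateRow Unit (fun i => ⟪p, b i⟫) := by
      ext i j
      have hb : ⟪(b i : E n), (b j : E n)⟫ = (1 : Matrix _ _ ℝ) i j := by
        rw [← Submodule.coe_inner, orthonormal_iff_ite.1 b.orthonormal i j, Matrix.one_apply]
      simp only [Matrix.gram_apply, ContinuousLinearMap.coe_coe, graphDeriv_apply,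
        inner_add_left, inner_add_right, inner_smul_left, inner_smul_right,
        inner_coe_orthogonal, real_inner_comm v, real_inner_self_eq_norm_sq, hv, hb]
      simp only [Matrix.mul_apply, Matrix.add_apply, Matrix.replicateCol_apply,
        Matrix.replicateRow_apply, Finset.univ_unique, Finset.sum_const, Finset.card_singleton,
        one_smul, conj_trivial]
      ring
    rw [hg, Matrix.det_one_add_replicateCol_mul_replicateRow]
    congr 1
    simp only [dotProduct, ← pow_two]
    rw [← b.sum_sq_norm_inner_left p]
    simp
  rw [← hsq, Real.sqrt_sq (LinearMap.normDet_nonneg _)]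

end GraphArea

/-! ### The area formula for C¹ graphs -/

section GraphAreaFormula

open scoped ENNReal NNReal

variable {n : ℕ} {v : E n} {h : (ℝ ∙ v)ᗮ → ℝ}

lemma finrank_orthogonal_unit (hv : ‖v‖ = 1) : Module.finrank ℝ (ℝ ∙ v)ᗮ = n - 1 := by
  have h1 := Submodule.finrank_add_finrank_orthogonal (ℝ ∙ v)
  rw [finrank_span_singleton (by rintro rfl; simp at hv), finrank_euclideanSpace_fin] at h1
  omega

/-- The area density `√(1 + |∇h|²)` of the graph of `h`. -/
def graphDensity (v : E n) (h : (ℝ ∙ v)ᗮ → ℝ) (y : (ℝ ∙ v)ᗮ) : ℝ :=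
  Real.sqrt (1 + ‖gradient h y‖ ^ 2)

lemma graphDensity_pos (y : (ℝ ∙ v)ᗮ) : 0 < graphDensity v h y := by
  unfold graphDensity; positivity

lemma measurable_graphDensity : Measurable (graphDensity v h) := by
  have h1 : Measurable (gradient h) :=
    (InnerProductSpace.toDual ℝ _).symm.continuous.measurable.comp (measurable_fderiv ℝ h)
  exact ((h1.norm.pow_const 2).const_add 1).sqrt

lemma continuousAt_graphDensity {y : (ℝ ∙ v)ᗮ} (hy : ContDiffAt ℝ 1 h y) :
    ContinuousAt (graphDensity v h) y := by
  have h1 : ContinuousAt (gradient h) y :=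
    (InnerProductSpace.toDual ℝ _).symm.continuous.continuousAt.comp
      (hy.fderiv_right (m := 0) (by simp)).continuousAt
  unfold graphDensity
  fun_prop

lemma hasStrictFDerivAt_chartPt {y : (ℝ ∙ v)ᗮ} (hy : ContDiffAt ℝ 1 h y) :
    HasStrictFDerivAt (fun y => chartPt v h y 0) (graphDeriv v (gradient h y)) y := by
  have h1 : HasStrictFDerivAt h (innerSL ℝ (gradient h y)) y := by
    have h2 : innerSL ℝ (gradient h y) = fderiv ℝ h y := by
      ext u
      rw [gradient, innerSL_apply_apply, InnerProductSpace.toDual_symm_apply]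
    rw [h2]
    exact hy.hasStrictFDerivAt (by simp)
  simp only [chartPt, add_zero]
  exact (ℝ ∙ v)ᗮ.subtypeL.hasStrictFDerivAt.add (h1.smul_const v)

/-- Near y₀ the parametrization distorts distances by a factor at most κ relative to its
linearization, which costs κ^(n-1) in area; the density varies by at most one more factor κ. -/
lemma exists_nhds_area_comparison (hv : ‖v‖ = 1) {y₀ : (ℝ ∙ v)ᗮ} (hy : ContDiffAt ℝ 1 h y₀)
    {κ : ℝ≥0} (hκ : 1 < κ) : ∃ N ∈ 𝓝 y₀, ∀ A ⊆ N, MeasurableSet A →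
      area ((fun y => chartPt v h y 0) '' A) ≤
        (κ : ℝ≥0∞) ^ n * ∫⁻ y in A, ENNReal.ofReal (graphDensity v h y) ∧
      ∫⁻ y in A, ENNReal.ofReal (graphDensity v h y) ≤
        (κ : ℝ≥0∞) ^ n * area ((fun y => chartPt v h y 0) '' A) := by
  have hn : n = (n - 1) + 1 := by
    rcases n with _ | n
    · exact absurd hv (by simp [Subsingleton.elim v 0])
    · rfl
  set L := graphDeriv v (gradient h y₀) with hL
  -- With c = κ - 1 the additive error c |x - y| becomes the factor κ, since both the linearization
  -- and the parametrization do not decrease distances.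
  obtain ⟨N, hN, hNL⟩ := (hasStrictFDerivAt_chartPt hy).approximates_deriv_on_nhds
    (c := κ - 1) (Or.inr (tsub_pos_of_lt hκ))
  have hσ := graphDensity_pos (h := h) y₀
  have hκ' : (1 : ℝ) < κ := by exact_mod_cast hκ
  have hc := continuousAt_graphDensity hy
  have hN1 : ∀ᶠ y in 𝓝 y₀, graphDensity v h y < κ * graphDensity v h y₀ :=
    hc.eventually_lt continuousAt_const (by nlinarith)
  have hN2 : ∀ᶠ y in 𝓝 y₀, graphDensity v h y₀ < κ * graphDensity v h y :=
    continuousAt_const.eventually_lt (continuousAt_const.mul hc) (by nlinarith)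
  refine ⟨N ∩ {y | graphDensity v h y < κ * graphDensity v h y₀ ∧
    graphDensity v h y₀ < κ * graphDensity v h y}, inter_mem hN (hN1.and hN2),
    fun A hA hAm => ?_⟩
  have hκc : ((κ - 1 : ℝ≥0) : ℝ) = κ - 1 := NNReal.coe_sub hκ.le
  have hexp : ∀ x ∈ A, ∀ y ∈ A,
      ‖x - y‖ ≤ ‖L (x - y)‖ ∧ ‖x - y‖ ≤ ‖chartPt v h x 0 - chartPt v h y 0‖ := by
    intro x _ y _
    constructor
    · rw [hL, graphDeriv_apply]
      exact norm_le_norm_coe_add_smul hv _ _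
    · have : chartPt v h x 0 - chartPt v h y 0 = ((x - y : (ℝ ∙ v)ᗮ) : E n) + (h x - h y) • v := by
        simp only [chartPt, add_zero, sub_smul, Submodule.coe_sub]; abel
      rw [this]
      exact norm_le_norm_coe_add_smul hv _ _
  have hd1 : ∀ x ∈ A, ∀ y ∈ A, edist (chartPt v h x 0) (chartPt v h y 0) ≤
      κ * edist (L x) (L y) := by
    intro x hx y hy
    rw [edist_nndist, edist_nndist, ← ENNReal.coe_mul, ENNReal.coe_le_coe, ← NNReal.coe_le_coe,
      NNReal.coe_mul, coe_nndist, coe_nndist, dist_eq_norm, dist_eq_norm, ← map_sub]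
    have h1 := hNL _ (hA hx).1 _ (hA hy).1
    have h2 := norm_sub_norm_le (chartPt v h x 0 - chartPt v h y 0) (L (x - y))
    have h3 := (hexp x hx y hy).1
    rw [hκc] at h1
    nlinarith
  have hd2 : ∀ x ∈ A, ∀ y ∈ A, edist (L x) (L y) ≤
      κ * edist (chartPt v h x 0) (chartPt v h y 0) := by
    intro x hx y hy
    rw [edist_nndist, edist_nndist, ← ENNReal.coe_mul, ENNReal.coe_le_coe, ← NNReal.coe_le_coe,
      NNReal.coe_mul, coe_nndist, coe_nndist, dist_eq_norm, dist_eq_norm, ← map_sub]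
    have h1 := hNL _ (hA hx).1 _ (hA hy).1
    have h2 := norm_sub_norm_le (L (x - y)) (chartPt v h x 0 - chartPt v h y 0)
    have h3 := (hexp x hx y hy).2
    rw [norm_sub_rev (L (x - y))] at h2
    rw [hκc] at h1
    nlinarith
  have hLA : area (L '' A) = ENNReal.ofReal (graphDensity v h y₀) * volume A := by
    have := L.toLinearMap.euclideanHausdorffMeasure_image_eq_normDet_mul_volume A
    rw [finrank_orthogonal_unit hv, normDet_graphDeriv hv] at this
    exact this
  have e1 := euclideanHausdorffMeasure_image_le_image (n - 1) hd1
  have e2 := euclideanHausdorffMeasure_image_le_image (n - 1) hd2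
  have hofκ : (κ : ℝ≥0∞) = ENNReal.ofReal κ := by simp
  have i1 : ENNReal.ofReal (graphDensity v h y₀) * volume A ≤
      κ * ∫⁻ y in A, ENNReal.ofReal (graphDensity v h y) := by
    rw [← setLIntegral_const, ← lintegral_const_mul _ measurable_graphDensity.ennreal_ofReal]
    refine setLIntegral_mono' hAm fun y hy => ?_
    rw [hofκ, ← ENNReal.ofReal_mul κ.coe_nonneg]
    exact ENNReal.ofReal_le_ofReal (hA hy).2.2.le
  have i2 : ∫⁻ y in A, ENNReal.ofReal (graphDensity v h y) ≤
      κ * (ENNReal.ofReal (graphDensity v h y₀) * volume A) := by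
    rw [← mul_assoc, ← setLIntegral_const]
    refine setLIntegral_mono' hAm fun y hy => ?_
    rw [hofκ, ← ENNReal.ofReal_mul κ.coe_nonneg]
    exact ENNReal.ofReal_le_ofReal (hA hy).2.1.le
  have hpow : (κ : ℝ≥0∞) ^ n = κ ^ (n - 1) * κ := by rw [← pow_succ, ← hn]
  constructor
  · refine e1.trans ?_
    rw [hpow, mul_assoc]
    gcongr
    exact hLA.le.trans i1
  · refine i2.trans ?_
    rw [← hLA, hpow, mul_comm (_ ^ _), mul_assoc]
    gcongr
    exact e2

lemma measurableEmbedding_graph (hv : ‖v‖ = 1) (hh : Continuous h) :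
    MeasurableEmbedding fun y => chartPt v h y 0 :=
  (measurableEmbedding_chartPt hv hh).comp
    (measurableEmbedding_prod_mk_right (0 : ℝ))

/-- The local comparison extends to all measurable subsets of V with the same constant κ^n, and then
κ → 1. -/
lemma comap_area_restrict (hv : ‖v‖ = 1) (hh : Continuous h) {V : Set (ℝ ∙ v)ᗮ} (hV : IsOpen V)
    (hC : ∀ y ∈ V, ContDiffAt ℝ 1 h y) :
    (area.comap fun y => chartPt v h y 0).restrict V =
      (volume.restrict V).withDensity fun y => ENNReal.ofReal (graphDensity v h y) := by
  have hemb := measurableEmbedding_graph hv hh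
  set μ := area.comap fun y => chartPt v h y 0 with hμ
  set ν := (volume : Measure (ℝ ∙ v)ᗮ).withDensity fun y => ENNReal.ofReal (graphDensity v h y)
    with hν
  have key : ∀ κ : ℝ≥0, 1 < κ → ∀ A ⊆ V, MeasurableSet A →
      μ A ≤ (κ : ℝ≥0∞) ^ n * ν A ∧ ν A ≤ (κ : ℝ≥0∞) ^ n * μ A := by
    intro κ hκ A hA hAm
    have hl : ∀ x ∈ V, ∃ N ∈ 𝓝 x, ∀ A ⊆ N ∩ V, MeasurableSet A →
        μ A ≤ ((κ : ℝ≥0∞) ^ n • ν) A ∧ ν A ≤ ((κ : ℝ≥0∞) ^ n • μ) A := by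
      intro x hx
      obtain ⟨N, hN, hNA⟩ := exists_nhds_area_comparison hv (hC x hx) hκ
      refine ⟨N, hN, fun A hA hAm => ?_⟩
      have := hNA A (hA.trans Set.inter_subset_left) hAm
      rwa [← hemb.comap_apply, ← withDensity_apply _ hAm] at this
    constructor
    · refine measure_le_of_locally (V := V) (ν := (κ : ℝ≥0∞) ^ n • ν) (fun x hx => ?_) hAm hA
      obtain ⟨N, hN, hNA⟩ := hl x hx
      exact ⟨N, hN, fun A h1 h2 => (hNA A h1 h2).1⟩
    · refine measure_le_of_locally (V := V) (ν := (κ : ℝ≥0∞) ^ n • μ) (fun x hx => ?_) hAm hA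
      obtain ⟨N, hN, hNA⟩ := hl x hx
      exact ⟨N, hN, fun A h1 h2 => (hNA A h1 h2).2⟩
  have hle : ∀ a b : ℝ≥0∞, (∀ κ : ℝ≥0, 1 < κ → a ≤ (κ : ℝ≥0∞) ^ n * b) → a ≤ b := by
    intro a b hab
    have ht : Tendsto (fun k : ℕ => ((1 + 1 / ((k : ℝ≥0) + 1) : ℝ≥0) : ℝ≥0∞) ^ n * b) atTop
        (𝓝 (((1 : ℝ≥0) : ℝ≥0∞) ^ n * b)) := by
      refine ENNReal.Tendsto.mul_const ?_ (Or.inl (by simp))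
      refine ((ENNReal.continuous_pow n).tendsto _).comp (ENNReal.tendsto_coe.2 ?_)
      have := (tendsto_one_div_add_atTop_nhds_zero_nat (𝕜 := ℝ≥0)).const_add 1
      simpa using this
    rw [ENNReal.coe_one, one_pow, one_mul] at ht
    exact ge_of_tendsto' ht fun k => hab _ (lt_add_of_pos_right _ (by positivity))
  rw [← restrict_withDensity hV.measurableSet]
  ext A hA
  rw [Measure.restrict_apply hA, Measure.restrict_apply hA]
  have hm := hA.inter hV.measurableSet
  exact le_antisymm (hle _ _ fun κ hκ => (key κ hκ _ Set.inter_subset_right hm).1)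
    (hle _ _ fun κ hκ => (key κ hκ _ Set.inter_subset_right hm).2)

lemma area_restrict_graph (hv : ‖v‖ = 1) (hh : Continuous h) {V : Set (ℝ ∙ v)ᗮ} (hV : IsOpen V)
    (hC : ∀ y ∈ V, ContDiffAt ℝ 1 h y) :
    area.restrict ((fun y => chartPt v h y 0) '' V) =
      ((volume.restrict V).withDensity fun y => ENNReal.ofReal (graphDensity v h y)).map
        fun y => chartPt v h y 0 := by
  have hemb := measurableEmbedding_graph hv hh
  rw [← comap_area_restrict hv hh hV hC]
  have := hemb.restrict_map (area.comap fun y => chartPt v h y 0)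
    ((fun y => chartPt v h y 0) '' V)
  rw [Set.preimage_image_eq _ hemb.injective] at this
  rw [← this, hemb.map_comap, Measure.restrict_restrict_of_subset (Set.image_subset_range _ _)]

lemma integrableOn_graph_iff (hv : ‖v‖ = 1) (hh : Continuous h) {V : Set (ℝ ∙ v)ᗮ} (hV : IsOpen V)
    (hC : ∀ y ∈ V, ContDiffAt ℝ 1 h y) (F : E n → ℝ) :
    IntegrableOn F ((fun y => chartPt v h y 0) '' V) area ↔
      IntegrableOn (fun y => graphDensity v h y * F (chartPt v h y 0)) V := by
  rw [IntegrableOn, area_restrict_graph hv hh hV hC,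
    (measurableEmbedding_graph hv hh).integrable_map_iff,
    integrable_withDensity_iff_integrable_smul' measurable_graphDensity.ennreal_ofReal
      (.of_forall fun _ => ENNReal.ofReal_lt_top), IntegrableOn]
  simp only [ENNReal.toReal_ofReal (graphDensity_pos _).le, smul_eq_mul, Function.comp_apply]

lemma setIntegral_graph (hv : ‖v‖ = 1) (hh : Continuous h) {V : Set (ℝ ∙ v)ᗮ} (hV : IsOpen V)
    (hC : ∀ y ∈ V, ContDiffAt ℝ 1 h y) (F : E n → ℝ) :
    ∫ x in (fun y => chartPt v h y 0) '' V, F x ∂area =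
      ∫ y in V, graphDensity v h y * F (chartPt v h y 0) := by
  rw [area_restrict_graph hv hh hV hC, (measurableEmbedding_graph hv hh).integral_map,
    integral_withDensity_eq_integral_toReal_smul measurable_graphDensity.ennreal_ofReal
      (.of_forall fun _ => ENNReal.ofReal_lt_top)]
  simp only [ENNReal.toReal_ofReal (graphDensity_pos _).le, smul_eq_mul]

end GraphAreaFormula

/-! ### The divergence theorem on compact Lipschitz sets -/

section GlobalDivergence

variable {n : ℕ} {K : Set (E n)} {X : E n → E n} {s Fl : E n → ℝ} {x₀ : E n}

/-- Near `x₀` the set `K` is the region above a Lipschitz graph; on the graph, either the field `X`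
and the density `Fl` vanish, or the graph is of class `C¹` and `Fl` is the outward flux of `X`. -/
def HasFluxChartAt (K : Set (E n)) (X : E n → E n) (Fl : E n → ℝ) (x₀ : E n) : Prop :=
  ∃ v : E n, ‖v‖ = 1 ∧ ∃ (C : NNReal) (h : (ℝ ∙ v)ᗮ → ℝ), LipschitzWith C h ∧
    ∀ᶠ x in 𝓝 x₀, (x ∈ K ↔ 0 ≤ height v h x) ∧ (x ∈ frontier K → (X x = 0 ∧ Fl x = 0) ∨
      (ContDiffAt ℝ 1 h ((ℝ ∙ v)ᗮ.orthogonalProjectionOnto x) ∧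
        graphDensity v h ((ℝ ∙ v)ᗮ.orthogonalProjectionOnto x) * Fl x =
          ⟪conormal v h ((ℝ ∙ v)ᗮ.orthogonalProjectionOnto x), X x⟫))

lemma mem_frontier_iff_height_eq_zero {v : E n} {h : (ℝ ∙ v)ᗮ → ℝ} {U : Set (E n)}
    (hv : ‖v‖ = 1) (hh : Continuous h) (hU : IsOpen U) (hKc : IsClosed K)
    (hK : ∀ x ∈ U, x ∈ K ↔ 0 ≤ height v h x) {x : E n} (hx : x ∈ U) :
    x ∈ frontier K ↔ height v h x = 0 := by
  rw [hKc.frontier_eq, Set.mem_sdiff, hK x hx]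
  have hc := continuous_height (v := v) hh
  constructor
  · rintro ⟨h0, hi⟩
    by_contra hne
    apply hi
    rw [mem_interior_iff_mem_nhds]
    filter_upwards [hU.mem_nhds hx, hc.continuousAt.eventually_const_lt
      (lt_of_le_of_ne h0 (Ne.symm hne))] with y hy hy0
    exact (hK y hy).2 hy0.le
  · refine fun h0 => ⟨h0.ge, fun hi => ?_⟩
    rw [mem_interior_iff_mem_nhds] at hi
    have ht : Tendsto (fun t : ℝ => chartPt v h ((ℝ ∙ v)ᗮ.orthogonalProjectionOnto x) t) (𝓝[<] 0)
        (𝓝 x) := by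
      have h1 : Continuous fun t : ℝ => chartPt v h ((ℝ ∙ v)ᗮ.orthogonalProjectionOnto x) t :=
        (continuous_chartPt hh).comp (Continuous.prodMk_right _)
      have h2 := h1.tendsto 0
      rw [← h0, chartPt_proj_height hv] at h2
      rw [← h0]
      exact h2.mono_left nhdsWithin_le_nhds
    obtain ⟨t, ⟨h1, h2⟩, h3⟩ := ((ht.eventually (inter_mem hi (hU.mem_nhds hx))).and
      self_mem_nhdsWithin).exists
    rw [hK _ h2, height_chartPt hv] at h1
    exact absurd h1 (not_le.2 h3)

/-- The flux over the hyperplane is converted to surface area on the set of points over which h is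
C¹. Elsewhere in the chart both X and `Fl` vanish on the boundary, so neither integral sees those
points. -/
lemma HasFluxChartAt.exists_nhds (hc : HasFluxChartAt K X Fl x₀) (hKc : IsClosed K)
    (hw : IsWeakDivergence K X s) (hX : ContinuousOn X K) (hXm : Measurable X)
    (hs : ContinuousOn s K) (hsm : Measurable s) :
    ∃ U, IsOpen U ∧ x₀ ∈ U ∧ ∀ ψ : E n → ℝ, ContDiff ℝ 1 ψ → HasCompactSupport ψ →
      tsupport ψ ⊆ U → IntegrableOn (fun x => ψ x * Fl x) (frontier K) area ∧
        ∫ x in K, (ψ x * s x + fderiv ℝ ψ x (X x)) = ∫ x in frontier K, ψ x * Fl x ∂area := by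
  obtain ⟨v, hv, C, h, hh, hev⟩ := hc
  obtain ⟨U, hU, hUo, hxU⟩ := eventually_nhds_iff.1 hev
  refine ⟨U, hUo, hxU, fun ψ hψ hψc hψU => ?_⟩
  have hKU : ∀ x ∈ U, x ∈ K ↔ 0 ≤ height v h x := fun x hx => (hU x hx).1
  have hfr : ∀ x ∈ U, x ∈ frontier K ↔ height v h x = 0 := fun x hx =>
    mem_frontier_iff_height_eq_zero hv hh.continuous hUo hKc hKU hx
  obtain ⟨hi, he⟩ := chart_divergence hv hh hUo hKc hKU hw hX hXm hs hsm hψ hψc hψU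
  have hΓc : Continuous fun y => chartPt v h y 0 :=
    (continuous_chartPt hh.continuous).comp (Continuous.prodMk_left 0)
  -- Being C¹ at a point is an open condition, so the area formula applies on an open set.
  set V : Set (ℝ ∙ v)ᗮ := {y | chartPt v h y 0 ∈ U ∧ ContDiffAt ℝ 1 h y} with hV
  have hVo : IsOpen V := by
    rw [isOpen_iff_mem_nhds]
    rintro y ⟨hy, hyC⟩
    exact (hΓc.continuousAt.eventually (hUo.mem_nhds hy)).and (hyC.eventually (by simp))
  have hVC : ∀ y ∈ V, ContDiffAt ℝ 1 h y := fun y hy => hy.2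
  have hΓfr : ∀ y, chartPt v h y 0 ∈ U → chartPt v h y 0 ∈ frontier K := fun y hy => by
    rw [hfr _ hy, height_chartPt hv]
  have hVfr : (fun y => chartPt v h y 0) '' V ⊆ frontier K := by
    rintro _ ⟨y, hy, rfl⟩
    exact hΓfr y hy.1
  have hoff : ∀ x ∈ frontier K \ (fun y => chartPt v h y 0) '' V, ψ x * Fl x = 0 := by
    rintro x ⟨hx, hxV⟩
    by_cases hxt : x ∈ tsupport ψ
    · have hxU := hψU hxt
      rcases (hU x hxU).2 hx with h0 | h0
      · rw [h0.2, mul_zero]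
      · have hx' : chartPt v h ((ℝ ∙ v)ᗮ.orthogonalProjectionOnto x) 0 = x := by
          conv_rhs => rw [← chartPt_proj_height (h := h) hv x, (hfr x hxU).1 hx]
        exact absurd ⟨_, ⟨by rwa [hx'], h0.1⟩, hx'⟩ hxV
    · rw [image_eq_zero_of_notMem_tsupport hxt, zero_mul]
  have hon : ∀ y ∈ V, graphDensity v h y * (ψ (chartPt v h y 0) * Fl (chartPt v h y 0)) =
      ψ (chartPt v h y 0) * ⟪conormal v h y, X (chartPt v h y 0)⟫ := by
    rintro y ⟨hy, hyC⟩
    rcases (hU _ hy).2 (hΓfr y hy) with h0 | h0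
    · rw [h0.1, h0.2]; simp
    · have := h0.2
      rw [proj_chartPt] at this
      rw [← this]; ring
  have hout : ∀ y ∉ V, ψ (chartPt v h y 0) * ⟪conormal v h y, X (chartPt v h y 0)⟫ = 0 := by
    intro y hy
    by_cases hyt : chartPt v h y 0 ∈ tsupport ψ
    · have hyU := hψU hyt
      rcases (hU _ hyU).2 (hΓfr y hyU) with h0 | h0
      · rw [h0.1]; simp
      · have := h0.1
        rw [proj_chartPt] at this
        exact absurd ⟨hyU, this⟩ hy
    · rw [image_eq_zero_of_notMem_tsupport hyt, zero_mul]
  have hfm : MeasurableSet (frontier K) := isClosed_frontier.measurableSet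
  constructor
  · refine IntegrableOn.of_forall_sdiff_eq_zero ?_ hfm hoff
    rw [integrableOn_graph_iff hv hh.continuous hVo hVC]
    exact hi.integrableOn.congr_fun (fun y hy => (hon y hy).symm) hVo.measurableSet
  · rw [he, setIntegral_eq_of_subset_of_forall_sdiff_eq_zero hfm hVfr hoff,
      setIntegral_graph hv hh.continuous hVo hVC, setIntegral_congr_fun hVo.measurableSet hon]
    exact (setIntegral_eq_integral_of_forall_compl_eq_zero fun y hy => hout y hy).symm

lemma exists_finite_smooth_partition (hK : IsCompact K) {U : E n → Set (E n)}
    (hU : ∀ x ∈ K, IsOpen (U x) ∧ x ∈ U x) :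
    ∃ (t : Finset (E n)) (ψ : E n → E n → ℝ), (∀ i ∈ t, i ∈ K) ∧
      (∀ i ∈ t, ContDiff ℝ 1 (ψ i) ∧ HasCompactSupport (ψ i) ∧ tsupport (ψ i) ⊆ U i) ∧
      ∀ x ∈ K, ∑ i ∈ t, ψ i x = 1 ∧ ∑ i ∈ t, fderiv ℝ (ψ i) x = 0 := by
  classical
  obtain ⟨t, htK, ht⟩ := hK.elim_nhds_subcover (fun x => U x ∩ Metric.ball x 1) fun x hx =>
    inter_mem ((hU x hx).1.mem_nhds (hU x hx).2) (Metric.ball_mem_nhds x one_pos)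
  -- The extra member Kᶜ completes the cover to all of space. Its function vanishes near K, so the
  -- others sum to one there and their derivatives sum to zero on K.
  set W : Option t → Set (E n) := fun o => o.elim Kᶜ fun i => U i ∩ Metric.ball (i : E n) 1
  obtain ⟨ρ, hρ⟩ := SmoothPartitionOfUnity.exists_isSubordinate (modelWithCornersSelf ℝ (E n))
    (isClosed_univ (X := E n)) W
    (by
      rintro (_ | i)
      · exact hK.isClosed.isOpen_compl
      · exact (hU i (htK i i.2)).1.inter Metric.isOpen_ball)
    (by
      intro x _
      by_cases hx : x ∈ K
      · obtain ⟨i, hi, hxi⟩ := Set.mem_iUnion₂.1 (ht hx)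
        exact Set.mem_iUnion.2 ⟨some ⟨i, hi⟩, hxi⟩
      · exact Set.mem_iUnion.2 ⟨none, hx⟩)
  have hC : ∀ o, ContDiff ℝ 1 (ρ o) := fun o => (ρ o).contMDiff.contDiff.of_le (by simp)
  have hsum : ∀ x, ∑ i : t, ρ (some i) x = 1 - ρ none x := fun x => by
    have := ρ.sum_eq_one (Set.mem_univ x)
    rw [finsum_eq_sum_of_fintype, Fintype.sum_option] at this
    linarith
  refine ⟨t, fun i => if hi : i ∈ t then ρ (some ⟨i, hi⟩) else 0, htK, fun i hi => ?_,
    fun x hx => ?_⟩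
  · simp only [hi, dif_pos]
    have hs : tsupport (ρ (some ⟨i, hi⟩)) ⊆ U i ∩ Metric.ball i 1 := hρ (some ⟨i, hi⟩)
    refine ⟨hC _, ?_, hs.trans Set.inter_subset_left⟩
    exact (isCompact_closedBall i 1).of_isClosed_subset (isClosed_tsupport _)
      (hs.trans (Set.inter_subset_right.trans Metric.ball_subset_closedBall))
  · have hxn : x ∉ tsupport (ρ none) := fun h => hρ none h hx
    rw [← Finset.sum_coe_sort t, ← Finset.sum_coe_sort t]
    simp only [Finset.coe_mem, dif_pos, Subtype.coe_eta]
    refine ⟨by rw [hsum, image_eq_zero_of_notMem_tsupport hxn, sub_zero], ?_⟩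
    rw [← fderiv_fun_sum fun i _ => (hC _).differentiable (by simp) x]
    simp only [hsum]
    rw [fderiv_const_sub, (notMem_tsupport_iff_eventuallyEq.1 hxn).fderiv_eq]
    simp

lemma measurable_indicator_of_continuousOn {Y F : Type*} [TopologicalSpace Y] [MeasurableSpace Y]
    [OpensMeasurableSpace Y] [TopologicalSpace F] [MeasurableSpace F] [BorelSpace F] [Zero F]
    {g : Y → F} {A : Set Y} (hA : MeasurableSet A) (hg : ContinuousOn g A) :
    Measurable (A.indicator g) := by
  classical
  rw [← Set.piecewise_eq_indicator]
  exact hg.measurable_piecewise continuousOn_const hA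

/-- The divergence theorem on a compact set whose boundary is Lipschitz, and of class `C¹` near the
points of the boundary at which the field does not vanish. -/
theorem divergence_theorem (hK : IsCompact K) (hw : IsWeakDivergence K X s)
    (hX : ContinuousOn X K) (hs : ContinuousOn s K)
    (hc : ∀ x ∈ frontier K, HasFluxChartAt K X Fl x) :
    IntegrableOn Fl (frontier K) area ∧ ∫ x in K, s x = ∫ x in frontier K, Fl x ∂area := by
  have hKm := hK.isClosed.measurableSet
  -- Every hypothesis concerns only values on K, so X and s may be replaced by their extensions by
  -- zero, which are Borel.
  wlog hm : Measurable X ∧ Measurable s generalizing X s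
  · have hfK : ∀ x ∈ frontier K, x ∈ K := fun x hx => hK.isClosed.frontier_subset hx
    have := this (X := K.indicator X) (s := K.indicator s) ?_
      (hX.congr fun x hx => Set.indicator_of_mem hx _)
      (hs.congr fun x hx => Set.indicator_of_mem hx _) ?_
      ⟨measurable_indicator_of_continuousOn hKm hX, measurable_indicator_of_continuousOn hKm hs⟩
    · rwa [setIntegral_congr_fun hKm fun x hx => Set.indicator_of_mem hx _] at this
    · intro φ C hφ hφc hφK
      rw [← hw φ C hφ hφc hφK]
      refine integral_congr_ae (.of_forall fun x => ?_)
      by_cases hx : x ∈ K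
      · simp only [Set.indicator_of_mem hx]
      · have hxt : x ∉ tsupport φ := fun h => hx (interior_subset (hφK h))
        simp only [image_eq_zero_of_notMem_tsupport hxt,
          (notMem_tsupport_iff_eventuallyEq.1 hxt).fderiv_eq, zero_mul, Pi.zero_def]
        simp
    · intro x hx
      obtain ⟨v, hv, C, h, hh, hev⟩ := hc x hx
      refine ⟨v, hv, C, h, hh, hev.mono fun y hy => ⟨hy.1, fun hyf => ?_⟩⟩
      rw [Set.indicator_of_mem (hfK y hyf)]
      exact hy.2 hyf
  obtain ⟨hXm, hsm⟩ := hm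
  have hloc : ∀ x ∈ K, ∃ U, IsOpen U ∧ x ∈ U ∧ ∀ ψ : E n → ℝ, ContDiff ℝ 1 ψ →
      HasCompactSupport ψ → tsupport ψ ⊆ U →
      IntegrableOn (fun x => ψ x * Fl x) (frontier K) area ∧
        ∫ x in K, (ψ x * s x + fderiv ℝ ψ x (X x)) = ∫ x in frontier K, ψ x * Fl x ∂area := by
    intro x hx
    by_cases hxf : x ∈ frontier K
    · exact (hc x hxf).exists_nhds hK.isClosed hw hX hXm hs hsm
    · have hxi : x ∈ interior K := by
        by_contra h
        exact hxf (hK.isClosed.frontier_eq ▸ ⟨hx, h⟩)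
      refine ⟨interior K, isOpen_interior, hxi, fun ψ hψ hψc hψU => ?_⟩
      have h0 : ∀ y ∈ frontier K, ψ y * Fl y = 0 := fun y hy => by
        rw [image_eq_zero_of_notMem_tsupport fun h => hy.2 (hψU h), zero_mul]
      obtain ⟨C, hC⟩ := hψ.lipschitzWith_of_hasCompactSupport hψc (by simp)
      constructor
      · exact integrableOn_zero.congr_fun (fun y hy => (h0 y hy).symm)
          isClosed_frontier.measurableSet
      · rw [setIntegral_congr_fun isClosed_frontier.measurableSet h0, integral_zero,
          ← hw ψ C hC hψc hψU]
        refine setIntegral_eq_integral_of_forall_compl_eq_zero fun y hy => ?_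
        have hyt : y ∉ tsupport ψ := fun h => hy (interior_subset (hψU h))
        simp [image_eq_zero_of_notMem_tsupport hyt,
          (notMem_tsupport_iff_eventuallyEq.1 hyt).fderiv_eq]
  choose! U hUo hxU hU using hloc
  obtain ⟨t, ψ, htK, hψ, hsum⟩ := exists_finite_smooth_partition hK
    fun x hx => ⟨hUo x hx, hxU x hx⟩
  have hUt : ∀ i ∈ t, _ := fun i hi => hU i (htK i hi) (ψ i) (hψ i hi).1 (hψ i hi).2.1
    (hψ i hi).2.2
  have hFl : ∀ x ∈ frontier K, ∑ i ∈ t, ψ i x * Fl x = Fl x := fun x hx => by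
    rw [← Finset.sum_mul, (hsum x (hK.isClosed.frontier_subset hx)).1, one_mul]
  have hS : ∀ x ∈ K, ∑ i ∈ t, (ψ i x * s x + fderiv ℝ (ψ i) x (X x)) = s x := fun x hx => by
    rw [Finset.sum_add_distrib, ← Finset.sum_mul, (hsum x hx).1, ← sum_apply,
      (hsum x hx).2]
    simp
  have hfm : MeasurableSet (frontier K) := isClosed_frontier.measurableSet
  refine ⟨(integrable_finsetSum t fun i hi => (hUt i hi).1).congr ?_, ?_⟩
  · exact (ae_restrict_iff' hfm).2 (.of_forall hFl)
  · rw [← setIntegral_congr_fun hfm hFl, ← setIntegral_congr_fun hKm hS,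
      integral_finsetSum t fun i hi => (hUt i hi).1, integral_finsetSum]
    · exact Finset.sum_congr rfl fun i hi => (hUt i hi).2
    · exact fun i hi => integrableOn_divergence_mul hK.isClosed hX hs (hψ i hi).1 (hψ i hi).2.1

end GlobalDivergence

/-! ### The normal flux when all gradients are parallel -/

section RankOne

variable {n m : ℕ} {U : Matrix (Fin m) (Fin n) ℝ} {N : Fin n → ℝ} {l : Fin m → ℝ}

lemma metricJ_of_rankOne (hU : ∀ α, U α = l α • N) :
    metricJ U = 1 + (∑ α, l α ^ 2) • Matrix.vecMulVec N N := by
  ext i j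
  rw [metricJ_apply, Matrix.add_apply, Matrix.smul_apply, Matrix.vecMulVec_apply, smul_eq_mul,
    Finset.sum_mul]
  congr 1
  refine Finset.sum_congr rfl fun β _ => ?_
  rw [hU]
  simp only [Pi.smul_apply, smul_eq_mul]
  ring

/-- The metric is a rank one perturbation of the identity, inverted by the Sherman–Morrison formula.
-/
lemma invJ_of_rankOne (hN : N ⬝ᵥ N = 1) (hU : ∀ α, U α = l α • N) :
    invJ U = 1 - ((∑ α, l α ^ 2) / (1 + ∑ α, l α ^ 2)) • Matrix.vecMulVec N N := by
  set L := ∑ α, l α ^ 2 with hL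
  have hL0 : 0 ≤ L := Finset.sum_nonneg fun _ _ => sq_nonneg _
  have hL1 : 1 + L ≠ 0 := by positivity
  rw [invJ, metricJ_of_rankOne hU]
  refine Matrix.inv_eq_right_inv ?_
  have hNN : Matrix.vecMulVec N N * Matrix.vecMulVec N N = Matrix.vecMulVec N N := by
    rw [Matrix.vecMulVec_mul_vecMulVec, hN, one_smul]
  rw [mul_sub, mul_one, add_mul, one_mul, smul_mul_smul_comm, hNN, ← hL, add_sub_assoc,
    ← add_smul, ← sub_smul]
  have : L - (L / (1 + L) + L * (L / (1 + L))) = 0 := by field_simp; ring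
  rw [this, zero_smul, add_zero]

/-- With L = ∑ l_α², N is an eigenvector of the inverse metric with eigenvalue 1/(1+L). In the trace
term N · H N carries the factor -L/(1+L), and the second term adds -1/(1+L): together exactly the
purely normal part of the Euclidean trace is removed. -/
lemma dotProduct_fluxJ_of_rankOne (hN : N ⬝ᵥ N = 1) (hU : ∀ α, U α = l α • N)
    (H : Fin m → Matrix (Fin n) (Fin n) ℝ) :
    N ⬝ᵥ fluxJ U H =
      (∑ α, l α * ((H α).trace - N ⬝ᵥ (H α *ᵥ N))) / (1 + ∑ α, l α ^ 2) := by
  set L := ∑ α, l α ^ 2 with hL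
  have hL0 : 0 ≤ L := Finset.sum_nonneg fun _ _ => sq_nonneg _
  have hL1 : 1 + L ≠ 0 := by positivity
  have ha := invJ_of_rankOne hN hU
  rw [← hL] at ha
  have haN : invJ U *ᵥ N = (1 / (1 + L)) • N := by
    rw [ha, Matrix.sub_mulVec, Matrix.one_mulVec, Matrix.smul_mulVec,
      Matrix.vecMulVec_mulVec, hN]
    simp only [MulOpposite.op_one, one_smul]
    nth_rewrite 1 [← one_smul ℝ N]
    rw [← sub_smul]
    congr 1
    field_simp
    ring
  have htr : ∀ α, (invJ U * H α).trace = (H α).trace - L / (1 + L) * (N ⬝ᵥ (H α *ᵥ N)) := by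
    intro α
    rw [ha, sub_mul, one_mul, Matrix.trace_sub, smul_mul_assoc, Matrix.trace_smul,
      Matrix.vecMulVec_mul, Matrix.trace_vecMulVec, smul_eq_mul, dotProduct_comm,
      Matrix.dotProduct_mulVec]
  have hNa : ∀ w, N ⬝ᵥ (invJ U *ᵥ w) = 1 / (1 + L) * (N ⬝ᵥ w) := fun w => by
    rw [Matrix.dotProduct_mulVec, ← Matrix.mulVec_transpose, invJ_transpose, haN,
      smul_dotProduct, smul_eq_mul]
  have hf : fluxJ U H = ∑ α, ((invJ U * H α).trace • (invJ U *ᵥ U α)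
      - (invJ U *ᵥ (H α *ᵥ (invJ U *ᵥ U α)))) := by
    ext j
    simp [fluxJ, Finset.sum_apply]
  rw [hf, dotProduct_sum, Finset.sum_div]
  refine Finset.sum_congr rfl fun α _ => ?_
  rw [dotProduct_sub, dotProduct_smul, hNa, hNa, hU, Matrix.mulVec_smul, haN, htr,
    Matrix.mulVec_smul, Matrix.mulVec_smul, dotProduct_smul, dotProduct_smul, dotProduct_smul, hN]
  simp only [smul_eq_mul]
  field_simp
  ring

end RankOne

/-! ### The trace on the tangent space and the mean curvature -/

section NormalTrace

variable {n : ℕ} {N : E n}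

/-- The trace of a bilinear form on the orthogonal complement of a unit vector. -/
def normalTrace (N : E n) (B : E n → E n → ℝ) : ℝ := ∑ i, B (e i) (e i) - B N N

/-- The projections of the standard basis form a Parseval frame of N^⊥. So the trace depends only on
values at tangent vectors, without choosing an orthonormal basis of the tangent space. -/
lemma normalTrace_eq_sum (hN : ‖N‖ = 1) (B : E n →L[ℝ] E n →L[ℝ] ℝ) :
    normalTrace N (fun u w => B u w) = ∑ i, B (e i - N i • N) (e i - N i • N) := by
  have h1 : ∑ i, N i * N i = 1 := by
    rw [← inner_euclidean, real_inner_self_eq_norm_sq, hN, one_pow]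
  have h2 : ∑ i, N i * B N (e i) = B N N := by
    have : B N N = B N (∑ i, N i • e i) := by rw [← sum_smul_e N]
    rw [this, map_sum]
    simp
  have h3 : ∑ i, N i * B (e i) N = B N N := by
    have : B N N = B (∑ i, N i • e i) N := by rw [← sum_smul_e N]
    rw [this, map_sum, _root_.sum_apply]
    simp
  simp only [map_sub, map_smul, _root_.sub_apply, _root_.smul_apply, smul_eq_mul]
  rw [normalTrace]
  have : ∀ i, B (e i) (e i) - N i * B N (e i) - N i * (B (e i) N - N i * B N N) =
      B (e i) (e i) - N i * B N (e i) - N i * B (e i) N + (N i * N i) * B N N := fun i => by ring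
  simp only [this, Finset.sum_add_distrib, Finset.sum_sub_distrib, h2, h3]
  rw [← Finset.sum_mul, h1]
  ring

lemma inner_sub_smul_self (hN : ‖N‖ = 1) (i : Fin n) : ⟪N, e i - N i • N⟫ = 0 := by
  rw [inner_sub_right, inner_e, inner_smul_right, real_inner_self_eq_norm_sq, hN]
  ring

/-- With c = |∇ρ|⁻¹, div(c ∇ρ) = c Δρ + ∇c · ∇ρ. Since the normal field has constant length, its
derivative is orthogonal to it, and this makes the second term cancel the normal part of c Δρ. -/
lemma divergence_unitNormal {ρ : E n → ℝ} {x : E n} (hρ : ContDiffAt ℝ 2 ρ x)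
    (h0 : gradient ρ x ≠ 0) :
    divergence (unitNormal ρ) x = -‖gradient ρ x‖⁻¹ *
      normalTrace (unitNormal ρ x) fun u w => fderiv ℝ (fderiv ℝ ρ) x u w := by
  -- The inverse Riesz map, written in coordinates as a continuous linear map so that it can be
  -- composed with the second derivative of ρ.
  set T : (E n →L[ℝ] ℝ) →L[ℝ] E n :=
    ∑ i, (ContinuousLinearMap.apply ℝ ℝ (e i : E n)).smulRight (e i) with hT
  have hTi : ∀ (A : E n →L[ℝ] ℝ) w, ⟪T A, w⟫ = A w := fun A w => by
    conv_rhs => rw [sum_smul_e w]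
    rw [hT, _root_.sum_apply, sum_inner, map_sum]
    refine Finset.sum_congr rfl fun i _ => ?_
    rw [ContinuousLinearMap.smulRight_apply, real_inner_smul_left, real_inner_comm, inner_e,
      map_smul, smul_eq_mul, mul_comm]
    rfl
  have hgT : gradient ρ = fun y => T (fderiv ℝ ρ y) := funext fun y =>
    ext_inner_right ℝ fun w => by
      rw [hTi, gradient, InnerProductSpace.toDual_symm_apply]
  have hd : DifferentiableAt ℝ (fderiv ℝ ρ) x :=
    (hρ.fderiv_right (m := 1) (by norm_num)).differentiableAt (by simp)
  have hg : HasFDerivAt (gradient ρ) (T.comp (fderiv ℝ (fderiv ℝ ρ) x)) x := by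
    rw [hgT]; exact T.hasFDerivAt.comp x hd.hasFDerivAt
  set c : E n → ℝ := fun y => ‖gradient ρ y‖⁻¹ with hc
  have hcd : DifferentiableAt ℝ c x :=
    (hg.differentiableAt.norm ℝ h0).inv (norm_ne_zero_iff.2 h0)
  have hN : HasFDerivAt (unitNormal ρ) (-(c x • T.comp (fderiv ℝ (fderiv ℝ ρ) x) +
      (fderiv ℝ c x).smulRight (gradient ρ x))) x := (hcd.hasFDerivAt.smul hg).neg
  have hgn : 0 < ‖gradient ρ x‖ := norm_pos_iff.2 h0
  have hgN : gradient ρ x = -(‖gradient ρ x‖ • unitNormal ρ x) := by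
    rw [unitNormal, smul_neg, neg_neg, smul_smul, mul_inv_cancel₀ hgn.ne', one_smul]
  have hunit : ∀ y, gradient ρ y ≠ 0 → ⟪unitNormal ρ y, unitNormal ρ y⟫ = 1 := fun y hy => by
    rw [real_inner_self_eq_norm_sq, unitNormal, norm_neg, norm_smul, norm_inv, norm_norm,
      inv_mul_cancel₀ (norm_ne_zero_iff.2 hy), one_pow]
  have hperp : ∀ u, ⟪unitNormal ρ x, fderiv ℝ (unitNormal ρ) x u⟫ = 0 := by
    intro u
    have h1 : (fun y => ⟪unitNormal ρ y, unitNormal ρ y⟫) =ᶠ[𝓝 x] fun _ => (1 : ℝ) := by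
      filter_upwards [hg.continuousAt.eventually_ne h0] with y hy using hunit y hy
    have h2 := h1.fderiv_eq (𝕜 := ℝ)
    rw [fderiv_const_apply] at h2
    have h3 := congrArg (fun A => A u) h2
    simp only [fderiv_inner_apply ℝ hN.differentiableAt hN.differentiableAt] at h3
    rw [real_inner_comm (unitNormal ρ x)] at h3
    simp only [_root_.zero_apply] at h3
    linarith [real_inner_comm (unitNormal ρ x) (fderiv ℝ (unitNormal ρ) x u)]
  have happ : ∀ u, fderiv ℝ (unitNormal ρ) x u =
      -(c x • T (fderiv ℝ (fderiv ℝ ρ) x u) + fderiv ℝ c x u • gradient ρ x) := fun u => by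
    rw [hN.fderiv]; rfl
  have hc' : fderiv ℝ c x (gradient ρ x) =
      -(c x * fderiv ℝ (fderiv ℝ ρ) x (unitNormal ρ x) (unitNormal ρ x)) := by
    have h1 := hperp (unitNormal ρ x)
    rw [happ, inner_neg_right, inner_add_right, inner_smul_right, inner_smul_right,
      real_inner_comm (T _), hTi] at h1
    have h2 : ⟪unitNormal ρ x, gradient ρ x⟫ = -‖gradient ρ x‖ := by
      rw [hgN, inner_neg_right, inner_smul_right, hunit x h0, ← hgN, mul_one]
    rw [h2] at h1
    have h3 : fderiv ℝ c x (gradient ρ x) =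
        -(‖gradient ρ x‖ * fderiv ℝ c x (unitNormal ρ x)) := by
      conv_lhs => rw [hgN]
      rw [map_neg, map_smul, smul_eq_mul]
    rw [h3]; linarith
  rw [divergence]
  have h4 : ∀ i, fderiv ℝ (unitNormal ρ) x (e i) i =
      -(c x * fderiv ℝ (fderiv ℝ ρ) x (e i) (e i)) - gradient ρ x i * fderiv ℝ c x (e i) := by
    intro i
    rw [← inner_e, happ, inner_neg_left, inner_add_left, real_inner_smul_left,
      real_inner_smul_left, hTi, inner_e]
    ring
  have h5 : ∑ i, gradient ρ x i * fderiv ℝ c x (e i) = fderiv ℝ c x (gradient ρ x) := by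
    conv_rhs => rw [sum_smul_e (gradient ρ x)]
    rw [map_sum]
    simp
  simp only [h4, Finset.sum_sub_distrib, h5, Finset.sum_neg_distrib, ← Finset.mul_sum]
  rw [hc', normalTrace]
  simp only [hc]
  ring

end NormalTrace

/-! ### Regularity of a Lipschitz graph along which a C² map is constant -/

section LevelGraph

variable {n : ℕ} {v : E n} {h : (ℝ ∙ v)ᗮ → ℝ} {C : NNReal} {S : Set (E n)} {y₀ : (ℝ ∙ v)ᗮ}
  {F : Type*} [NormedAddCommGroup F]

lemma chartPt_sub_chartPt (y z : (ℝ ∙ v)ᗮ) :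
    chartPt v h z 0 - chartPt v h y 0 = ((z - y : (ℝ ∙ v)ᗮ) : E n) + (h z - h y) • v := by
  simp only [chartPt, add_zero, sub_smul, Submodule.coe_sub]; abel

lemma continuous_graph (hh : Continuous h) : Continuous fun y => chartPt v h y 0 :=
  (continuous_chartPt hh).comp (Continuous.prodMk_left 0)

section NormedSpace

variable [NormedSpace ℝ F] {g : E n → F}

/-- Because h is Lipschitz, displacements along the graph are O(z - y); the first order expansion of
the constant g then makes A of the displacement negligible. -/
lemma isLittleO_of_level (hh : LipschitzWith C h) {y : (ℝ ∙ v)ᗮ}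
    (hΓ : ∀ᶠ z in 𝓝 y, chartPt v h z 0 ∈ S)
    (hc : ∀ᶠ z in 𝓝 y, g (chartPt v h z 0) = g (chartPt v h y 0)) {A : E n →L[ℝ] F}
    (hg : HasFDerivWithinAt g A S (chartPt v h y 0)) :
    (fun z => A ((z - y : (ℝ ∙ v)ᗮ) : E n) + (h z - h y) • A v) =o[𝓝 y] fun z => z - y := by
  have ht : Tendsto (fun z => chartPt v h z 0) (𝓝 y) (𝓝[S] (chartPt v h y 0)) :=
    tendsto_nhdsWithin_iff.2 ⟨(continuous_graph hh.continuous).tendsto y, hΓ⟩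
  have h1 := hg.isLittleO.comp_tendsto ht
  have h2 : (fun z => chartPt v h z 0 - chartPt v h y 0) =O[𝓝 y] fun z => z - y := by
    refine IsBigO.of_bound (1 + C * ‖v‖) (.of_forall fun z => ?_)
    rw [chartPt_sub_chartPt]
    refine (norm_add_le _ _).trans ?_
    rw [norm_smul, ← dist_eq_norm (h z), add_mul, one_mul, mul_right_comm]
    have := hh.dist_le_mul z y
    rw [dist_eq_norm z] at this
    exact add_le_add le_rfl (mul_le_mul_of_nonneg_right this (norm_nonneg _))
  refine ((h1.trans_isBigO h2).neg_left).congr' ?_ .rfl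
  filter_upwards [hc] with z hz
  simp only [Function.comp_apply, hz, chartPt_sub_chartPt, map_add, map_smul]
  abel

/-- If A v = 0, the expansion says that A on v^⊥ is o(z - y), hence zero, so A = 0 altogether. Thus
a nonzero derivative is automatically transversal to the hyperplane. -/
lemma apply_ne_zero_of_level (hh : LipschitzWith C h) {y : (ℝ ∙ v)ᗮ} (hv : ‖v‖ = 1)
    (hΓ : ∀ᶠ z in 𝓝 y, chartPt v h z 0 ∈ S)
    (hc : ∀ᶠ z in 𝓝 y, g (chartPt v h z 0) = g (chartPt v h y 0)) {A : E n →L[ℝ] F}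
    (hg : HasFDerivWithinAt g A S (chartPt v h y 0)) (hA : A ≠ 0) : A v ≠ 0 := by
  intro hAv
  apply hA
  have h1 := isLittleO_of_level hh hΓ hc hg
  simp only [hAv, smul_zero, add_zero] at h1
  have h2 : HasFDerivAt (fun z : (ℝ ∙ v)ᗮ => A z) (0 : (ℝ ∙ v)ᗮ →L[ℝ] F) y := by
    rw [hasFDerivAt_iff_isLittleO]
    refine h1.congr_left fun z => ?_
    simp
  have h3 : HasFDerivAt (fun z : (ℝ ∙ v)ᗮ => A z) (A.comp (ℝ ∙ v)ᗮ.subtypeL) y :=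
    (A.comp (ℝ ∙ v)ᗮ.subtypeL).hasFDerivAt
  have h4 := h3.unique h2
  ext w
  have h5 := chartPt_proj_height (h := fun _ => 0) hv w
  rw [← h5, chartPt, map_add, map_smul, hAv, smul_zero, add_zero]
  exact congrArg (fun B => B ((ℝ ∙ v)ᗮ.orthogonalProjectionOnto w)) h4

lemma hasFDerivAt_of_level (hh : LipschitzWith C h) {y : (ℝ ∙ v)ᗮ}
    (hΓ : ∀ᶠ z in 𝓝 y, chartPt v h z 0 ∈ S)
    (hc : ∀ᶠ z in 𝓝 y, g (chartPt v h z 0) = g (chartPt v h y 0)) {A : E n →L[ℝ] F}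
    (hg : HasFDerivWithinAt g A S (chartPt v h y 0)) (l : F →L[ℝ] ℝ) (hl : l (A v) ≠ 0) :
    HasFDerivAt h (-((l (A v))⁻¹ • (l.comp A).comp (ℝ ∙ v)ᗮ.subtypeL)) y := by
  have h1 := (l.isBigO_comp _ _).trans_isLittleO (isLittleO_of_level hh hΓ hc hg)
  rw [hasFDerivAt_iff_isLittleO]
  refine (h1.const_mul_left (l (A v))⁻¹).congr_left fun z => ?_
  simp only [map_add, map_smul, smul_eq_mul, _root_.neg_apply, _root_.smul_apply,
    ContinuousLinearMap.comp_apply, Submodule.subtypeL_apply]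
  field_simp
  ring

lemma contDiffAt_graph {k : WithTop ℕ∞} {y : (ℝ ∙ v)ᗮ} (hk : ContDiffAt ℝ k h y) :
    ContDiffAt ℝ k (fun y => chartPt v h y 0) y := by
  simp only [chartPt, add_zero]
  exact (ℝ ∙ v)ᗮ.subtypeL.contDiff.contDiffAt.add (hk.smul contDiffAt_const)

lemma contDiffAt_comp_graph {G : E n → F} {k : WithTop ℕ∞} (hG : ContDiffOn ℝ k G S)
    (hΓ : ∀ᶠ z in 𝓝 y₀, chartPt v h z 0 ∈ S) (hk : ContDiffAt ℝ k h y₀) :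
    ContDiffAt ℝ k (fun y => G (chartPt v h y 0)) y₀ := by
  have h1 : ContDiffWithinAt ℝ k (G ∘ fun y => chartPt v h y 0) {z | chartPt v h z 0 ∈ S} y₀ :=
    (hG _ hΓ.self_of_nhds).comp y₀ (contDiffAt_graph hk).contDiffWithinAt fun z hz => hz
  exact h1.contDiffAt hΓ

/-- A substitute for the implicit function theorem, needed because g lives only on the closed side
S. Implicit differentiation expresses Dh through the derivative of g along the graph; so C⁰
regularity of h makes Dh continuous, and C¹ regularity of h makes Dh of class C¹. -/
lemma contDiffAt_of_level (hh : LipschitzWith C h) (hv : ‖v‖ = 1) (hS : UniqueDiffOn ℝ S)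
    (hg : ContDiffOn ℝ 2 g S) (hΓ : ∀ᶠ z in 𝓝 y₀, chartPt v h z 0 ∈ S)
    (hc : ∀ᶠ z in 𝓝 y₀, g (chartPt v h z 0) = g (chartPt v h y₀ 0))
    (hne : fderivWithin ℝ g S (chartPt v h y₀ 0) ≠ 0) : ContDiffAt ℝ 2 h y₀ := by
  have hgd : ∀ x ∈ S, HasFDerivWithinAt g (fderivWithin ℝ g S x) S x := fun x hx =>
    ((hg.differentiableOn (by simp)) x hx).hasFDerivWithinAt
  have hD : ContDiffOn ℝ 1 (fderivWithin ℝ g S) S := hg.fderivWithin hS (by norm_num)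
  have hAv := apply_ne_zero_of_level hh hv hΓ hc (hgd _ hΓ.self_of_nhds) hne
  -- A functional detecting A v reduces the vector-valued g to one scalar equation.
  obtain ⟨l, -, hl⟩ := exists_dual_vector ℝ _ (norm_ne_zero_iff.2 hAv)
  have hl0 : l (fderivWithin ℝ g S (chartPt v h y₀ 0) v) ≠ 0 := by
    rw [hl]; simpa using hAv
  set D : (ℝ ∙ v)ᗮ → (ℝ ∙ v)ᗮ →L[ℝ] ℝ := fun y =>
    -((l (fderivWithin ℝ g S (chartPt v h y 0) v))⁻¹ •
      (l.comp (fderivWithin ℝ g S (chartPt v h y 0))).comp (ℝ ∙ v)ᗮ.subtypeL) with hDdef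
  have hDk : ∀ k : WithTop ℕ∞, k ≤ 1 → ContDiffAt ℝ k h y₀ → ContDiffAt ℝ k D y₀ := by
    intro k hk hhk
    have h1 : ContDiffAt ℝ k (fun y => fderivWithin ℝ g S (chartPt v h y 0)) y₀ :=
      contDiffAt_comp_graph (hD.of_le hk) hΓ hhk
    have h2 : ContDiffAt ℝ k (fun y => l (fderivWithin ℝ g S (chartPt v h y 0) v)) y₀ :=
      l.contDiff.contDiffAt.comp y₀ (h1.clm_apply contDiffAt_const)
    exact ((h2.inv hl0).smul ((contDiffAt_const.clm_comp h1).clm_comp contDiffAt_const)).neg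
  have hh0 : ContDiffAt ℝ 0 h y₀ := (contDiff_zero.2 hh.continuous).contDiffAt
  have hev : ∀ᶠ y in 𝓝 y₀, HasFDerivAt h (D y) y := by
    have h1 : ContinuousAt (fun y => l (fderivWithin ℝ g S (chartPt v h y 0) v)) y₀ := by
      have h2 := (contDiffAt_comp_graph (hD.of_le zero_le) hΓ hh0).continuousAt
      exact l.continuous.continuousAt.comp (h2.clm_apply continuousAt_const)
    filter_upwards [hΓ.eventually_nhds, hc.eventually_nhds, h1.eventually_ne hl0] with y h2 h3 h4
    refine hasFDerivAt_of_level hh h2 ?_ (hgd _ h2.self_of_nhds) l h4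
    filter_upwards [h3] with z hz
    rw [hz, h3.self_of_nhds]
  have hstep : ∀ k : ℕ, ContDiffAt ℝ k D y₀ → ContDiffAt ℝ (k + 1) h y₀ := fun k hk =>
    contDiffAt_succ_iff_hasFDerivAt.2 ⟨D, ⟨_, hev, fun y hy => hy⟩, hk⟩
  have hh1 : ContDiffAt ℝ 1 h y₀ := by
    have := hstep 0 (hDk _ (by simp) (by simpa using hh0))
    simpa using this
  have := hstep 1 (hDk _ (by simp) (by simpa using hh1))
  norm_num at this
  exact this

/-- If `g` is constant along the graph of `h`, then its first derivative vanishes in the tangent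
directions, and its second derivative is given there by the second derivative of `h`. -/
lemma level_derivatives (hS : UniqueDiffOn ℝ S)
    (hg : ContDiffOn ℝ 2 g S) (hΓ : ∀ᶠ z in 𝓝 y₀, chartPt v h z 0 ∈ S)
    (hc : ∀ᶠ z in 𝓝 y₀, g (chartPt v h z 0) = g (chartPt v h y₀ 0))
    (hh : ContDiffAt ℝ 2 h y₀) :
    (∀ u : (ℝ ∙ v)ᗮ, fderivWithin ℝ g S (chartPt v h y₀ 0) ((u : E n) + fderiv ℝ h y₀ u • v) = 0) ∧
    ∀ u w : (ℝ ∙ v)ᗮ, fderivWithin ℝ (fderivWithin ℝ g S) S (chartPt v h y₀ 0)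
        ((w : E n) + fderiv ℝ h y₀ w • v) ((u : E n) + fderiv ℝ h y₀ u • v) =
      -(fderiv ℝ (fderiv ℝ h) y₀ w u • fderivWithin ℝ g S (chartPt v h y₀ 0) v) := by
  have hgd : ∀ x ∈ S, HasFDerivWithinAt g (fderivWithin ℝ g S x) S x := fun x hx =>
    ((hg.differentiableOn (by simp)) x hx).hasFDerivWithinAt
  have hD : ContDiffOn ℝ 1 (fderivWithin ℝ g S) S := hg.fderivWithin hS (by norm_num)
  have hΓd : ∀ y, DifferentiableAt ℝ h y → HasFDerivAt (fun y => chartPt v h y 0)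
      ((ℝ ∙ v)ᗮ.subtypeL + (fderiv ℝ h y).smulRight v) y := fun y hy => by
    simp only [chartPt, add_zero]
    exact (ℝ ∙ v)ᗮ.subtypeL.hasFDerivAt.add (hy.hasFDerivAt.smul_const v)
  have h1 : ∀ᶠ y in 𝓝 y₀, ∀ u : (ℝ ∙ v)ᗮ,
      fderivWithin ℝ g S (chartPt v h y 0) ((u : E n) + fderiv ℝ h y u • v) = 0 := by
    filter_upwards [hΓ.eventually_nhds, hc.eventually_nhds, hh.eventually (by simp)]
      with y h2 h3 h4 u
    have h5 := (hgd _ h2.self_of_nhds).comp_hasFDerivAt y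
      (hΓd y (h4.differentiableAt (by simp))) h2
    have h6 : HasFDerivAt (g ∘ fun y => chartPt v h y 0) (0 : (ℝ ∙ v)ᗮ →L[ℝ] F) y :=
      (hasFDerivAt_const (g (chartPt v h y₀ 0)) y).congr_of_eventuallyEq h3
    have := congrArg (fun B => B u) (h5.unique h6)
    simpa using this
  refine ⟨h1.self_of_nhds, fun u w => ?_⟩
  have hx := hΓ.self_of_nhds
  have hA : HasFDerivAt (fun y => fderivWithin ℝ g S (chartPt v h y 0)) _ y₀ :=
    ((hD.differentiableOn (by simp)) _ hx).hasFDerivWithinAt.comp_hasFDerivAt y₀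
      (hΓd y₀ (hh.differentiableAt (by simp))) hΓ
  have hhd : HasFDerivAt (fderiv ℝ h) (fderiv ℝ (fderiv ℝ h) y₀) y₀ :=
    ((hh.fderiv_right (m := 1) (by norm_num)).differentiableAt (by simp)).hasFDerivAt
  have hT : HasFDerivAt (fun y => (u : E n) + fderiv ℝ h y u • v)
      (((fderiv ℝ (fderiv ℝ h) y₀).flip u).smulRight v) y₀ :=
    (((hhd.clm_apply (hasFDerivAt_const u y₀)).smul_const v).const_add (u : E n)).congr_fderiv
      (by ext; simp)
  have h2 := (hA.clm_apply hT).unique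
    ((hasFDerivAt_const (0 : F) y₀).congr_of_eventuallyEq (h1.mono fun y hy => hy u))
  have h3 := congrArg (fun B => B w) h2
  simp only [_root_.add_apply, ContinuousLinearMap.comp_apply, ContinuousLinearMap.flip_apply,
    ContinuousLinearMap.smulRight_apply, map_smul, _root_.zero_apply,
    Submodule.subtypeL_apply] at h3
  rw [← add_eq_zero_iff_eq_neg, add_comm]
  exact h3

end NormedSpace

end LevelGraph

/-! ### One-sided differentiation on the complement of a Lipschitz domain -/

section LipschitzComplement

variable {n m : ℕ} {Ω : Set (E n)}

lemma HasLipschitzBoundary.exists_chart (hlip : HasLipschitzBoundary Ω) {x₀ : E n}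
    (hx₀ : x₀ ∈ frontier Ω) : ∃ v : E n, ‖v‖ = 1 ∧ ∃ (C : NNReal) (h : (ℝ ∙ v)ᗮ → ℝ),
      LipschitzWith C h ∧ ∃ U, IsOpen U ∧ x₀ ∈ U ∧ ∀ x ∈ U, x ∈ Ωᶜ ↔ 0 ≤ height v h x := by
  obtain ⟨v, hv, C, h, hh, hev⟩ := hlip x₀ hx₀
  obtain ⟨U, hU, hUo, hxU⟩ := eventually_nhds_iff.1 hev
  refine ⟨v, hv, C, h, hh, U, hUo, hxU, fun x hx => ?_⟩
  rw [Set.mem_compl_iff, hU x hx, not_lt, height, sub_nonneg]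

/-- At a boundary point the complement contains a truncated cone around v, with opening governed by
the Lipschitz constant. It makes one-sided derivatives unique, and makes every point a limit of
interior points. -/
lemma exists_convex_subset_compl (hlip : HasLipschitzBoundary Ω) {x : E n} (hx : x ∈ Ωᶜ) :
    ∃ S ⊆ Ωᶜ, Convex ℝ S ∧ (interior S).Nonempty ∧ x ∈ S := by
  by_cases hxi : x ∈ interior Ωᶜ
  · obtain ⟨ε, hε, hb⟩ := Metric.isOpen_iff.1 isOpen_interior x hxi
    refine ⟨Metric.ball x ε, hb.trans interior_subset, convex_ball x ε, ?_,
      Metric.mem_ball_self hε⟩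
    rw [Metric.isOpen_ball.interior_eq]
    exact ⟨x, Metric.mem_ball_self hε⟩
  · have hxf : x ∈ frontier Ω := by
      rw [← frontier_compl]
      exact ⟨subset_closure hx, hxi⟩
    obtain ⟨v, hv, C, h, hh, U, hUo, hxU, hU⟩ := hlip.exists_chart hxf
    obtain ⟨ε, hε, hb⟩ := Metric.isOpen_iff.1 hUo x hxU
    set P := (ℝ ∙ v)ᗮ.orthogonalProjectionOnto with hP
    refine ⟨{z | C * ‖P (z - x)‖ ≤ ⟪v, z - x⟫} ∩ Metric.ball x ε, ?_, ?_, ?_, ?_⟩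
    · rintro z ⟨hz, hzb⟩
      rw [hU z (hb hzb)]
      have h1 := (hU x hxU).1 hx
      have h2 := hh.dist_le_mul (P z) (P x)
      rw [Real.dist_eq, dist_eq_norm, ← map_sub] at h2
      have h3 := (abs_le.1 h2).2
      have h4 : C * ‖P (z - x)‖ ≤ ⟪v, z - x⟫ := hz
      rw [inner_sub_right] at h4
      rw [height] at h1 ⊢
      linarith
    · refine Convex.inter ?_ (convex_ball x ε)
      intro z hz w hw a b ha hb hab
      have hz' : C * ‖P (z - x)‖ ≤ ⟪v, z - x⟫ := hz
      have hw' : C * ‖P (w - x)‖ ≤ ⟪v, w - x⟫ := hw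
      have he : a • z + b • w - x = a • (z - x) + b • (w - x) := by
        rw [smul_sub, smul_sub, sub_add_sub_comm, ← add_smul, hab, one_smul]
      change C * ‖P (a • z + b • w - x)‖ ≤ ⟪v, a • z + b • w - x⟫
      rw [he, map_add, map_smul, map_smul, inner_add_right, inner_smul_right, inner_smul_right]
      have h1 : ‖a • P (z - x) + b • P (w - x)‖ ≤ a * ‖P (z - x)‖ + b * ‖P (w - x)‖ := by
        refine (norm_add_le _ _).trans ?_
        rw [norm_smul, norm_smul, Real.norm_of_nonneg ha, Real.norm_of_nonneg hb]
      calc (C : ℝ) * ‖a • P (z - x) + b • P (w - x)‖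
          ≤ C * (a * ‖P (z - x)‖ + b * ‖P (w - x)‖) := by gcongr
        _ = a * (C * ‖P (z - x)‖) + b * (C * ‖P (w - x)‖) := by ring
        _ ≤ _ := by gcongr
    · refine ⟨x + (ε / 2) • v, mem_interior.2 ⟨{z | C * ‖P (z - x)‖ < ⟪v, z - x⟫} ∩
        Metric.ball x ε, Set.inter_subset_inter_left _ fun z hz =>
          show C * ‖P (z - x)‖ ≤ ⟪v, z - x⟫ from le_of_lt hz, ?_, ?_, ?_⟩⟩
      · exact (isOpen_lt (by fun_prop) (by fun_prop)).inter Metric.isOpen_ball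
      · have h0 : P v = 0 :=
          Submodule.orthogonalProjectionOnto_orthogonalComplement_singleton_eq_zero v
        simp only [Set.mem_ofPred_eq, add_sub_cancel_left, map_smul, h0, smul_zero, norm_zero,
          mul_zero, inner_smul_right, real_inner_self_eq_norm_sq, hv]
        positivity
      · rw [Metric.mem_ball, dist_eq_norm, add_sub_cancel_left, norm_smul, hv, mul_one,
          Real.norm_of_nonneg (by positivity)]
        linarith
    · exact ⟨by simp, Metric.mem_ball_self hε⟩

lemma uniqueDiffOn_compl (hlip : HasLipschitzBoundary Ω) : UniqueDiffOn ℝ Ωᶜ := fun x hx => by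
  obtain ⟨S, hS, hc, hi, hxS⟩ := exists_convex_subset_compl hlip hx
  exact (uniqueDiffWithinAt_convex hc hi (subset_closure hxS)).mono hS

lemma compl_subset_closure_interior (hlip : HasLipschitzBoundary Ω) :
    Ωᶜ ⊆ closure (interior Ωᶜ) := fun x hx => by
  obtain ⟨S, hS, hc, hi, hxS⟩ := exists_convex_subset_compl hlip hx
  have := hc.closure_interior_eq_closure_of_nonempty_interior hi
  exact closure_mono (interior_mono hS) (this ▸ subset_closure hxS)

end LipschitzComplement

/-! ### Continuity and symmetry of the jets up to the boundary -/

section JetsOnDomain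

variable {n m : ℕ} {K : Set (E n)} {f : E n → E m}

lemma continuousOn_jet1 (hK : UniqueDiffOn ℝ K) (hf : ContDiffOn ℝ 2 f K) :
    ContinuousOn (jet1 K f) K := by
  have h1 := hf.continuousOn_fderivWithin hK (by simp)
  refine continuousOn_pi.2 fun α => continuousOn_pi.2 fun i => ?_
  have h2 : ContinuousOn (fun x => fderivWithin ℝ f K x (e i)) K := h1.clm_apply continuousOn_const
  exact (EuclideanSpace.proj (𝕜 := ℝ) α).continuous.comp_continuousOn h2

lemma continuousOn_jet2 (hK : UniqueDiffOn ℝ K) (hf : ContDiffOn ℝ 2 f K) :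
    ContinuousOn (jet2 K f) K := by
  have h1 : ContDiffOn ℝ 1 (fderivWithin ℝ f K) K := hf.fderivWithin hK (by norm_num)
  have h2 := h1.continuousOn_fderivWithin hK (by simp)
  refine continuousOn_pi.2 fun α => continuousOn_pi.2 fun i => continuousOn_pi.2 fun j => ?_
  have h3 : ContinuousOn (fun x => fderivWithin ℝ (fderivWithin ℝ f K) K x (e i) (e j)) K :=
    (h2.clm_apply continuousOn_const).clm_apply continuousOn_const
  exact (EuclideanSpace.proj (𝕜 := ℝ) α).continuous.comp_continuousOn h3

lemma continuousOn_flux (hK : UniqueDiffOn ℝ K) (hf : ContDiffOn ℝ 2 f K) :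
    ContinuousOn (flux K f) K := by
  have h1 : ContinuousOn (fun x => (jet1 K f x, jet2 K f x)) K :=
    (continuousOn_jet1 hK hf).prodMk (continuousOn_jet2 hK hf)
  have h2 := continuous_toLp_fluxJ (n := n) (m := m)
  have h3 := h2.comp_continuousOn h1
  exact h3

lemma continuousOn_divJ (hK : UniqueDiffOn ℝ K) (hf : ContDiffOn ℝ 2 f K) :
    ContinuousOn (fun x => divJ (jet1 K f x) (jet2 K f x)) K := by
  have h1 : ContinuousOn (fun x => (jet1 K f x, jet2 K f x)) K :=
    (continuousOn_jet1 hK hf).prodMk (continuousOn_jet2 hK hf)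
  have h2 := continuous_divJ (n := n) (m := m)
  have h3 := h2.comp_continuousOn h1
  exact h3

lemma jet2_symm (hK : UniqueDiffOn ℝ K) (hf : ContDiffOn ℝ 2 f K) {x : E n} (hx : x ∈ K)
    (hxi : x ∈ closure (interior K)) (α : Fin m) (i j : Fin n) :
    jet2 K f x α i j = jet2 K f x α j i := by
  have := ((hf x hx).isSymmSndFDerivWithinAt (by simp) hK hxi hx).eq (e i) (e j)
  exact congrArg (fun w : E m => w α) this

lemma normSqDf_eq_zero_of_fderivWithin {x : E n} (h : fderivWithin ℝ f K x = 0) :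
    normSqDf K f x = 0 ∧ flux K f x = 0 := by
  have h1 : jet1 K f x = 0 := by ext α i; simp [jet1, pd, h]
  constructor
  · simp [normSqDf, pd, h]
  · ext j
    have h2 : ∀ α, jet1 K f x α = 0 := fun α => by rw [h1]; rfl
    simp [flux, fluxJ, h2]

end JetsOnDomain

/-! ### Linear algebra of the conormal -/

section ConormalAlgebra

variable {n : ℕ} {v : E n} {h : (ℝ ∙ v)ᗮ → ℝ} {y : (ℝ ∙ v)ᗮ}
  {F : Type*} [NormedAddCommGroup F] [NormedSpace ℝ F]

lemma inner_conormal (w : E n) : ⟪conormal v h y, w⟫ =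
    fderiv ℝ h y ((ℝ ∙ v)ᗮ.orthogonalProjectionOnto w) - ⟪v, w⟫ := by
  rw [conormal, inner_sub_left, ← Submodule.inner_orthogonalProjectionOnto_eq_of_mem_left,
    gradient, InnerProductSpace.toDual_symm_apply]

lemma coe_proj_add_smul (hv : ‖v‖ = 1) (w : E n) :
    (((ℝ ∙ v)ᗮ.orthogonalProjectionOnto w : (ℝ ∙ v)ᗮ) : E n) + ⟪v, w⟫ • v = w := by
  have := chartPt_proj_height (h := fun _ => 0) hv w
  simpa [chartPt, height] using this

lemma norm_conormal (hv : ‖v‖ = 1) : ‖conormal v h y‖ = graphDensity v h y := by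
  rw [graphDensity]
  have : conormal v h y = ((gradient h y : (ℝ ∙ v)ᗮ) : E n) + (-1 : ℝ) • v := by
    rw [conormal, neg_one_smul, sub_eq_add_neg]
  rw [this, ← Real.sqrt_sq (norm_nonneg (_ + _)), norm_coe_add_smul_sq hv]
  congr 1
  ring

/-- A linear map killing the tangent space of the graph factors through the conormal; its value at v
fixes the factor, because ⟨conormal, v⟩ = -1. -/
lemma apply_eq_neg_inner_conormal (hv : ‖v‖ = 1) {A : E n →L[ℝ] F}
    (hA : ∀ u : (ℝ ∙ v)ᗮ, A ((u : E n) + fderiv ℝ h y u • v) = 0) (w : E n) :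
    A w = -(⟪conormal v h y, w⟫ • A v) := by
  have h1 := hA ((ℝ ∙ v)ᗮ.orthogonalProjectionOnto w)
  rw [map_add, map_smul, ← eq_neg_iff_add_eq_zero] at h1
  conv_lhs => rw [← coe_proj_add_smul hv w]
  rw [map_add, map_smul, h1, inner_conormal, ← neg_smul, ← neg_smul, ← add_smul]
  congr 1
  ring

lemma eq_tangent_of_inner_conormal_eq_zero (hv : ‖v‖ = 1) {w : E n}
    (hw : ⟪conormal v h y, w⟫ = 0) :
    (((ℝ ∙ v)ᗮ.orthogonalProjectionOnto w : (ℝ ∙ v)ᗮ) : E n) +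
      fderiv ℝ h y ((ℝ ∙ v)ᗮ.orthogonalProjectionOnto w) • v = w := by
  rw [inner_conormal, sub_eq_zero] at hw
  rw [hw, coe_proj_add_smul hv]

end ConormalAlgebra

/-! ### The flux through the boundary of Ω -/

section BoundaryFlux

variable {n m : ℕ} {Ω U : Set (E n)} {f : E n → E m} {v : E n} {h : (ℝ ∙ v)ᗮ → ℝ} {C : NNReal}
  {y₀ : (ℝ ∙ v)ᗮ} {ρ : E n → ℝ}

lemma eq_zero_of_mem_frontier (hΩ : IsOpen Ω) {x : E n} (hx : x ∈ frontier Ω)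
    (hρ : ContinuousAt ρ x) (hm : ∀ᶠ y in 𝓝 x, y ∈ Ω ↔ ρ y < 0) : ρ x = 0 := by
  rw [hΩ.frontier_eq] at hx
  have h1 : 0 ≤ ρ x := not_lt.1 fun h => hx.2 (hm.self_of_nhds.2 h)
  refine h1.antisymm' (not_lt.1 fun h => ?_)
  obtain ⟨z, hz, h2, h3⟩ := (mem_closure_iff_frequently.1 hx.1).and_eventually
    (hm.and (hρ.eventually_const_lt h)) |>.exists
  exact absurd (h2.1 hz) (not_lt.2 h3.le)

lemma eventually_graph_mem_frontier (hΩ : IsOpen Ω) (hv : ‖v‖ = 1) (hh : Continuous h)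
    (hU : IsOpen U) (hK : ∀ x ∈ U, x ∈ Ωᶜ ↔ 0 ≤ height v h x) (hy : chartPt v h y₀ 0 ∈ U) :
    ∀ᶠ z in 𝓝 y₀, chartPt v h z 0 ∈ frontier Ω := by
  filter_upwards [(continuous_graph hh).continuousAt.eventually (hU.mem_nhds hy)] with z hz
  rw [← frontier_compl, mem_frontier_iff_height_eq_zero hv hh hU hΩ.isClosed_compl hK hz,
    height_chartPt hv]

/-- A small piece of the graph is the image of a ball, hence connected, and so lies in one component
of the boundary. -/
lemma eventually_graph_const (hh : Continuous h)
    (hfr : ∀ᶠ z in 𝓝 y₀, chartPt v h z 0 ∈ frontier Ω)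
    (hconst : ∀ x ∈ frontier Ω, ∀ y ∈ connectedComponentIn (frontier Ω) x, f y = f x) :
    ∀ᶠ z in 𝓝 y₀, f (chartPt v h z 0) = f (chartPt v h y₀ 0) := by
  obtain ⟨ε, hε, hb⟩ := Metric.eventually_nhds_iff_ball.1 hfr
  filter_upwards [Metric.ball_mem_nhds y₀ hε] with z hz
  refine hconst _ (hb y₀ (Metric.mem_ball_self hε)) _ ?_
  have hpre : IsPreconnected ((fun y => chartPt v h y 0) '' Metric.ball y₀ ε) :=
    (convex_ball y₀ ε).isPreconnected.image _ (continuous_graph hh).continuousOn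
  refine hpre.subset_connectedComponentIn ⟨y₀, Metric.mem_ball_self hε, rfl⟩ ?_ ⟨z, hz, rfl⟩
  rintro _ ⟨w, hw, rfl⟩
  exact hb w hw

lemma isDefiningFunctionAt_height (hv : ‖v‖ = 1) (hU : IsOpen U)
    (hK : ∀ x ∈ U, x ∈ Ωᶜ ↔ 0 ≤ height v h x) (hy : chartPt v h y₀ 0 ∈ U)
    (hh : ContDiffAt ℝ 2 h y₀) : IsDefiningFunctionAt Ω (chartPt v h y₀ 0) (height v h) where
  contDiffAt := by
    have h1 : ContDiffAt ℝ 2 h ((ℝ ∙ v)ᗮ.orthogonalProjectionOnto (chartPt v h y₀ 0)) := by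
      rwa [proj_chartPt]
    exact (innerSL ℝ v).contDiff.contDiffAt.sub
      (h1.comp _ ((ℝ ∙ v)ᗮ.orthogonalProjectionOnto).contDiff.contDiffAt)
  map_eq_zero := height_chartPt hv _ _
  gradient_ne_zero := by
    intro h0
    have hd : DifferentiableAt ℝ h ((ℝ ∙ v)ᗮ.orthogonalProjectionOnto (chartPt v h y₀ 0)) := by
      rw [proj_chartPt]; exact hh.differentiableAt (by simp)
    have h1 := (hasFDerivAt_height hd).fderiv
    have h2 : fderiv ℝ (height v h) (chartPt v h y₀ 0) v = 0 := by
      rw [← InnerProductSpace.toDual_symm_apply (𝕜 := ℝ), ← gradient, h0, inner_zero_left]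
    rw [h1, _root_.neg_apply, innerSL_apply_apply, inner_conormal, real_inner_self_eq_norm_sq, hv,
      Submodule.orthogonalProjectionOnto_orthogonalComplement_singleton_eq_zero] at h2
    simp at h2
  mem_iff := by
    filter_upwards [hU.mem_nhds hy] with y hyU
    rw [← not_iff_not, not_lt]
    exact hK y hyU

/-- The first two derivatives of a defining function at a boundary point of a chart. -/
lemma IsDefiningFunctionAt.derivatives (hρ : IsDefiningFunctionAt Ω (chartPt v h y₀ 0) ρ)
    (hΩ : IsOpen Ω) (hv : ‖v‖ = 1) (hU : IsOpen U)
    (hK : ∀ x ∈ U, x ∈ Ωᶜ ↔ 0 ≤ height v h x) (hy : chartPt v h y₀ 0 ∈ U)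
    (hfr : ∀ᶠ z in 𝓝 y₀, chartPt v h z 0 ∈ frontier Ω) (hh : ContDiffAt ℝ 2 h y₀) :
    0 < fderiv ℝ ρ (chartPt v h y₀ 0) v ∧
    (∀ w, fderiv ℝ ρ (chartPt v h y₀ 0) w =
      -(⟪conormal v h y₀, w⟫ * fderiv ℝ ρ (chartPt v h y₀ 0) v)) ∧
    ∀ u w : (ℝ ∙ v)ᗮ, fderiv ℝ (fderiv ℝ ρ) (chartPt v h y₀ 0)
        ((w : E n) + fderiv ℝ h y₀ w • v) ((u : E n) + fderiv ℝ h y₀ u • v) =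
      -(fderiv ℝ (fderiv ℝ h) y₀ w u * fderiv ℝ ρ (chartPt v h y₀ 0) v) := by
  set x := chartPt v h y₀ 0 with hx
  set S : Set (E n) := {z | ContDiffAt ℝ 2 ρ z} with hS
  have hmem : ∀ {z}, z ∈ S → ContDiffAt ℝ 2 ρ z := fun hz => hz
  have hSo : IsOpen S := isOpen_iff_mem_nhds.2 fun z hz => (hmem hz).eventually (by simp)
  have hxS : x ∈ S := hρ.contDiffAt
  have hρS : ContDiffOn ℝ 2 ρ S := fun z hz => (hmem hz).contDiffWithinAt
  have hΓc : ContinuousAt (fun y => chartPt v h y 0) y₀ := (contDiffAt_graph hh).continuousAt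
  have hΓS : ∀ᶠ z in 𝓝 y₀, chartPt v h z 0 ∈ S := hΓc.eventually (hSo.mem_nhds hxS)
  have hc : ∀ᶠ z in 𝓝 y₀, ρ (chartPt v h z 0) = ρ (chartPt v h y₀ 0) := by
    filter_upwards [hΓS, hfr, hΓc.eventually hρ.mem_iff.eventually_nhds] with z h1 h2 h3
    rw [eq_zero_of_mem_frontier hΩ h2 (hmem h1).continuousAt h3, ← hx, hρ.map_eq_zero]
  obtain ⟨h1, h2⟩ := level_derivatives hSo.uniqueDiffOn hρS hΓS hc hh
  have hD : fderivWithin ℝ ρ S =ᶠ[𝓝 x] fderiv ℝ ρ := by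
    filter_upwards [hSo.mem_nhds hxS] with z hz using fderivWithin_of_isOpen hSo hz
  rw [← hx, hD.self_of_nhds] at h1
  rw [← hx, fderivWithin_of_isOpen hSo hxS, hD.self_of_nhds, hD.fderiv_eq] at h2
  have h3 := apply_eq_neg_inner_conormal hv h1
  refine ⟨lt_of_le_of_ne ?_ fun h0 => hρ.gradient_ne_zero ?_, h3, h2⟩
  -- Moving upwards along v leaves Ω, where ρ ≥ 0, so the derivative along v is nonnegative; it
  -- cannot be zero, since all other directional derivatives are multiples of it.
  · have hline : HasDerivAt (fun t : ℝ => ρ (x + t • v)) (fderiv ℝ ρ x v) 0 := by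
      have := (hρ.contDiffAt.differentiableAt (by simp)).hasFDerivAt
      exact this.hasLineDerivAt v
    have hcont : Tendsto (fun t : ℝ => x + t • v) (𝓝[>] 0) (𝓝 x) := by
      have : Continuous fun t : ℝ => x + t • v := by fun_prop
      have := this.tendsto 0
      rw [zero_smul, add_zero] at this
      exact this.mono_left nhdsWithin_le_nhds
    refine ge_of_tendsto (hline.tendsto_slope_zero_right) ?_
    filter_upwards [hcont.eventually hρ.mem_iff, hcont.eventually (hU.mem_nhds hy),
      self_mem_nhdsWithin] with t ht htU ht0
    have h4 : x + t • v = chartPt v h y₀ t := by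
      rw [hx, chartPt, chartPt, add_zero, add_smul, add_assoc]
    have h5 : x + t • v ∈ Ωᶜ := by
      rw [hK _ htU, h4, height_chartPt hv]
      exact le_of_lt ht0
    have h6 : 0 ≤ ρ (x + t • v) := not_lt.1 fun h => h5 (ht.2 h)
    simp only [zero_add, zero_smul, add_zero, hρ.map_eq_zero, sub_zero, smul_eq_mul]
    exact mul_nonneg (inv_nonneg.2 (le_of_lt ht0)) h6
  · have h4 : fderiv ℝ ρ x = 0 := by
      ext w
      rw [h3, ← h0]
      simp
    rw [gradient, h4, map_zero]

/-- Both f and the defining function are constant along the boundary. Hence their gradients are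
normal, and their Hessians on the tangent space are multiples of the same form D²h. The trace for ρ
is mean curvature, so the rank one formula turns the flux of X into -|Df|²/(1+|Df|²) H. -/
theorem graphDensity_mul_meanCurv (hΩ : IsOpen Ω) (hK : UniqueDiffOn ℝ Ωᶜ)
    (hf : ContDiffOn ℝ 2 f Ωᶜ)
    (hconst : ∀ x ∈ frontier Ω, ∀ y ∈ connectedComponentIn (frontier Ω) x, f y = f x)
    (hv : ‖v‖ = 1) (hh : LipschitzWith C h) (hU : IsOpen U)
    (hKU : ∀ x ∈ U, x ∈ Ωᶜ ↔ 0 ≤ height v h x) (hy : chartPt v h y₀ 0 ∈ U)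
    (hne : fderivWithin ℝ f Ωᶜ (chartPt v h y₀ 0) ≠ 0) :
    ContDiffAt ℝ 1 h y₀ ∧ graphDensity v h y₀ *
        -(normSqDf Ωᶜ f (chartPt v h y₀ 0) / (1 + normSqDf Ωᶜ f (chartPt v h y₀ 0)) *
          meanCurv Ω (chartPt v h y₀ 0)) =
      ⟪conormal v h y₀, flux Ωᶜ f (chartPt v h y₀ 0)⟫ := by
  have hfr := eventually_graph_mem_frontier hΩ hv hh.continuous hU hKU hy
  have hfc := eventually_graph_const hh.continuous hfr hconst
  have hfS : ∀ᶠ z in 𝓝 y₀, chartPt v h z 0 ∈ Ωᶜ := hfr.mono fun z hz => by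
    rw [hΩ.frontier_eq] at hz
    exact hz.2
  have hC := contDiffAt_of_level hh hv hK hf hfS hfc hne
  refine ⟨hC.of_le (by norm_num), ?_⟩
  -- The height function shows that `meanCurv` is not in its default branch; the computation below
  -- is valid for whichever defining function was chosen.
  have hex : ∃ ρ, IsDefiningFunctionAt Ω (chartPt v h y₀ 0) ρ :=
    ⟨_, isDefiningFunctionAt_height hv hU hKU hy hC⟩
  rw [meanCurv, dif_pos hex]
  have hρ := hex.choose_spec
  set ρ := hex.choose
  obtain ⟨hc0, hρ1, hρ2⟩ := hρ.derivatives hΩ hv hU hKU hy hfr hC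
  obtain ⟨hf1, hf2⟩ := level_derivatives hK hf hfS hfc hC
  have hf1' := apply_eq_neg_inner_conormal hv hf1
  set x := chartPt v h y₀ 0
  set c := fderiv ℝ ρ x v with hc
  set A := fderivWithin ℝ f Ωᶜ x with hA
  set σ := graphDensity v h y₀ with hσ
  have hσ0 : 0 < σ := graphDensity_pos y₀
  -- the unit normal
  have hgrad : gradient ρ x = -(c • conormal v h y₀) := ext_inner_right ℝ fun w => by
    rw [gradient, InnerProductSpace.toDual_symm_apply, hρ1, inner_neg_left, real_inner_smul_left,
      mul_comm]
  have hgn : ‖gradient ρ x‖ = c * σ := by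
    rw [hgrad, norm_neg, norm_smul, norm_conormal hv, Real.norm_of_nonneg hc0.le]
  set N := unitNormal ρ x with hN
  have hconN : conormal v h y₀ = σ • N := by
    rw [hN, unitNormal, hgn, hgrad]
    simp only [smul_neg, neg_neg, smul_smul]
    rw [show σ * ((c * σ)⁻¹ * c) = 1 by field_simp, one_smul]
  have hN1 : ‖N‖ = 1 := by
    have h1 := norm_conormal (h := h) (y := y₀) hv
    rw [hconN, norm_smul, Real.norm_of_nonneg hσ0.le] at h1
    exact mul_left_cancel₀ hσ0.ne' (h1.trans (mul_one σ).symm)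
  -- the traces of the second derivatives
  have htr : ∀ α, (jet2 Ωᶜ f x α).trace - N.ofLp ⬝ᵥ (jet2 Ωᶜ f x α *ᵥ N.ofLp) =
      -(σ * A v α) * divergence (unitNormal ρ) x := by
    intro α
    set B : E n →L[ℝ] E n →L[ℝ] ℝ := (ContinuousLinearMap.compL ℝ (E n) (E m) ℝ
      (EuclideanSpace.proj α)).comp (fderivWithin ℝ (fderivWithin ℝ f Ωᶜ) Ωᶜ x)
    have h1 : (jet2 Ωᶜ f x α).trace - N.ofLp ⬝ᵥ (jet2 Ωᶜ f x α *ᵥ N.ofLp) =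
        normalTrace N fun u w => B u w := by
      rw [← hess_apply_eq_dotProduct]; rfl
    -- The vectors e_i - N_i N are tangent, and on tangent vectors both Hessians are -D²h times the
    -- respective derivative along v; the ratio is A v α / c.
    have h2 : ∀ i, B (e i - N i • N) (e i - N i • N) =
        A v α / c * fderiv ℝ (fderiv ℝ ρ) x (e i - N i • N) (e i - N i • N) := by
      intro i
      have h3 : ⟪conormal v h y₀, e i - N i • N⟫ = 0 := by
        rw [hconN, real_inner_smul_left, inner_sub_smul_self hN1, mul_zero]
      have h4 := eq_tangent_of_inner_conormal_eq_zero hv h3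
      set w := (ℝ ∙ v)ᗮ.orthogonalProjectionOnto (e i - N i • N)
      have h5 := congrArg (fun z : E m => z α) (hf2 w w)
      have h6 := hρ2 w w
      rw [h4] at h5 h6
      rw [h6]
      refine h5.trans ?_
      simp only [WithLp.ofLp_neg, WithLp.ofLp_smul, Pi.neg_apply, Pi.smul_apply, smul_eq_mul]
      field_simp
    rw [h1, normalTrace_eq_sum hN1, divergence_unitNormal hρ.contDiffAt hρ.gradient_ne_zero,
      ← hN, normalTrace_eq_sum hN1, hgn]
    simp only [h2, ← Finset.mul_sum]
    field_simp
  -- the first derivatives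
  have hjet : ∀ α, jet1 Ωᶜ f x α = (-(σ * A v α)) • N.ofLp := by
    intro α
    ext i
    have h1 := congrArg (fun z : E m => z α) (hf1' (e i))
    rw [hconN, real_inner_smul_left, inner_e] at h1
    simp only [WithLp.ofLp_neg, WithLp.ofLp_smul, Pi.neg_apply, Pi.smul_apply, smul_eq_mul] at h1
    refine h1.trans ?_
    simp only [Pi.smul_apply, smul_eq_mul]
    ring
  have hNN : N.ofLp ⬝ᵥ N.ofLp = 1 := by
    rw [dotProduct, ← inner_euclidean, real_inner_self_eq_norm_sq, hN1, one_pow]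
  have hL : normSqDf Ωᶜ f x = ∑ α, (-(σ * A v α)) ^ 2 := by
    rw [normSqDf]
    refine Finset.sum_congr rfl fun α _ => ?_
    have h1 : ∀ i, pd Ωᶜ f x α i = -(σ * A v α) * N i := fun i => congrFun (hjet α) i
    simp only [h1, mul_pow]
    rw [← Finset.mul_sum]
    have h2 : ∑ i, N i ^ 2 = 1 := by
      rw [← hNN, dotProduct]
      exact Finset.sum_congr rfl fun i _ => pow_two _
    rw [h2, mul_one]
  have hflux := dotProduct_fluxJ_of_rankOne hNN hjet (jet2 Ωᶜ f x)
  rw [hconN, real_inner_smul_left, inner_euclidean]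
  change _ = σ * (N.ofLp ⬝ᵥ fluxJ (jet1 Ωᶜ f x) (jet2 Ωᶜ f x))
  rw [hflux, ← hL]
  simp only [htr, ← mul_assoc, ← Finset.sum_mul]
  simp only [← pow_two, ← hL]
  ring

/-- If Df = 0 at a boundary point, the field and the density vanish there, whatever value `meanCurv`
has. If Df ≠ 0, the boundary is regular and the flux has been computed. -/
theorem hasFluxChartAt_boundary (hΩ : IsOpen Ω) (hlip : HasLipschitzBoundary Ω)
    (hf : ContDiffOn ℝ 2 f Ωᶜ)
    (hconst : ∀ x ∈ frontier Ω, ∀ y ∈ connectedComponentIn (frontier Ω) x, f y = f x)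
    {x₀ : E n} (hx₀ : x₀ ∈ frontier Ω) :
    HasFluxChartAt Ωᶜ (flux Ωᶜ f)
      (fun x => -(normSqDf Ωᶜ f x / (1 + normSqDf Ωᶜ f x) * meanCurv Ω x)) x₀ := by
  obtain ⟨v, hv, C, h, hh, U, hUo, hxU, hU⟩ := hlip.exists_chart hx₀
  refine ⟨v, hv, C, h, hh, ?_⟩
  filter_upwards [hUo.mem_nhds hxU] with x hx
  refine ⟨hU x hx, fun hxf => ?_⟩
  have h0 := (mem_frontier_iff_height_eq_zero hv hh.continuous hUo hΩ.isClosed_compl hU hx).1 hxf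
  have hxΓ : chartPt v h ((ℝ ∙ v)ᗮ.orthogonalProjectionOnto x) 0 = x := by
    conv_rhs => rw [← chartPt_proj_height (h := h) hv x, h0]
  by_cases hne : fderivWithin ℝ f Ωᶜ x = 0
  · obtain ⟨h1, h2⟩ := normSqDf_eq_zero_of_fderivWithin hne
    exact Or.inl ⟨h2, by simp [h1]⟩
  · refine Or.inr ?_
    have := graphDensity_mul_meanCurv (y₀ := (ℝ ∙ v)ᗮ.orthogonalProjectionOnto x) hΩ
      (uniqueDiffOn_compl hlip) hf hconst hv hh hUo hU (by rwa [hxΓ]) (by rwa [hxΓ])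
    rwa [hxΓ] at this

end BoundaryFlux

/-! ### Spheres: flux charts and area -/

section Spheres

variable {n : ℕ}

lemma mem_frontier_congr {Y : Type*} [TopologicalSpace Y] {A B : Set Y} {x : Y}
    (h : ∀ᶠ y in 𝓝 x, y ∈ A ↔ y ∈ B) : x ∈ frontier A ↔ x ∈ frontier B := by
  rw [frontier_eq_closure_inter_closure, frontier_eq_closure_inter_closure, Set.mem_inter_iff,
    Set.mem_inter_iff]
  simp only [mem_closure_iff_frequently]
  refine and_congr (frequently_congr h) (frequently_congr (h.mono fun y hy => ?_))
  exact not_congr hy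

lemma HasFluxChartAt.congr {K K' : Set (E n)} {X : E n → E n} {Fl Fl' : E n → ℝ} {x₀ : E n}
    (hc : HasFluxChartAt K X Fl x₀) (hK : ∀ᶠ x in 𝓝 x₀, x ∈ K ↔ x ∈ K')
    (hFl : ∀ᶠ x in 𝓝 x₀, x ∈ frontier K → Fl x = Fl' x) : HasFluxChartAt K' X Fl' x₀ := by
  obtain ⟨v, hv, C, h, hh, hev⟩ := hc
  refine ⟨v, hv, C, h, hh, ?_⟩
  filter_upwards [hev, hK.eventually_nhds, hFl] with x h1 h2 h3
  refine ⟨h2.self_of_nhds.symm.trans h1.1, fun hx => ?_⟩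
  rw [← mem_frontier_congr h2] at hx
  rw [← h3 hx]
  exact h1.2 hx

lemma hasGradientAt_sphere {W : Type*} [NormedAddCommGroup W] [InnerProductSpace ℝ W]
    [CompleteSpace W] {r : ℝ} {y : W} (hy : ‖y‖ < r) :
    HasGradientAt (fun y : W => -Real.sqrt (r ^ 2 - ‖y‖ ^ 2))
      ((Real.sqrt (r ^ 2 - ‖y‖ ^ 2))⁻¹ • y) y := by
  have h0 : 0 < r ^ 2 - ‖y‖ ^ 2 := by nlinarith [norm_nonneg y]
  have h1 : HasFDerivAt (fun y : W => r ^ 2 - ‖y‖ ^ 2) (-(2 • innerSL ℝ y)) y :=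
    (hasStrictFDerivAt_norm_sq y).hasFDerivAt.const_sub _
  have h2 := (h1.sqrt h0.ne').neg
  rw [hasGradientAt_iff_hasFDerivAt]
  refine h2.congr_fderiv ?_
  ext w
  simp only [_root_.neg_apply, _root_.smul_apply, innerSL_apply_apply, smul_eq_mul,
    InnerProductSpace.toDual_apply_apply, real_inner_smul_left, nsmul_eq_mul]
  field_simp
  simp

/-- With v pointing inwards at x₀, the ball lies locally above the hemisphere -√(r² - |y|²), whose
conormal is x/s with s the square root. Its length r/s is the area density. -/
lemma hasFluxChartAt_sphere {r : ℝ} (hr : 0 < r) {x₀ : E n} (hx₀ : ‖x₀‖ = r) (X : E n → E n) :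
    HasFluxChartAt (Metric.closedBall 0 r) X (fun x => ⟪x, X x⟫ / r) x₀ := by
  set v : E n := -(r⁻¹ • x₀) with hvdef
  have hv : ‖v‖ = 1 := by
    rw [hvdef, norm_neg, norm_smul, hx₀, Real.norm_of_nonneg (inv_nonneg.2 hr.le),
      inv_mul_cancel₀ hr.ne']
  have hx₀v : x₀ = (-r) • v := by
    rw [hvdef, smul_neg, neg_smul, neg_neg, smul_smul, mul_inv_cancel₀ hr.ne', one_smul]
  set P := (ℝ ∙ v)ᗮ.orthogonalProjectionOnto with hP
  have hPx₀ : P x₀ = 0 := by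
    rw [hx₀v, map_smul, hP,
      Submodule.orthogonalProjectionOnto_orthogonalComplement_singleton_eq_zero, smul_zero]
  set h₀ : (ℝ ∙ v)ᗮ → ℝ := fun y => -Real.sqrt (r ^ 2 - ‖y‖ ^ 2) with hh₀
  have hC₀ : ∀ y : (ℝ ∙ v)ᗮ, ‖y‖ < r → ContDiffAt ℝ 1 h₀ y := fun y hy => by
    have h0 : r ^ 2 - ‖y‖ ^ 2 ≠ 0 := by nlinarith [norm_nonneg y]
    exact ((contDiffAt_const.sub (contDiff_norm_sq ℝ).contDiffAt).sqrt h0).neg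
  -- The hemisphere is only locally Lipschitz; its restriction near 0 is extended to a globally
  -- Lipschitz function.
  obtain ⟨C, t, ht, hCt⟩ := (hC₀ 0 (by simpa using hr)).exists_lipschitzOnWith
  obtain ⟨h, hh, hht⟩ := hCt.extend_real
  refine ⟨v, hv, C, h, hh, ?_⟩
  have hPc : Tendsto P (𝓝 x₀) (𝓝 0) := by
    have := P.continuous.tendsto x₀
    rwa [hPx₀] at this
  have hnear : ∀ᶠ y in 𝓝 (0 : (ℝ ∙ v)ᗮ), h =ᶠ[𝓝 y] h₀ ∧ ‖y‖ < r := by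
    have h1 : h =ᶠ[𝓝 (0 : (ℝ ∙ v)ᗮ)] h₀ := by
      filter_upwards [ht] with y hy using (hht hy).symm
    have h2 : ∀ᶠ y in 𝓝 (0 : (ℝ ∙ v)ᗮ), ‖y‖ < r :=
      continuous_norm.continuousAt.eventually_lt_const (by simpa using hr)
    exact h1.eventually_nhds.and h2
  have hneg : ∀ᶠ x in 𝓝 x₀, ⟪v, x⟫ < 0 := by
    have h1 : ContinuousAt (fun x : E n => ⟪v, x⟫) x₀ := by fun_prop
    refine h1.eventually_lt_const ?_
    change ⟪v, x₀⟫ < 0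
    rw [hx₀v, inner_smul_right, real_inner_self_eq_norm_sq, hv]
    linarith
  filter_upwards [hPc.eventually hnear, hneg] with x hx hxv
  obtain ⟨hxh, hxr⟩ := hx
  have hsq : ‖x‖ ^ 2 = ‖P x‖ ^ 2 + ⟪v, x⟫ ^ 2 := by
    conv_lhs => rw [← coe_proj_add_smul hv x]
    exact norm_coe_add_smul_sq hv _ _
  have h0 : 0 < r ^ 2 - ‖P x‖ ^ 2 := by nlinarith [norm_nonneg (P x)]
  set s := Real.sqrt (r ^ 2 - ‖P x‖ ^ 2) with hs
  have hs0 : 0 < s := Real.sqrt_pos.2 h0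
  have hs2 : s ^ 2 = r ^ 2 - ‖P x‖ ^ 2 := Real.sq_sqrt h0.le
  have hhx : h (P x) = -s := hxh.self_of_nhds
  constructor
  · rw [mem_closedBall_zero_iff, height, ← hP, hhx, ← sq_le_sq₀ (norm_nonneg x) hr.le, hsq,
      sub_neg_eq_add]
    constructor
    · intro h1
      have : (-⟪v, x⟫) ^ 2 ≤ s ^ 2 := by rw [neg_sq]; linarith
      linarith [le_of_sq_le_sq this hs0.le]
    · intro h1
      nlinarith
  · intro hxf
    right
    rw [frontier_closedBall _ hr.ne', mem_sphere_zero_iff_norm] at hxf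
    have hvx : ⟪v, x⟫ = -s := by
      have h1 : (-⟪v, x⟫) ^ 2 = s ^ 2 := by rw [neg_sq, hs2, ← hxf, hsq]; ring
      linarith [(sq_eq_sq₀ (by linarith) hs0.le).1 h1]
    have hg : gradient h (P x) = s⁻¹ • P x :=
      ((hasGradientAt_sphere hxr).congr_of_eventuallyEq hxh).gradient
    have hcon : conormal v h (P x) = s⁻¹ • x := by
      rw [conormal, hg]
      conv_rhs => rw [← coe_proj_add_smul hv x, hvx]
      rw [smul_add, smul_smul, mul_neg, inv_mul_cancel₀ hs0.ne', neg_smul, one_smul,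
        Submodule.coe_smul, sub_eq_add_neg]
    refine ⟨(hC₀ _ hxr).congr_of_eventuallyEq hxh, ?_⟩
    rw [← norm_conormal hv, hcon, norm_smul, hxf, norm_inv, Real.norm_of_nonneg hs0.le,
      real_inner_smul_left]
    field_simp

/-- The divergence theorem for the field x ↦ x, with divergence n and flux density r on the sphere.
Finiteness of the area comes from the integrability it provides for the nonzero constant r. -/
lemma area_sphere_ne_top_and {r : ℝ} (hr : 0 < r) :
    area (Metric.sphere (0 : E n) r) ≠ ⊤ ∧
      area.real (Metric.sphere (0 : E n) r) * r =
        n * (r ^ n * volume.real (Metric.closedBall (0 : E n) 1)) := by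
  have hw : IsWeakDivergence (Metric.closedBall (0 : E n) r) (fun x => x) (fun _ => (n : ℝ)) := by
    intro φ C hφ hφc _
    have h1 := integral_mul_divergence_add_fderiv (X := fun x : E n => x) (C := fun _ => 1)
      (fun j => (LipschitzWith.of_dist_le_mul fun x y => by
        rw [NNReal.coe_one, one_mul, Real.dist_eq, dist_eq_norm]
        exact (PiLp.norm_apply_le (x - y) j))) hφ hφc
    rw [← h1]
    refine integral_congr_ae (.of_forall fun x => ?_)
    have h2 : ∀ j : Fin n, lineDeriv ℝ (fun y : E n => y j) x (e j) = 1 := fun j => by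
      have := ((EuclideanSpace.proj (𝕜 := ℝ) j).hasFDerivAt (x := x)).hasLineDerivAt (e j)
      refine (HasLineDerivAt.lineDeriv this).trans ?_
      exact (e_apply j j).trans (if_pos rfl)
    simp [h2]
  obtain ⟨h1, h2⟩ := divergence_theorem (isCompact_closedBall (0 : E n) r) hw continuousOn_id
    continuousOn_const (Fl := fun x => ⟪x, x⟫ / r) fun x hx => by
      rw [frontier_closedBall _ hr.ne', mem_sphere_zero_iff_norm] at hx
      exact hasFluxChartAt_sphere hr hx _
  rw [frontier_closedBall _ hr.ne'] at h1 h2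
  have h3 : ∀ x ∈ Metric.sphere (0 : E n) r, ⟪x, x⟫ / r = r := fun x hx => by
    rw [mem_sphere_zero_iff_norm] at hx
    rw [real_inner_self_eq_norm_sq, hx]
    field_simp
  have hm : MeasurableSet (Metric.sphere (0 : E n) r) := Metric.isClosed_sphere.measurableSet
  have h4 : IntegrableOn (fun _ : E n => r) (Metric.sphere (0 : E n) r) area :=
    h1.congr_fun h3 hm
  rw [setIntegral_congr_fun hm h3, setIntegral_const, setIntegral_const, smul_eq_mul, smul_eq_mul]
    at h2
  refine ⟨?_, ?_⟩
  · rw [integrableOn_const_iff] at h4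
    rcases h4 with h4 | h4
    · exact absurd h4 (by simpa using hr.ne')
    · exact h4.ne
  · rw [← h2, mul_comm]
    congr 1
    rw [Measure.real, Measure.addHaar_closedBall _ _ hr.le, ENNReal.toReal_mul,
      ENNReal.toReal_ofReal (by positivity), finrank_euclideanSpace_fin]
    rw [Measure.real, Measure.addHaar_closedBall _ _ zero_le_one]
    simp

end Spheres

/-! ### Pointwise estimates for small gradients -/

section Estimates

variable {n m : ℕ} {U : Matrix (Fin m) (Fin n) ℝ} {H : Fin m → Matrix (Fin n) (Fin n) ℝ} {u η : ℝ}

/-- The flux field with respect to the Euclidean metric. -/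
def fluxE (U : Matrix (Fin m) (Fin n) ℝ) (H : Fin m → Matrix (Fin n) (Fin n) ℝ) (j : Fin n) : ℝ :=
  ∑ α, ((H α).trace * U α j - (H α *ᵥ U α) j)

/-- The normal curvature term of `divJ`. -/
def perpJ (U : Matrix (Fin m) (Fin n) ℝ) (H : Fin m → Matrix (Fin n) (Fin n) ℝ) : ℝ :=
  ∑ α, ∑ β, ((H α *ᵥ (invJ U *ᵥ U α)) ⬝ᵥ (invJ U *ᵥ (H β *ᵥ (invJ U *ᵥ U β)))
    - (H α *ᵥ (invJ U *ᵥ U β)) ⬝ᵥ (invJ U *ᵥ (H β *ᵥ (invJ U *ᵥ U α))))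

lemma sPerp_eq_perpJ {D : Set (E n)} {f : E n → E m} {x : E n}
    (hs : ∀ α i j, jet2 D f x α i j = jet2 D f x α j i) :
    sPerp D f x = perpJ (jet1 D f x) (jet2 D f x) := by
  have h1 := scalarCurv_add_sPerp D f x hs
  rw [scalarCurv_eq D f x hs, divJ] at h1
  simp only [Finset.sum_add_distrib] at h1
  exact add_left_cancel h1

open scoped Matrix.Norms.Operator

lemma norm_le_of_abs_le {k l : ℕ} {A : Matrix (Fin k) (Fin l) ℝ} {a : ℝ} (ha : 0 ≤ a)
    (hA : ∀ i j, |A i j| ≤ a) : ‖A‖ ≤ l * a := by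
  lift a to NNReal using ha
  rw [← coe_nnnorm, Matrix.linfty_opNNNorm_def, ← NNReal.coe_natCast, ← NNReal.coe_mul,
    NNReal.coe_le_coe]
  refine Finset.sup_le fun i _ => ?_
  calc ∑ j, ‖A i j‖₊ ≤ ∑ _j : Fin l, a := Finset.sum_le_sum fun j _ => by
        rw [← NNReal.coe_le_coe]; exact hA i j
    _ = l * a := by simp

lemma abs_trace_le (A : Matrix (Fin n) (Fin n) ℝ) : |A.trace| ≤ n * ‖A‖ := by
  have h1 : ∀ i, ‖A i i‖ ≤ ‖A‖ := fun i => by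
    rw [← coe_nnnorm, ← coe_nnnorm, NNReal.coe_le_coe, Matrix.linfty_opNNNorm_def]
    exact (Finset.single_le_sum (f := fun j => ‖A i j‖₊) (fun _ _ => zero_le)
      (Finset.mem_univ i)).trans (Finset.le_sup (f := fun i => ∑ j, ‖A i j‖₊) (Finset.mem_univ i))
  rw [Matrix.trace, ← Real.norm_eq_abs]
  refine (norm_sum_le _ _).trans ((Finset.sum_le_sum fun i _ => h1 i).trans ?_)
  simp

lemma abs_dotProduct_le (w z : Fin n → ℝ) : |w ⬝ᵥ z| ≤ n * (‖w‖ * ‖z‖) := by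
  rw [dotProduct, ← Real.norm_eq_abs]
  refine (norm_sum_le _ _).trans ((Finset.sum_le_sum (g := fun _ => ‖w‖ * ‖z‖) fun i _ => ?_).trans
    ?_)
  · rw [norm_mul]
    exact mul_le_mul (norm_le_pi_norm w i) (norm_le_pi_norm z i) (norm_nonneg _) (norm_nonneg _)
  · simp

/-- From a - 1 = -a UᵀU, the smallness of mn u² lets the factor a on the right be absorbed. -/
lemma norm_invJ_bounds (hu : 0 ≤ u) (hU : ∀ α i, |U α i| ≤ u) (hsm : (m * n : ℝ) * u ^ 2 ≤ 1 / 2) :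
    ‖invJ U‖ ≤ 2 ∧ ‖invJ U - 1‖ ≤ 2 * (m * n) * u ^ 2 := by
  have h1 : invJ U - 1 = -(invJ U * (Uᵀ * U)) := by
    have := invJ_mul U
    rw [metricJ, mul_add, mul_one] at this
    rw [← this]; abel
  have h2 : ‖U‖ ≤ n * u := norm_le_of_abs_le hu hU
  have h3 : ‖Uᵀ‖ ≤ m * u := norm_le_of_abs_le hu fun i j => hU j i
  have h4 : ‖Uᵀ * U‖ ≤ (m * n) * u ^ 2 := by
    refine (Matrix.linfty_opNorm_mul _ _).trans
      ((mul_le_mul h3 h2 (norm_nonneg _) (by positivity)).trans (le_of_eq ?_))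
    ring
  have h5 : ‖invJ U - 1‖ ≤ ‖invJ U‖ * ((m * n) * u ^ 2) := by
    rw [h1, norm_neg]
    exact (Matrix.linfty_opNorm_mul _ _).trans (mul_le_mul_of_nonneg_left h4 (norm_nonneg _))
  have h6 : ‖(1 : Matrix (Fin n) (Fin n) ℝ)‖ ≤ 1 := by
    rw [← Matrix.diagonal_one, Matrix.linfty_opNorm_diagonal]
    exact (pi_norm_le_iff_of_nonneg zero_le_one).2 fun i => by simp
  have h7 : ‖invJ U‖ ≤ ‖invJ U - 1‖ + 1 := by
    have := norm_add_le (invJ U - 1) 1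
    rw [sub_add_cancel] at this
    linarith
  have h8 : ‖invJ U‖ ≤ 2 := by nlinarith [norm_nonneg (invJ U)]
  refine ⟨h8, h5.trans ?_⟩
  rw [mul_assoc 2]
  gcongr

/-- Writing a = 1 + b, each term of the difference contains b = O(u²) besides one factor U and one
factor H, so the error is cubic in u and linear in η. -/
lemma abs_fluxJ_sub_fluxE_le (hu : 0 ≤ u) (hη : 0 ≤ η) (hU : ∀ α i, |U α i| ≤ u)
    (hH : ∀ α i j, |H α i j| ≤ η) (hsm : (m * n : ℝ) * u ^ 2 ≤ 1 / 2) (j : Fin n) :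
    |fluxJ U H j - fluxE U H j| ≤
      m * (3 * (n + 1) * (2 * (m * n) * u ^ 2 * (n * η) * u)) := by
  obtain ⟨ha, hb⟩ := norm_invJ_bounds hu hU hsm
  set a := invJ U with hadef
  set b := a - 1 with hbdef
  have hab : a = 1 + b := by rw [hbdef]; abel
  have hHn : ∀ α, ‖H α‖ ≤ n * η := fun α => norm_le_of_abs_le hη (hH α)
  have hUn : ∀ α, ‖U α‖ ≤ u := fun α => (pi_norm_le_iff_of_nonneg hu).2 (hU α)
  set B := 2 * (m * n : ℝ) * u ^ 2 with hB
  have hB0 : 0 ≤ B := by positivity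
  have hmv : ∀ (A : Matrix (Fin n) (Fin n) ℝ) (w : Fin n → ℝ) {c d : ℝ}, 0 ≤ c → ‖A‖ ≤ c →
      ‖w‖ ≤ d → ‖A *ᵥ w‖ ≤ c * d := fun A w c d hc hA hw =>
    (Matrix.linfty_opNorm_mulVec A w).trans (mul_le_mul hA hw (norm_nonneg _) hc)
  rw [fluxJ, fluxE, ← Finset.sum_sub_distrib]
  refine (Finset.abs_sum_le_sum_abs _ _).trans ((Finset.sum_le_sum
    (g := fun _ => 3 * (n + 1) * (B * (n * η) * u)) fun α _ => ?_).trans (by simp))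
  have e1 : (a * H α).trace * (a *ᵥ U α) j - (a *ᵥ (H α *ᵥ (a *ᵥ U α))) j -
      ((H α).trace * U α j - (H α *ᵥ U α) j) =
      (b * H α).trace * (a *ᵥ U α) j + (H α).trace * (b *ᵥ U α) j
        - (b *ᵥ (H α *ᵥ (a *ᵥ U α))) j - (H α *ᵥ (b *ᵥ U α)) j := by
    have h1 : (a * H α).trace = (H α).trace + (b * H α).trace := by
      rw [hab, add_mul, one_mul, Matrix.trace_add]
    have h2 : ∀ w, (a *ᵥ w) = w + b *ᵥ w := fun w => by
      rw [hab, Matrix.add_mulVec, Matrix.one_mulVec]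
    rw [h1, h2 (H α *ᵥ _)]
    simp only [h2 (U α), Matrix.mulVec_add, Pi.add_apply]
    ring
  have haU : ‖a *ᵥ U α‖ ≤ 2 * u := hmv a _ (by norm_num) ha (hUn α)
  have hbU : ‖b *ᵥ U α‖ ≤ B * u := hmv b _ hB0 hb (hUn α)
  have t1 : |(b * H α).trace * (a *ᵥ U α) j| ≤ n * (B * (n * η)) * (2 * u) := by
    rw [abs_mul]
    refine mul_le_mul ((abs_trace_le _).trans ?_) ((norm_le_pi_norm _ j).trans haU) (abs_nonneg _)
      (by positivity)
    gcongr
    exact (Matrix.linfty_opNorm_mul _ _).trans (mul_le_mul hb (hHn α) (norm_nonneg _) hB0)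
  have t2 : |(H α).trace * (b *ᵥ U α) j| ≤ n * (n * η) * (B * u) := by
    rw [abs_mul]
    refine mul_le_mul ((abs_trace_le _).trans ?_) ((norm_le_pi_norm _ j).trans hbU) (abs_nonneg _)
      (by positivity)
    gcongr
    exact hHn α
  have t3 : |(b *ᵥ (H α *ᵥ (a *ᵥ U α))) j| ≤ B * (n * η * (2 * u)) :=
    (norm_le_pi_norm _ j).trans (hmv b _ hB0 hb (hmv _ _ (by positivity) (hHn α) haU))
  have t4 : |(H α *ᵥ (b *ᵥ U α)) j| ≤ n * η * (B * u) :=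
    (norm_le_pi_norm _ j).trans (hmv _ _ (by positivity) (hHn α) hbU)
  rw [e1]
  rw [abs_le] at t1 t2 t3 t4 ⊢
  constructor <;> nlinarith [t1.1, t1.2, t2.1, t2.2, t3.1, t3.2, t4.1, t4.2]

lemma abs_perpJ_le (hu : 0 ≤ u) (hη : 0 ≤ η) (hU : ∀ α i, |U α i| ≤ u)
    (hH : ∀ α i j, |H α i j| ≤ η) (hsm : (m * n : ℝ) * u ^ 2 ≤ 1 / 2) :
    |perpJ U H| ≤ m * (m * (2 * (n * ((n * η * (2 * u)) * (2 * (n * η * (2 * u))))))) := by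
  obtain ⟨ha, -⟩ := norm_invJ_bounds hu hU hsm
  set a := invJ U with hadef
  have hHn : ∀ α, ‖H α‖ ≤ n * η := fun α => norm_le_of_abs_le hη (hH α)
  have hUn : ∀ α, ‖U α‖ ≤ u := fun α => (pi_norm_le_iff_of_nonneg hu).2 (hU α)
  have hmv : ∀ (A : Matrix (Fin n) (Fin n) ℝ) (w : Fin n → ℝ) {c d : ℝ}, 0 ≤ c → ‖A‖ ≤ c →
      ‖w‖ ≤ d → ‖A *ᵥ w‖ ≤ c * d := fun A w c d hc hA hw =>
    (Matrix.linfty_opNorm_mulVec A w).trans (mul_le_mul hA hw (norm_nonneg _) hc)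
  have hw : ∀ α β, ‖H α *ᵥ (a *ᵥ U β)‖ ≤ n * η * (2 * u) := fun α β =>
    hmv _ _ (by positivity) (hHn α) (hmv _ _ (by norm_num) ha (hUn β))
  have ht : ∀ α β γ δ, |(H α *ᵥ (a *ᵥ U β)) ⬝ᵥ (a *ᵥ (H γ *ᵥ (a *ᵥ U δ)))| ≤
      n * ((n * η * (2 * u)) * (2 * (n * η * (2 * u)))) := fun α β γ δ =>
    (abs_dotProduct_le _ _).trans (mul_le_mul_of_nonneg_left (mul_le_mul (hw α β)
      (hmv _ _ (by norm_num) ha (hw γ δ)) (norm_nonneg _) (by positivity)) (by positivity))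
  rw [perpJ]
  refine (Finset.abs_sum_le_sum_abs _ _).trans ((Finset.sum_le_sum
    (g := fun _ => m * (2 * (n * ((n * η * (2 * u)) * (2 * (n * η * (2 * u)))))))
    fun α _ => ?_).trans (by simp))
  refine (Finset.abs_sum_le_sum_abs _ _).trans ((Finset.sum_le_sum
    (g := fun _ => 2 * (n * ((n * η * (2 * u)) * (2 * (n * η * (2 * u))))))
    fun β _ => ?_).trans (by simp))
  refine (abs_sub _ _).trans ?_
  linarith [ht α α β β, ht α β β α]

end Estimates

/-! ### Decay at infinity and integrability of the divergence -/

section Decay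

variable {n m : ℕ} {Ω : Set (E n)} {f : E n → E m}

/-- With t = |x|^(-p/2), first derivatives are O(t) and second ones O(t/|x|). So the flux error u³η
is O(t⁴/|x|), the normal curvature term u²η² is O(t⁴/|x|²), and t⁴ = |x|^(-2p). -/
lemma IsAsymptoticallyFlat.exists_decay (hn : 2 ≤ n) (hf : IsAsymptoticallyFlat Ω f) :
    ∃ p : ℝ, ((n : ℝ) - 2) / 2 < p ∧ ∃ C R : ℝ, 0 ≤ C ∧ 0 < R ∧ ∀ x : E n, R ≤ ‖x‖ →
      |perpJ (jet1 Ωᶜ f x) (jet2 Ωᶜ f x)| ≤ C * ‖x‖ ^ (-(2 * p + 2)) ∧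
      ∀ j, |fluxJ (jet1 Ωᶜ f x) (jet2 Ωᶜ f x) j - fluxE (jet1 Ωᶜ f x) (jet2 Ωᶜ f x) j| ≤
        C * ‖x‖ ^ (-(2 * p + 1)) := by
  obtain ⟨p, hp, h1, h2⟩ := hf.decay
  have hn' : (2 : ℝ) ≤ n := by exact_mod_cast hn
  -- Here n ≥ 2 matters: p > 0 makes Df tend to zero, which gives the smallness required by the
  -- estimates.
  have hp0 : 0 < p := by linarith
  have h1' : (fun x α i => pd Ωᶜ f x α i) =O[Bornology.cobounded (E n)]
      fun x => ‖x‖ ^ (-p / 2) := isBigO_pi.2 fun α => isBigO_pi.2 fun i => h1 α i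
  have h2' : (fun x α i j => pd2 Ωᶜ f x α i j) =O[Bornology.cobounded (E n)]
      fun x => ‖x‖ ^ (-p / 2 - 1) :=
    isBigO_pi.2 fun α => isBigO_pi.2 fun i => isBigO_pi.2 fun j => h2 α i j
  obtain ⟨C₁, hC₁, hb₁⟩ := h1'.exists_pos
  obtain ⟨C₂, hC₂, hb₂⟩ := h2'.exists_pos
  have ht : Tendsto (fun x : E n => (m * n : ℝ) * (C₁ * ‖x‖ ^ (-(p / 2))) ^ 2)
      (Bornology.cobounded (E n)) (𝓝 ((m * n : ℝ) * (C₁ * 0) ^ 2)) :=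
    ((((tendsto_rpow_neg_atTop (half_pos hp0)).comp tendsto_norm_cobounded_atTop).const_mul
      C₁).pow 2).const_mul _
  rw [mul_zero, zero_pow two_ne_zero, mul_zero] at ht
  have hev := (hb₁.bound.and hb₂.bound).and
    ((ht.eventually (gt_mem_nhds (show (0 : ℝ) < 1 / 2 by norm_num))))
  obtain ⟨R, -, hR⟩ := (hasBasis_cobounded_norm (E := E n)).eventually_iff.1 hev
  set M₁ : ℝ := m * (m * (2 * (n * ((n * C₂ * (2 * C₁)) * (2 * (n * C₂ * (2 * C₁)))))))
  set M₂ : ℝ := m * (3 * (n + 1) * (2 * (m * n) * C₁ ^ 2 * (n * C₂) * C₁))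
  have hM₁ : 0 ≤ M₁ := by positivity
  have hM₂ : 0 ≤ M₂ := by positivity
  refine ⟨p, hp, M₁ + M₂, max R 1, by positivity, by positivity, fun x hx => ?_⟩
  have hx1 : 0 < ‖x‖ := lt_of_lt_of_le one_pos ((le_max_right _ _).trans hx)
  obtain ⟨⟨hb1, hb2⟩, hsm⟩ := hR ((le_max_left _ _).trans hx)
  set t := ‖x‖ ^ (-p / 2) with htdef
  have ht0 : 0 < t := Real.rpow_pos_of_pos hx1 _
  have ht4 : t ^ 4 = ‖x‖ ^ (-(2 * p)) := by
    rw [htdef, ← Real.rpow_natCast, ← Real.rpow_mul hx1.le]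
    congr 1
    push_cast
    ring
  have hη : ‖x‖ ^ (-p / 2 - 1) = t / ‖x‖ := by rw [Real.rpow_sub_one hx1.ne']
  rw [Real.norm_of_nonneg ht0.le] at hb1
  rw [hη, Real.norm_of_nonneg (by positivity)] at hb2
  rw [← neg_div, ← htdef] at hsm
  have hU : ∀ α i, |jet1 Ωᶜ f x α i| ≤ C₁ * t := fun α i =>
    ((norm_le_pi_norm (pd Ωᶜ f x α) i).trans (norm_le_pi_norm (pd Ωᶜ f x) α)).trans hb1
  have hH : ∀ α i j, |jet2 Ωᶜ f x α i j| ≤ C₂ * (t / ‖x‖) := fun α i j =>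
    ((norm_le_pi_norm (pd2 Ωᶜ f x α i) j).trans ((norm_le_pi_norm (pd2 Ωᶜ f x α) i).trans
      (norm_le_pi_norm (pd2 Ωᶜ f x) α))).trans hb2
  constructor
  · refine (abs_perpJ_le (by positivity) (by positivity) hU hH hsm.le).trans ?_
    have e1 : ‖x‖ ^ (-(2 * p + 2)) = t ^ 4 / ‖x‖ ^ 2 := by
      rw [ht4, neg_add, ← sub_eq_add_neg, Real.rpow_sub hx1, Real.rpow_two]
    calc _ = M₁ * (t ^ 4 / ‖x‖ ^ 2) := by simp only [M₁]; ring
      _ ≤ _ := by rw [e1]; gcongr; linarith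
  · intro j
    refine (abs_fluxJ_sub_fluxE_le (by positivity) (by positivity) hU hH hsm.le j).trans ?_
    have e1 : ‖x‖ ^ (-(2 * p + 1)) = t ^ 4 / ‖x‖ := by
      rw [ht4, neg_add, ← sub_eq_add_neg, Real.rpow_sub_one hx1.ne']
    calc _ = M₂ * (t ^ 4 / ‖x‖) := by simp only [M₂]; ring
      _ ≤ _ := by rw [e1]; gcongr; linarith

/-- Near Ω the function is continuous on a compact set. Far away S is integrable by hypothesis, and
S^⊥ has decay exponent 2p + 2 > n. -/
lemma IsAsymptoticallyFlat.integrableOn_divJ (hn : 2 ≤ n) (hΩ : IsOpen Ω)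
    (hlip : HasLipschitzBoundary Ω) (hf : IsAsymptoticallyFlat Ω f) :
    IntegrableOn (fun x => divJ (jet1 Ωᶜ f x) (jet2 Ωᶜ f x)) Ωᶜ := by
  have hK := uniqueDiffOn_compl hlip
  have hm : MeasurableSet Ωᶜ := hΩ.measurableSet.compl
  have hsy : ∀ x ∈ Ωᶜ, ∀ α i j, jet2 Ωᶜ f x α i j = jet2 Ωᶜ f x α j i := fun x hx =>
    jet2_symm hK hf.contDiffOn hx (compl_subset_closure_interior hlip hx)
  have hs := continuousOn_divJ hK hf.contDiffOn
  obtain ⟨p, hp, C, R, hC, hR, hb⟩ := hf.exists_decay hn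
  have hfar : IntegrableOn (fun x => perpJ (jet1 Ωᶜ f x) (jet2 Ωᶜ f x))
      (Ωᶜ ∩ (Metric.closedBall 0 (max R 1))ᶜ) := by
    have hm' : MeasurableSet (Ωᶜ ∩ (Metric.closedBall (0 : E n) (max R 1))ᶜ) :=
      hm.inter Metric.isClosed_closedBall.measurableSet.compl
    have hdom : Integrable fun x : E n => C * 2 ^ (2 * p + 2) * (1 + ‖x‖) ^ (-(2 * p + 2)) := by
      refine (integrable_one_add_norm ?_).const_mul _
      rw [finrank_euclideanSpace_fin]
      linarith
    refine hdom.integrableOn.mono' ?_ ?_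
    · have h1 : AEStronglyMeasurable (fun x => divJ (jet1 Ωᶜ f x) (jet2 Ωᶜ f x) -
          scalarCurv Ωᶜ f x) (volume.restrict Ωᶜ) :=
        (hs.aestronglyMeasurable hm).sub hf.integrable_scalarCurv.aestronglyMeasurable
      refine (h1.mono_measure (Measure.restrict_mono Set.inter_subset_left le_rfl)).congr ?_
      filter_upwards [ae_restrict_mem hm'] with x hx
      rw [← scalarCurv_add_sPerp _ _ _ (hsy x hx.1), add_sub_cancel_left,
        sPerp_eq_perpJ (hsy x hx.1)]
    · filter_upwards [ae_restrict_mem hm'] with x hx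
      have hx2 : max R 1 < ‖x‖ := by
        have := hx.2
        rwa [Set.mem_compl_iff, mem_closedBall_zero_iff, not_le] at this
      have hx1 : 1 < ‖x‖ := (le_max_right _ _).trans_lt hx2
      refine ((hb x ((le_max_left _ _).trans hx2.le)).1).trans ?_
      rw [mul_assoc]
      refine mul_le_mul_of_nonneg_left ?_ hC
      have hn' : (2 : ℝ) ≤ n := by exact_mod_cast hn
      rw [Real.rpow_neg (by linarith), Real.rpow_neg (by linarith), ← div_eq_mul_inv,
        le_div_iff₀ (by positivity), inv_mul_le_iff₀ (by positivity),
        ← Real.mul_rpow (by linarith) (by norm_num)]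
      exact Real.rpow_le_rpow (by linarith) (by linarith) (by linarith)
  have h1 : IntegrableOn (fun x => divJ (jet1 Ωᶜ f x) (jet2 Ωᶜ f x))
      (Ωᶜ ∩ Metric.closedBall 0 (max R 1)) :=
    (hs.mono Set.inter_subset_left).integrableOn_compact
      ((isCompact_closedBall 0 _).inter_left hΩ.isClosed_compl)
  have h2 : IntegrableOn (fun x => divJ (jet1 Ωᶜ f x) (jet2 Ωᶜ f x))
      (Ωᶜ ∩ (Metric.closedBall 0 (max R 1))ᶜ) := by
    have h3 := (hf.integrable_scalarCurv.mono_set (Set.inter_subset_left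
      (t := (Metric.closedBall (0 : E n) (max R 1))ᶜ))).add hfar
    refine h3.congr_fun (fun x hx => ?_)
      (hm.inter Metric.isClosed_closedBall.measurableSet.compl)
    rw [← scalarCurv_add_sPerp _ _ _ (hsy x hx.1), sPerp_eq_perpJ (hsy x hx.1)]
    rfl
  have := h1.union h2
  rwa [← Set.inter_union_distrib_left, Set.union_compl_self, Set.inter_univ] at this

end Decay

/-! ### The ADM integrand -/

section MassIntegrand

variable {n m : ℕ} {K : Set (E n)} {f : E n → E m} {x : E n}

lemma hasFDerivAt_jet1_apply (hK : UniqueDiffOn ℝ K) (hf : ContDiffOn ℝ 2 f K) (hx : K ∈ 𝓝 x)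
    (α : Fin m) (i : Fin n) : ∃ L : E n →L[ℝ] ℝ, HasFDerivAt (fun y => jet1 K f y α i) L x ∧
      ∀ k, L (e k) = jet2 K f x α k i := by
  have h1 : ContDiffOn ℝ 1 (fderivWithin ℝ f K) K := hf.fderivWithin hK (by norm_num)
  have h2 := ((h1.differentiableOn (by simp)) x (mem_of_mem_nhds hx)).hasFDerivWithinAt.hasFDerivAt
    hx
  exact ⟨_, (EuclideanSpace.proj (𝕜 := ℝ) α).hasFDerivAt.comp x
    (h2.clm_apply (hasFDerivAt_const (e i : E n) x)), fun k => by simp [jet2, pd2, hess]⟩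

lemma dMetric_metric (hK : UniqueDiffOn ℝ K) (hf : ContDiffOn ℝ 2 f K) (hx : K ∈ 𝓝 x)
    (i j k : Fin n) : dMetric (metric K f) i j k x =
      ∑ α, (jet2 K f x α k i * jet1 K f x α j + jet1 K f x α i * jet2 K f x α k j) := by
  choose L hL hLe using hasFDerivAt_jet1_apply hK hf hx
  have h1 : (fun y => metric K f y i j) = fun y => (1 : Matrix (Fin n) (Fin n) ℝ) i j +
      ∑ α, jet1 K f y α i * jet1 K f y α j := by
    ext1 y
    rw [metric_eq, metricJ_apply]
  have h2 := (HasFDerivAt.fun_sum (u := Finset.univ) fun α _ =>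
    (hL α i).mul (hL α j)).const_add ((1 : Matrix (Fin n) (Fin n) ℝ) i j)
  rw [dMetric, h1]
  refine (congrArg (fun B : E n →L[ℝ] ℝ => B (e k)) h2.fderiv).trans ?_
  simp only [_root_.sum_apply]
  refine Finset.sum_congr rfl fun α _ => ?_
  simp only [_root_.add_apply, _root_.smul_apply, smul_eq_mul, hLe]
  ring

/-- In ∂_i g_ij - ∂_j g_ii = ∑_α (f_ii f_j + f_i f_ij - 2 f_i f_ij), the mixed terms combine by
symmetry into the Euclidean flux. -/
lemma mass_integrand_eq (hK : UniqueDiffOn ℝ K) (hf : ContDiffOn ℝ 2 f K) (hx : K ∈ 𝓝 x)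
    (r : ℝ) : ∑ i, ∑ j, (dMetric (metric K f) i j i x - dMetric (metric K f) i i j x) * (x j / r) =
      ∑ j, fluxE (jet1 K f x) (jet2 K f x) j * (x j / r) := by
  have hs := jet2_symm hK hf (mem_of_mem_nhds hx)
    (subset_closure (mem_interior_iff_mem_nhds.2 hx))
  rw [Finset.sum_comm]
  refine Finset.sum_congr rfl fun j _ => ?_
  rw [← Finset.sum_mul]
  congr 1
  simp only [dMetric_metric hK hf hx, fluxE, ← Finset.sum_sub_distrib]
  rw [Finset.sum_comm]
  refine Finset.sum_congr rfl fun α _ => ?_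
  rw [Matrix.trace, Finset.sum_mul, Matrix.mulVec, dotProduct, ← Finset.sum_sub_distrib]
  refine Finset.sum_congr rfl fun i _ => ?_
  rw [hs α i j, Matrix.diag_apply]
  ring

lemma continuousOn_fluxE (hK : UniqueDiffOn ℝ K) (hf : ContDiffOn ℝ 2 f K) (j : Fin n) :
    ContinuousOn (fun x => fluxE (jet1 K f x) (jet2 K f x) j) K := by
  have h1 := continuousOn_jet1 hK hf
  have h2 := continuousOn_jet2 hK hf
  have hU : ∀ α i, ContinuousOn (fun x => jet1 K f x α i) K := fun α i =>
    continuousOn_pi.1 (continuousOn_pi.1 h1 α) i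
  have hH : ∀ α i j, ContinuousOn (fun x => jet2 K f x α i j) K := fun α i j =>
    continuousOn_pi.1 (continuousOn_pi.1 (continuousOn_pi.1 h2 α) i) j
  simp only [fluxE, Matrix.trace, Matrix.diag_apply, Matrix.mulVec, dotProduct]
  exact continuousOn_finsetSum _ fun α _ => ((continuousOn_finsetSum _ fun i _ =>
    hH α i i).mul (hU α j)).sub (continuousOn_finsetSum _ fun i _ => (hH α j i).mul (hU α i))

end MassIntegrand

/-! ### Integration over the domain and passage to infinity -/

section Mass

variable {n m : ℕ} {Ω : Set (E n)} {f : E n → E m}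

lemma frontier_compl_inter_closedBall {R r : ℝ} (hR : Ω ⊆ Metric.closedBall 0 R)
    (hr : R < r) (hr0 : 0 < r) :
    frontier (Ωᶜ ∩ Metric.closedBall 0 r) = frontier Ω ∪ Metric.sphere 0 r := by
  have hfr : frontier Ω ⊆ Metric.closedBall 0 R := frontier_subset_closure.trans
    (closure_minimal hR Metric.isClosed_closedBall)
  ext x
  rw [Set.mem_union]
  by_cases hx : ‖x‖ < r
  · have h1 : ∀ᶠ y in 𝓝 x, y ∈ Ωᶜ ∩ Metric.closedBall 0 r ↔ y ∈ Ωᶜ := by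
      filter_upwards [continuous_norm.continuousAt.eventually_lt_const hx] with y hy
      exact and_iff_left (mem_closedBall_zero_iff.2 hy.le)
    rw [mem_frontier_congr h1, frontier_compl]
    refine (or_iff_left fun h => ?_).symm
    exact hx.ne (mem_sphere_zero_iff_norm.1 h)
  · have h1 : ∀ᶠ y in 𝓝 x, y ∈ Ωᶜ ∩ Metric.closedBall 0 r ↔ y ∈ Metric.closedBall 0 r := by
      filter_upwards [continuous_norm.continuousAt.eventually_const_lt
        (hr.trans_le (not_lt.1 hx))] with y hy
      exact and_iff_right fun h => (not_lt.2 (mem_closedBall_zero_iff.1 (hR h))) hy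
    rw [mem_frontier_congr h1, frontier_closedBall _ hr0.ne']
    refine (or_iff_right fun h => ?_).symm
    exact absurd (hr.trans_le (not_lt.1 hx)) (not_lt.2 (mem_closedBall_zero_iff.1 (hfr h)))

/-- The divergence theorem for the flux field on the part of the domain in a large ball. -/
theorem integral_sphere_flux (hΩ : IsOpen Ω) (hlip : HasLipschitzBoundary Ω)
    (hf : ContDiffOn ℝ 2 f Ωᶜ)
    (hconst : ∀ x ∈ frontier Ω, ∀ y ∈ connectedComponentIn (frontier Ω) x, f y = f x)
    {R r : ℝ} (hR : Ω ⊆ Metric.closedBall 0 R) (hr : R < r) (hr0 : 0 < r) :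
    IntegrableOn (fun x => normSqDf Ωᶜ f x / (1 + normSqDf Ωᶜ f x) * meanCurv Ω x)
      (frontier Ω) area ∧
    IntegrableOn (fun x => ⟪x, flux Ωᶜ f x⟫ / r) (Metric.sphere 0 r) area ∧
    ∫ x in Metric.sphere 0 r, ⟪x, flux Ωᶜ f x⟫ / r ∂area =
      (∫ x in Ωᶜ ∩ Metric.closedBall 0 r, divJ (jet1 Ωᶜ f x) (jet2 Ωᶜ f x)) +
        ∫ x in frontier Ω, normSqDf Ωᶜ f x / (1 + normSqDf Ωᶜ f x) * meanCurv Ω x ∂area := by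
  classical
  have hK := uniqueDiffOn_compl hlip
  have hfr : frontier Ω ⊆ Metric.closedBall 0 R := frontier_subset_closure.trans
    (closure_minimal hR Metric.isClosed_closedBall)
  set b : E n → ℝ := fun x => normSqDf Ωᶜ f x / (1 + normSqDf Ωᶜ f x) * meanCurv Ω x
  -- The outward normal of the truncated domain points into Ω along its inner boundary, which
  -- accounts for the sign of b.
  set Fl : E n → ℝ := fun x => if ‖x‖ < r then -b x else ⟪x, flux Ωᶜ f x⟫ / r with hFl
  have hwd : IsWeakDivergence (Ωᶜ ∩ Metric.closedBall 0 r) (flux Ωᶜ f)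
      (fun x => divJ (jet1 Ωᶜ f x) (jet2 Ωᶜ f x)) := fun φ C hφ hφc hφK =>
    weak_divergence (hf.mono interior_subset) hφ hφc
      (hφK.trans (interior_mono Set.inter_subset_left))
  have hfrK := frontier_compl_inter_closedBall hR hr hr0
  obtain ⟨h1, h2⟩ := divergence_theorem (Fl := Fl)
    ((isCompact_closedBall (0 : E n) r).inter_left hΩ.isClosed_compl) hwd
    ((continuousOn_flux hK hf).mono Set.inter_subset_left)
    ((continuousOn_divJ hK hf).mono Set.inter_subset_left) (fun x hx => by
      rw [hfrK] at hx
      rcases hx with hx | hx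
      · have hxr : ‖x‖ < r := (mem_closedBall_zero_iff.1 (hfr hx)).trans_lt hr
        have hnear := continuous_norm.continuousAt.eventually_lt_const hxr
        refine (hasFluxChartAt_boundary hΩ hlip hf hconst hx).congr ?_ ?_
        · filter_upwards [hnear] with y hy
          exact (and_iff_left (mem_closedBall_zero_iff.2 hy.le)).symm
        · filter_upwards [hnear] with y hy _
          exact (if_pos hy).symm
      · have hxr : ‖x‖ = r := mem_sphere_zero_iff_norm.1 hx
        refine (hasFluxChartAt_sphere hr0 hxr (flux Ωᶜ f)).congr ?_ ?_
        · filter_upwards [continuous_norm.continuousAt.eventually_const_lt (hr.trans_eq hxr.symm)]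
            with y hy
          exact (and_iff_right fun h => (not_lt.2 (mem_closedBall_zero_iff.1 (hR h))) hy).symm
        · refine .of_forall fun y hy => ?_
          rw [frontier_closedBall _ hr0.ne', mem_sphere_zero_iff_norm] at hy
          rw [hFl]
          exact (if_neg hy.not_lt).symm)
  rw [hfrK] at h1 h2
  have hmf : MeasurableSet (frontier Ω) := isClosed_frontier.measurableSet
  have hms : MeasurableSet (Metric.sphere (0 : E n) r) := Metric.isClosed_sphere.measurableSet
  have e1 : ∀ x ∈ frontier Ω, Fl x = -b x := fun x hx =>
    if_pos ((mem_closedBall_zero_iff.1 (hfr hx)).trans_lt hr)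
  have e2 : ∀ x ∈ Metric.sphere (0 : E n) r, Fl x = ⟪x, flux Ωᶜ f x⟫ / r := fun x hx =>
    if_neg (mem_sphere_zero_iff_norm.1 hx).not_lt
  have hdis : Disjoint (frontier Ω) (Metric.sphere 0 r) := Set.disjoint_left.2 fun x hx hx' =>
    ((mem_closedBall_zero_iff.1 (hfr hx)).trans_lt hr).ne (mem_sphere_zero_iff_norm.1 hx')
  have i1 := h1.mono_set Set.subset_union_left
  have i2 := h1.mono_set Set.subset_union_right
  have i3 : IntegrableOn b (frontier Ω) area := by
    have := (i1.congr_fun e1 hmf).neg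
    refine this.congr_fun (fun x _ => ?_) hmf
    simp
  refine ⟨i3, i2.congr_fun e2 hms, ?_⟩
  rw [setIntegral_union hdis hms i1 i2, setIntegral_congr_fun hmf e1,
    setIntegral_congr_fun hms e2, integral_neg] at h2
  rw [h2]
  ring

/-- The error d is O(r^(-2p-1)) on the sphere of radius r, whose area is a multiple of r^(n-1); the
product has exponent n - 2 - 2p < 0. -/
lemma tendsto_integral_sphere_sub (hn : 2 ≤ n) (hlip : HasLipschitzBoundary Ω)
    (hf : IsAsymptoticallyFlat Ω f) {R : ℝ} (hR : Ω ⊆ Metric.closedBall 0 R) :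
    ∃ d : ℝ → E n → ℝ, (∀ᶠ r in atTop, IntegrableOn (d r) (Metric.sphere 0 r) area ∧
      ∀ x ∈ Metric.sphere (0 : E n) r, ∑ i, ∑ j, (dMetric (metric Ωᶜ f) i j i x -
        dMetric (metric Ωᶜ f) i i j x) * (x j / r) = ⟪x, flux Ωᶜ f x⟫ / r + d r x) ∧
      Tendsto (fun r => ∫ x in Metric.sphere 0 r, d r x ∂area) atTop (𝓝 0) := by
  have hK := uniqueDiffOn_compl hlip
  obtain ⟨p, hp, C, R₁, hC, hR₁, hb⟩ := hf.exists_decay hn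
  set d : ℝ → E n → ℝ := fun r x => ∑ j, (fluxE (jet1 Ωᶜ f x) (jet2 Ωᶜ f x) j -
    fluxJ (jet1 Ωᶜ f x) (jet2 Ωᶜ f x) j) * (x j / r) with hd
  have hnhds : ∀ r, R < r → ∀ x ∈ Metric.sphere (0 : E n) r, Ωᶜ ∈ 𝓝 x := fun r hr x hx => by
    rw [mem_sphere_zero_iff_norm] at hx
    filter_upwards [continuous_norm.continuousAt.eventually_const_lt (hr.trans_eq hx.symm)]
      with y hy
    exact fun h => (not_lt.2 (mem_closedBall_zero_iff.1 (hR h))) hy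
  have hdle : ∀ r, R₁ ≤ r → ∀ x ∈ Metric.sphere (0 : E n) r,
      ‖d r x‖ ≤ n * (C * r ^ (-(2 * p + 1))) := fun r hr x hx => by
    rw [mem_sphere_zero_iff_norm] at hx
    have hr0 : 0 < r := hR₁.trans_le hr
    refine (norm_sum_le _ _).trans ((Finset.sum_le_sum (g := fun _ => C * r ^ (-(2 * p + 1)))
      fun j _ => ?_).trans (by simp))
    have h1 := (hb x (by rwa [hx])).2 j
    rw [hx, abs_sub_comm] at h1
    rw [norm_mul, ← mul_one (C * _)]
    refine mul_le_mul h1 ?_ (norm_nonneg _) (by positivity)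
    rw [norm_div, Real.norm_of_nonneg hr0.le, div_le_one hr0, ← hx]
    exact PiLp.norm_apply_le x j
  refine ⟨d, ?_, ?_⟩
  · filter_upwards [eventually_gt_atTop R, eventually_ge_atTop R₁] with r hr hr₁
    have hr0 : 0 < r := hR₁.trans_le hr₁
    have hsK : Metric.sphere (0 : E n) r ⊆ Ωᶜ := fun x hx => mem_of_mem_nhds (hnhds r hr x hx)
    constructor
    · have hX := continuousOn_flux hK hf.contDiffOn
      have hcont : ContinuousOn (d r) (Metric.sphere 0 r) := by
        refine ContinuousOn.mono ?_ hsK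
        refine continuousOn_finsetSum _ fun j _ => ContinuousOn.mul
          ((continuousOn_fluxE hK hf.contDiffOn j).sub ?_) (by fun_prop)
        exact (EuclideanSpace.proj (𝕜 := ℝ) j).continuous.comp_continuousOn hX
      refine IntegrableOn.of_bound (area_sphere_ne_top_and hr0).1.lt_top
        (hcont.aestronglyMeasurable Metric.isClosed_sphere.measurableSet)
        (n * (C * r ^ (-(2 * p + 1)))) ?_
      exact (ae_restrict_iff' Metric.isClosed_sphere.measurableSet).2 (.of_forall (hdle r hr₁))
    · intro x hx
      rw [mass_integrand_eq hK hf.contDiffOn (hnhds r hr x hx), inner_euclidean, Finset.sum_div,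
        ← Finset.sum_add_distrib]
      refine Finset.sum_congr rfl fun j _ => ?_
      change _ = x j * fluxJ (jet1 Ωᶜ f x) (jet2 Ωᶜ f x) j / r + _
      ring
  · set A := n * volume.real (Metric.closedBall (0 : E n) 1) with hA
    have hlim : Tendsto (fun r : ℝ => n * C * A * r ^ (-(2 * p + 2 - n))) atTop (𝓝 0) := by
      have := (tendsto_rpow_neg_atTop (show 0 < 2 * p + 2 - n by linarith)).const_mul (n * C * A)
      rwa [mul_zero] at this
    refine squeeze_zero_norm' ?_ hlim
    filter_upwards [eventually_ge_atTop R₁] with r hr₁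
    have hr0 : 0 < r := hR₁.trans_le hr₁
    obtain ⟨h1, h2⟩ := area_sphere_ne_top_and (n := n) hr0
    refine (norm_setIntegral_le_of_norm_le_const h1.lt_top (hdle r hr₁)).trans (le_of_eq ?_)
    have h3 : area.real (Metric.sphere (0 : E n) r) = A * r ^ n / r := by
      rw [eq_div_iff hr0.ne', h2, hA]; ring
    have h4 : r ^ (-(2 * p + 2 - n)) = r ^ (-(2 * p + 1)) * (r ^ n / r) := by
      rw [← Real.rpow_natCast, ← Real.rpow_sub_one hr0.ne', ← Real.rpow_add hr0]
      congr 1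
      ring
    rw [h3, h4]
    ring

lemma detMetric_pos (D : Set (E n)) (x : E n) : 0 < detMetric D f x := by
  rw [detMetric, metric_eq]; exact det_metricJ_pos _

lemma volumeM_density (hlip : HasLipschitzBoundary Ω) (hΩ : IsOpen Ω)
    (hf : ContDiffOn ℝ 2 f Ωᶜ) : AEMeasurable
      (fun x => ENNReal.ofReal (Real.sqrt (detMetric Ωᶜ f x))) (volume.restrict Ωᶜ) := by
  have h1 : ContinuousOn (fun x => (metricJ (jet1 Ωᶜ f x)).det) Ωᶜ := by
    have h2 : Continuous fun U : Matrix (Fin m) (Fin n) ℝ => (metricJ U).det := by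
      unfold metricJ; fun_prop
    have h3 := h2.comp_continuousOn (continuousOn_jet1 (uniqueDiffOn_compl hlip) hf)
    exact h3
  have h4 : (fun x => Real.sqrt (detMetric Ωᶜ f x)) =
      fun x => Real.sqrt ((metricJ (jet1 Ωᶜ f x)).det) := by
    ext1 x; rw [detMetric, metric_eq]
  have h5 : AEMeasurable (fun x => Real.sqrt (detMetric Ωᶜ f x)) (volume.restrict Ωᶜ) := by
    rw [h4]
    exact (h1.sqrt.aestronglyMeasurable hΩ.measurableSet.compl).aemeasurable
  exact h5.ennreal_ofReal

lemma sqrt_detMetric_smul (F : E n → ℝ) (x : E n) :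
    (ENNReal.ofReal (Real.sqrt (detMetric Ωᶜ f x))).toReal •
      (F x * (1 / Real.sqrt (detMetric Ωᶜ f x))) = F x := by
  have := Real.sqrt_pos.2 (detMetric_pos (f := f) Ωᶜ x)
  rw [ENNReal.toReal_ofReal this.le, smul_eq_mul]
  field_simp

/-- The volume density √G cancels the weight 1/√G, so integrals over M reduce to Lebesgue integrals
over the domain. -/
lemma integrable_volumeM_iff (hlip : HasLipschitzBoundary Ω) (hΩ : IsOpen Ω)
    (hf : ContDiffOn ℝ 2 f Ωᶜ) (F : E n → ℝ) :
    Integrable (fun x => F x * (1 / Real.sqrt (detMetric Ωᶜ f x))) (volumeM Ωᶜ f) ↔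
      IntegrableOn F Ωᶜ := by
  rw [volumeM, integrable_withDensity_iff_integrable_smul₀' (volumeM_density hlip hΩ hf)
    (.of_forall fun _ => ENNReal.ofReal_lt_top)]
  simp only [sqrt_detMetric_smul]
  rfl

lemma integral_volumeM (hlip : HasLipschitzBoundary Ω) (hΩ : IsOpen Ω)
    (hf : ContDiffOn ℝ 2 f Ωᶜ) (F : E n → ℝ) :
    ∫ x, F x * (1 / Real.sqrt (detMetric Ωᶜ f x)) ∂(volumeM Ωᶜ f) = ∫ x in Ωᶜ, F x := by
  rw [volumeM, integral_withDensity_eq_integral_toReal_smul₀ (volumeM_density hlip hΩ hf)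
    (.of_forall fun _ => ENNReal.ofReal_lt_top)]
  simp only [sqrt_detMetric_smul]

end Mass

end GraphMass

end

theorem theorem1p2 {n m : ℕ} (hn : 2 ≤ n) (Ω : Set (GraphMass.E n))
    (hΩ_open : IsOpen Ω) (hΩ_bdd : Bornology.IsBounded Ω)
    (hΩ_lip : GraphMass.HasLipschitzBoundary Ω)
    (f : GraphMass.E n → GraphMass.E m) (hf : GraphMass.IsAsymptoticallyFlat Ω f)
    (hconst : ∀ x ∈ frontier Ω, ∀ y ∈ connectedComponentIn (frontier Ω) x, f y = f x) :
    Integrable (fun x => (GraphMass.scalarCurv Ωᶜ f x + GraphMass.sPerp Ωᶜ f x) *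
        (1 / Real.sqrt (GraphMass.detMetric Ωᶜ f x))) (GraphMass.volumeM Ωᶜ f) ∧
    IntegrableOn (fun x => GraphMass.normSqDf Ωᶜ f x / (1 + GraphMass.normSqDf Ωᶜ f x) *
        GraphMass.meanCurv Ω x) (frontier Ω) GraphMass.area ∧
    GraphMass.HasADMMass (GraphMass.metric Ωᶜ f)
      (1 / (2 * ((n : ℝ) - 1) * GraphMass.sphereArea n) *
        ((∫ x, (GraphMass.scalarCurv Ωᶜ f x + GraphMass.sPerp Ωᶜ f x) *
            (1 / Real.sqrt (GraphMass.detMetric Ωᶜ f x)) ∂(GraphMass.volumeM Ωᶜ f)) +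
          ∫ x in frontier Ω, GraphMass.normSqDf Ωᶜ f x / (1 + GraphMass.normSqDf Ωᶜ f x) *
            GraphMass.meanCurv Ω x ∂GraphMass.area)) := by
  open GraphMass in
  have hm : MeasurableSet Ωᶜ := hΩ_open.measurableSet.compl
  have hK := uniqueDiffOn_compl hΩ_lip
  have hsum : Set.EqOn (fun x => scalarCurv Ωᶜ f x + sPerp Ωᶜ f x)
      (fun x => divJ (jet1 Ωᶜ f x) (jet2 Ωᶜ f x)) Ωᶜ := fun x hx =>
    scalarCurv_add_sPerp _ _ _
      (jet2_symm hK hf.contDiffOn hx (compl_subset_closure_interior hΩ_lip hx))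
  have hint := hf.integrableOn_divJ hn hΩ_open hΩ_lip
  obtain ⟨R, hR⟩ := hΩ_bdd.subset_closedBall 0
  have hflux := fun (r : ℝ) (hr : R < r) (hr0 : 0 < r) =>
    integral_sphere_flux hΩ_open hΩ_lip hf.contDiffOn hconst hR hr hr0
  refine ⟨?_, ?_, ?_⟩
  · rw [integrable_volumeM_iff hΩ_lip hΩ_open hf.contDiffOn]
    exact hint.congr_fun (fun x hx => (hsum hx).symm) hm
  -- Any positive radius beyond R serves, since the integrability over Σ does not involve the
  -- sphere.
  · exact (hflux (max R 0 + 1) (by linarith [le_max_left R 0])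
      (by linarith [le_max_right R 0])).1
  · rw [HasADMMass, integral_volumeM hΩ_lip hΩ_open hf.contDiffOn, setIntegral_congr_fun hm hsum]
    refine Tendsto.const_mul _ ?_
    obtain ⟨d, hd, hd0⟩ := tendsto_integral_sphere_sub hn hΩ_lip hf hR
    have hvol : Tendsto (fun r : ℝ => ∫ x in Ωᶜ ∩ Metric.closedBall 0 r,
        divJ (jet1 Ωᶜ f x) (jet2 Ωᶜ f x)) atTop
        (𝓝 (∫ x in Ωᶜ, divJ (jet1 Ωᶜ f x) (jet2 Ωᶜ f x))) := by
      have hU : ⋃ r : ℝ, Ωᶜ ∩ Metric.closedBall (0 : E n) r = Ωᶜ := by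
        rw [← Set.inter_iUnion, Set.eq_univ_of_forall fun x => Set.mem_iUnion.2
          ⟨‖x‖, mem_closedBall_zero_iff.2 le_rfl⟩, Set.inter_univ]
      have := tendsto_setIntegral_of_monotone (μ := volume)
        (s := fun r : ℝ => Ωᶜ ∩ Metric.closedBall (0 : E n) r)
        (f := fun x => divJ (jet1 Ωᶜ f x) (jet2 Ωᶜ f x))
        (fun r => hm.inter Metric.isClosed_closedBall.measurableSet)
        (fun r s hrs => Set.inter_subset_inter_right _ (Metric.closedBall_subset_closedBall hrs))
        (by rwa [hU])
      rwa [hU] at this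
    have hlim := (hvol.add_const (∫ x in frontier Ω,
      normSqDf Ωᶜ f x / (1 + normSqDf Ωᶜ f x) * meanCurv Ω x ∂area)).add hd0
    rw [add_zero] at hlim
    -- For large r the ADM integral equals the volume integral over the truncated domain, plus the
    -- integral over Σ, plus the vanishing error.
    refine hlim.congr' ?_
    filter_upwards [hd, eventually_gt_atTop R, eventually_gt_atTop 0] with r hr hrR hr0
    rw [setIntegral_congr_fun Metric.isClosed_sphere.measurableSet hr.2,
      integral_add (hflux r hrR hr0).2.1 hr.1, (hflux r hrR hr0).2.2]
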